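/- Fix $d\ge 1$ and $\gamma\in(0,\infty)$. Let $\xi=(\xi_t)_{t\ge 0}$, $\xi_t=\{\xi(x,t):x\in\mathbb Z^d\}$, be a real-valued (jointly measurable) random field, with law $\mathbb P$ and expectation $\mathbb E$, that is stationary and ergodic under translations in space and time, is not constant, and has finite mean $\rho=\mathbb E(\xi(0,0))\in\mathbb R$. For $\kappa,\gamma'\in[0,\infty)$ let $X^\kappa$ be simple random walk on $\mathbb Z^d$ stepping at rate $2d\kappa$, and let $$u_{\kappa,\gamma'}(x,t)=\mathrm E_x\Big(\exp\Big[\gamma'\int_0^t\xi(X^\kappa(s),t-s)\,ds\Big]\,1_{\{X^\kappa(t)=0\}}\Big)$$ be the Feynman–Kac solution of the parabolic Anderson model $\partial_t u=\kappa\Delta u+\gamma'\xi u$, $u(\cdot,0)=\delta_0$, where $\Delta u(x,t)=\sum_{\|y-x\|=1}[u(y,t)-u(x,t)]$. Assume that for all $\kappa,\gamma'\in[0,\infty)$ there is a $c(\kappa,\gamma')<\infty$ with $\mathbb E(\log u_{\kappa,\gamma'}(0,t))\le c(\kappa,\gamma')\,t$ for all $t\ge 0$. Put $I^\xi(x,t)=\int_0^t[\xi(x,s)-\rho]\,ds$.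 Then for every $\kappa>0$ the quenched Lyapunov exponent $\lambda_0(\kappa)=\lim_{t\to\infty}\frac1t\log u_{\kappa,\gamma}(0,t)$ exists $\mathbb P$-almost surely and is a finite constant, and the following hold. (i) If $\xi$ is bounded from below and, for some nearest neighbour $e$ of $0$, $$\liminf_{t\to\infty}\tfrac1t\,\mathbb E\big(|I^\xi(0,t)-I^\xi(e,t)|^2\big)>0,\qquad \limsup_{t\to\infty}\tfrac1{t^2}\,\mathbb E\big(|I^\xi(0,t)|^4\big)<\infty,$$ then $$\liminf_{\kappa\downarrow 0}\,\log(1/\kappa)\,[\lambda_0(\kappa)-\rho\gamma]>0.$$ (ii) If $\xi$ is a time-homogeneous Markov process with state space $S\subset\mathbb R^{\mathbb Z^d}$ and with law $\mathbb P_\eta$ when started from $\xi_0=\eta\in S$, is bounded from above, and $$\limsup_{t\to\infty}\frac1{t^{2/3}}\log\Big[\sup_{\eta\in S}\mathbb P_\eta\big(I^\xi(0,t)>t^{5/6}\big)\Big]<0,$$ then $$\limsup_{\kappa\downarrow 0}\,[\log(1/\kappa)]^{1/6}\,[\lambda_0(\kappa)-\rho\gamma]<\infty.$$ (iii) If $\xi$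 is such a Markov process, is bounded from above, and there is a $c<\infty$ with $$\sup_{\eta\in S}\mathbb E_\eta\big(\exp[\mu I^\xi(0,t)]\big)\le\exp[c\mu^2t]\qquad\text{for all }\mu,t>0\text{ with }\mu t\ge 1,$$ then $$\limsup_{\kappa\downarrow 0}\,\frac{\log(1/\kappa)}{\log\log(1/\kappa)}\,[\lambda_0(\kappa)-\rho\gamma]<\infty.$$ -/

import Mathlib

open MeasureTheory ProbabilityTheory Filter Topology Set
open scoped NNReal ENNReal

noncomputable section

namespace PAM

/-- Sites of the lattice `ℤ^d`. -/
abbrev Site (d : ℕ) : Type := Fin d → ℤ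

/-- Real-valued configurations on `ℤ^d`, with the product `σ`-algebra. -/
abbrev Config (d : ℕ) : Type := Site d → ℝ

/-- `e` is a nearest neighbour of the origin. For an integer vector, Euclidean norm `1` and
`ℓ¹`-norm `1` mean the same. -/
def IsNeighborOfZero {d : ℕ} (e : Site d) : Prop := ∑ i, |e i| = 1

/-! ### Simple random walk in continuous time -/

/-- The driving randomness of the walk: a holding time and a direction for each jump. -/
abbrev WalkSpace (d : ℕ) : Type := ℕ → ℝ × (Fin d × Bool)

/-- Holding times are exponential with mean `1`, directions are uniform on the `2d` unit vectors,
and everything is independent. -/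
def walkLaw (d : ℕ) [NeZero d] : Measure (WalkSpace d) :=
  haveI : IsProbabilityMeasure (expMeasure 1) := isProbabilityMeasure_expMeasure one_pos
  Measure.infinitePi fun _ : ℕ =>
    (expMeasure 1).prod (PMF.uniformOfFintype (Fin d × Bool)).toMeasure

/-- The unit vector encoded by a coordinate and a sign. -/
def unitStep {d : ℕ} (p : Fin d × Bool) : Site d := Pi.single p.1 (if p.2 then 1 else -1)

/-- The time of the `(n+1)`-st jump. -/
def jumpTime {d : ℕ} (w : WalkSpace d) (n : ℕ) : ℝ := ∑ i ∈ Finset.range (n + 1), (w i).1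

/-- The number of jumps in `[0, t]`. -/
def jumpCount {d : ℕ} (w : WalkSpace d) (t : ℝ) : ℕ := {n : ℕ | jumpTime w n ≤ t}.ncard

/-- Simple random walk started at `0` with total jump rate `1`. -/
def walk {d : ℕ} (w : WalkSpace d) (t : ℝ) : Site d :=
  ∑ n ∈ Finset.range (jumpCount w t), unitStep (w n).2

/-- Simple random walk `X^κ` started at `0`, stepping at rate `2dκ`. -/
def walkAt {d : ℕ} (κ : ℝ) (w : WalkSpace d) (t : ℝ) : Site d := walk w (2 * d * κ * t)

/-! ### The solution of the parabolic Anderson model -/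

/-- The Feynman-Kac solution `u(x,t)` of `∂u/∂t = κ Δ u + γ ξ u`, `u(·,0) = δ₀`, in a given
realisation `v` of the environment:
`u(x,t) = E_x (exp (γ ∫₀ᵗ ξ(X^κ(s), t - s) ds) 1{X^κ(t) = 0})`, as an element of `[0,∞]`. -/
def pamSol {d : ℕ} [NeZero d] (v : ℝ≥0 → Config d) (κ γ : ℝ) (x : Site d) (t : ℝ) : ℝ≥0∞ :=
  ∫⁻ w, {w' : WalkSpace d | x + walkAt κ w' t = 0}.indicator
    (fun w' => ENNReal.ofReal
      (Real.exp (γ * ∫ s in (0 : ℝ)..t, v (t - s).toNNReal (x + walkAt κ w' s)))) w ∂(walkLaw d)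

section Environment

variable {d : ℕ} {Ω : Type*} [MeasurableSpace Ω]

/-- The trajectory `t ↦ ξ_t(ω)` of the environment. -/
def path (ξ : ℝ≥0 → Ω → Config d) (ω : Ω) : ℝ≥0 → Config d := fun t => ξ t ω

/-- The space-time shift of a trajectory by the time `s` and the site `y`. -/
def shift (s : ℝ≥0) (y : Site d) (v : ℝ≥0 → Config d) : ℝ≥0 → Config d :=
  fun t x => v (s + t) (y + x)

/-- The law of `ξ` is invariant under translations in space and time. -/
def IsStationary (P : Measure Ω) (ξ : ℝ≥0 → Ω → Config d) : Prop :=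
  ∀ (s : ℝ≥0) (y : Site d), P.map (fun ω => shift s y (path ξ ω)) = P.map (path ξ)

/-- Every event of the trajectory space that is invariant, up to null sets, under all translations
in space and time has probability `0` or `1`. -/
def IsErgodic (P : Measure Ω) (ξ : ℝ≥0 → Ω → Config d) : Prop :=
  ∀ A : Set (ℝ≥0 → Config d), MeasurableSet A →
    (∀ (s : ℝ≥0) (y : Site d), ∀ᵐ ω ∂P, (shift s y (path ξ ω) ∈ A ↔ path ξ ω ∈ A)) →
    P (path ξ ⁻¹' A) = 0 ∨ P (path ξ ⁻¹' A) = 1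

/-- The mean `ρ` of the environment. -/
def density (P : Measure Ω) (ξ : ℝ≥0 → Ω → Config d) : ℝ := ∫ ω, ξ 0 ω 0 ∂P

/-- The standing assumptions on the dynamic random environment: it is jointly measurable in time
and randomness, stationary and ergodic, not constant, has a finite mean, and
`E (log u(0,t)) ≤ c(κ,γ) t` for all `κ, γ, t ≥ 0`, where `u` is the solution of the parabolic
Anderson model (the bound contains that `log u(0,t)` has a finite expectation). -/
structure IsEnvironment [NeZero d] (P : Measure Ω) (ξ : ℝ≥0 → Ω → Config d) : Prop where
  measurable : Measurable fun p : ℝ≥0 × Ω => ξ p.1 p.2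
  stationary : IsStationary P ξ
  ergodic : IsErgodic P ξ
  not_constant : ¬ ∃ c : ℝ, ∀ (t : ℝ≥0) (x : Site d), ∀ᵐ ω ∂P, ξ t ω x = c
  integrable : Integrable (fun ω => ξ 0 ω 0) P
  log_bound : ∀ κ γ : ℝ, 0 ≤ κ → 0 ≤ γ → ∃ c : ℝ, ∀ t : ℝ, 0 ≤ t →
    (∀ᵐ ω ∂P, pamSol (path ξ ω) κ γ 0 t < ⊤) ∧
    Integrable (fun ω => Real.log (pamSol (path ξ ω) κ γ 0 t).toReal) P ∧
    ∫ ω, Real.log (pamSol (path ξ ω) κ γ 0 t).toReal ∂P ≤ c * t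

/-- `l` is the quenched Lyapunov exponent: almost surely, `u(0,t)` is positive and finite for all
`t ≥ 0` and `(1/t) log u(0,t) → l` as `t → ∞`. -/
def IsQuenchedLyapunov [NeZero d] (P : Measure Ω) (ξ : ℝ≥0 → Ω → Config d) (γ κ l : ℝ) : Prop :=
  ∀ᵐ ω ∂P, (∀ t : ℝ, 0 ≤ t → 0 < pamSol (path ξ ω) κ γ 0 t ∧ pamSol (path ξ ω) κ γ 0 t < ⊤) ∧
    Tendsto (fun t : ℝ => 1 / t * Real.log (pamSol (path ξ ω) κ γ 0 t).toReal) atTop (𝓝 l)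

/-- `I^ξ(x,t) = ∫₀ᵗ (ξ(x,s) - ρ) ds`. -/
def cumulative (ξ : ℝ≥0 → Ω → Config d) (ρ : ℝ) (x : Site d) (t : ℝ) (ω : Ω) : ℝ :=
  ∫ s in (0 : ℝ)..t, (ξ s.toNNReal ω x - ρ)

/-- `liminf_{t→∞} t⁻¹ E(|I(0,t) - I(e,t)|²) > 0` and `limsup_{t→∞} t⁻² E(|I(0,t)|⁴) < ∞`. -/
def MomentCondition (P : Measure Ω) (ξ : ℝ≥0 → Ω → Config d) (e : Site d) : Prop :=
  0 < liminf (fun t : ℝ =>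
      (∫⁻ ω, ENNReal.ofReal (|cumulative ξ (density P ξ) 0 t ω
          - cumulative ξ (density P ξ) e t ω| ^ 2) ∂P) / ENNReal.ofReal t) atTop ∧
  limsup (fun t : ℝ =>
      (∫⁻ ω, ENNReal.ofReal (|cumulative ξ (density P ξ) 0 t ω| ^ 4) ∂P)
        / ENNReal.ofReal (t ^ 2)) atTop < ⊤

/-- `ξ` is bounded from below. -/
def IsBoundedBelow (P : Measure Ω) (ξ : ℝ≥0 → Ω → Config d) : Prop :=
  ∃ M : ℝ, ∀ (t : ℝ≥0) (x : Site d), ∀ᵐ ω ∂P, M ≤ ξ t ω x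

/-- `ξ` is bounded from above. -/
def IsBoundedAbove (P : Measure Ω) (ξ : ℝ≥0 → Ω → Config d) : Prop :=
  ∃ M : ℝ, ∀ (t : ℝ≥0) (x : Site d), ∀ᵐ ω ∂P, ξ t ω x ≤ M

/-- Under `Q`, the law of `(ξ_{t+s})_{s ≥ 0}` given `(ξ_s)_{s ≤ t}` is the law of `ξ` under
`Pstart η` with `η = ξ_t`. -/
def HasMarkovProperty (Q : Measure Ω) (ξ : ℝ≥0 → Ω → Config d) {S : Set (Config d)}
    (hS : ∀ t ω, ξ t ω ∈ S) (Pstart : Kernel S Ω) : Prop :=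
  ∀ (t : ℝ≥0) (B : Set Ω),
    MeasurableSet[⨆ s : Set.Iic t, MeasurableSpace.comap (ξ s) inferInstance] B →
    ∀ A : Set (ℝ≥0 → Config d), MeasurableSet A →
      Q (B ∩ {ω | shift t 0 (path ξ ω) ∈ A})
        = ∫⁻ ω in B, Pstart ⟨ξ t ω, hS t ω⟩ (path ξ ⁻¹' A) ∂Q

/-- `ξ` is a time-homogeneous Markov process with state space `S`: `Pstart η` is the law of the
process started from `η ∈ S`, and the Markov property holds under each of these laws and
under `P`. -/
structure IsMarkovProcess (P : Measure Ω) (ξ : ℝ≥0 → Ω → Config d) (S : Set (Config d))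
    (Pstart : Kernel S Ω) : Prop where
  isMarkovKernel : IsMarkovKernel Pstart
  mem_state : ∀ t ω, ξ t ω ∈ S
  start : ∀ η : S, ∀ᵐ ω ∂(Pstart η), ξ 0 ω = η
  markov_start : ∀ η : S, HasMarkovProperty (Pstart η) ξ mem_state Pstart
  markov : HasMarkovProperty P ξ mem_state Pstart

/-- `limsup_{t→∞} t^{-2/3} log (sup_η P_η (I(0,t) > t^{5/6})) < 0`. -/
def WeakDeviationCondition (ξ : ℝ≥0 → Ω → Config d) (ρ : ℝ) {S : Set (Config d)}
    (Pstart : Kernel S Ω) : Prop :=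
  limsup (fun t : ℝ =>
    ENNReal.log (⨆ η : S, Pstart η {ω | t ^ (5 / 6 : ℝ) < cumulative ξ ρ 0 t ω})
      / ((t ^ (2 / 3 : ℝ) : ℝ) : EReal)) atTop < 0

/-- There is a finite `c` with `sup_η E_η (exp (μ I(0,t))) ≤ exp (c μ² t)` for all `μ, t > 0` with
`μ t ≥ 1`. -/
def ExpDeviationCondition (ξ : ℝ≥0 → Ω → Config d) (ρ : ℝ) {S : Set (Config d)}
    (Pstart : Kernel S Ω) : Prop :=
  ∃ c : ℝ, ∀ μ t : ℝ, 0 < μ → 0 < t → 1 ≤ μ * t →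
    ⨆ η : S, ∫⁻ ω, ENNReal.ofReal (Real.exp (μ * cumulative ξ ρ 0 t ω)) ∂(Pstart η)
      ≤ ENNReal.ofReal (Real.exp (c * μ ^ 2 * t))

end Environment

end PAM

end

/-! Existence of the exponent. The environment is read backwards in the Feynman–Kac formula, so the
Markov property of the walk (`measurePreserving_concat`) bounds the solution from below by a product
over two time intervals (`LocInt.mul_le_pamSol`). Thus `log u(0,t)` is superadditive under time
shifts, and `lyapunov`, the supremum of the mean growth rates, is the candidate for the limit.
Ergodicity is only given for space and time shifts jointly, so the time shift alone may fail to be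
ergodic and a subadditive ergodic theorem for it need not produce a constant. Instead, travelling
between two fixed sites costs only `o(t)` (`IsEnvironment.ae_eventually_logSol_shift_le`), so events
about the growth rate are invariant under all space-time shifts and have probability 0 or 1
(`IsEnvironment.zero_one`). The wrong alternative is excluded by a covering argument in the style of
Katznelson and Weiss (`superadditive_exists_integral_ge`): it would contradict the mean growth
rates. Waiting at the origin fills the gaps between the points of a time grid.

Lower bound. During a time `T` the walk may stay at `0`, or visit the neighbour `e` and return.
Taking the better option gains `γ/2` times the mean absolute difference of the two occupation
integrals, which the moment conditions make at least of order `√T`; the visit costs two jumps, about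
`2 log(1/κ)`. Since the mean rate at one single time already bounds the exponent from below, `T` of
order `log²(1/κ)` gives an excess of order `1 / log(1/κ)`.

Upper bounds. Let `Z_t` be the total mass at time `t`, without the constraint on the endpoint, and
consider `E Z_t^p` with small `p ≤ 1`. In a time block of length `T = c log(1/κ)` the walk either
does not jump, and collects the field at one fixed site, or it jumps. In the first case the Markov
property of the environment and the uniform deviation bounds give a factor `b`. In the second the
jump costs about `κT`, while the field, bounded by `M`, gains at most `κ^{-1/2}` over `exp (γ ρ T)`
if `c` is small. As `p ≤ 1`, the `p`-th power of the sum over landing sites is at most the sum of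
the `p`-th powers, and by stationarity all sites have the same moment. Hence `E Z_{t+T}^p ≤ e^{pγρT}
(b + C κ^{p/4}) E Z_t^p`, and a Jensen-type inequality bounds the exponent
(`IsMarkovProcess.lyapunov_le`). The two upper bounds come from `p` of order `T^{-1/3}` and `log
log(1/κ) / log(1/κ)`.

Measurability. Stationarity and the Markov property speak of the product `σ`-algebra on
trajectories, for which time integrals are not measurable. By the strong law, integrals are almost
surely limits of averages over randomly chosen, then frozen, sampling times. This gives versions
that depend on countably many times, and only on the past (`ae_fkOn_eq_sampledFkOn`). -/

noncomputable section

set_option linter.unusedSectionVars false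

namespace PAM

/-! ### The driving sequence of the walk: product law, jump times and jump counts. -/

section Walk

variable {d : ℕ}

lemma expMeasure_one_eq : expMeasure 1 = volume.withDensity (exponentialPDF 1) := rfl

lemma measurable_exponentialPDF_one : Measurable (exponentialPDF 1) :=
  (measurable_exponentialPDFReal 1).ennreal_ofReal

lemma expMeasure_one_Iic {t : ℝ} (ht : 0 ≤ t) :
    expMeasure 1 (Iic t) = ENNReal.ofReal (1 - Real.exp (-t)) := by
  rw [expMeasure_one_eq, withDensity_apply _ measurableSet_Iic,
    lintegral_exponentialPDF_eq_antiDeriv one_pos, if_pos ht, one_mul]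

lemma expMeasure_one_Ioi {t : ℝ} (ht : 0 ≤ t) :
    expMeasure 1 (Ioi t) = ENNReal.ofReal (Real.exp (-t)) := by
  have : IsProbabilityMeasure (expMeasure 1) := isProbabilityMeasure_expMeasure one_pos
  have h1 : Real.exp (-t) ≤ 1 := Real.exp_le_one_iff.2 (by linarith)
  rw [← compl_Iic, prob_compl_eq_one_sub measurableSet_Iic, expMeasure_one_Iic ht,
    ← ENNReal.ofReal_one, ← ENNReal.ofReal_sub _ (by linarith)]
  congr 1; ring

/-- The exponential law is memoryless. -/
lemma setLIntegral_Ioi_expMeasure_one {s : ℝ} (hs : 0 ≤ s) {f : ℝ → ℝ≥0∞} (hf : Measurable f) :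
    ∫⁻ x in Ioi s, f x ∂(expMeasure 1)
      = ENNReal.ofReal (Real.exp (-s)) * ∫⁻ x, f (s + x) ∂(expMeasure 1) := by
  have hm := measurable_exponentialPDF_one
  rw [expMeasure_one_eq, setLIntegral_withDensity_eq_setLIntegral_mul _ hm hf measurableSet_Ioi,
    lintegral_withDensity_eq_lintegral_mul _ hm (by fun_prop),
    ← lintegral_const_mul _ (by fun_prop),
    ← lintegral_indicator measurableSet_Ioi,
    ← lintegral_add_left_eq_self _ s]
  refine lintegral_congr_ae ?_
  have h0 : ∀ᵐ x : ℝ, x ≠ 0 := by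
    simp [ae_iff]
  filter_upwards [h0] with x hx
  rcases lt_or_gt_of_ne hx with h | h
  · rw [indicator_of_notMem (by simp; linarith)]
    simp [exponentialPDF_of_neg h]
  · rw [indicator_of_mem (by simp; linarith)]
    simp only [Pi.mul_apply]
    rw [exponentialPDF_of_nonneg h.le, exponentialPDF_of_nonneg (by linarith), ← mul_assoc,
      ← ENNReal.ofReal_mul (Real.exp_nonneg _)]
    congr 2
    rw [one_mul, one_mul, one_mul, one_mul, ← Real.exp_add]
    congr 1; ring

/-- The law of one step of the walk: a holding time and a direction. -/
def stepLaw (d : ℕ) [NeZero d] : Measure (ℝ × (Fin d × Bool)) :=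
  (expMeasure 1).prod (PMF.uniformOfFintype (Fin d × Bool)).toMeasure

variable [NeZero d]

instance : IsProbabilityMeasure (stepLaw d) := by
  have : IsProbabilityMeasure (expMeasure 1) := isProbabilityMeasure_expMeasure one_pos
  unfold stepLaw; infer_instance

lemma walkLaw_eq : walkLaw d = Measure.infinitePi fun _ : ℕ => stepLaw d := rfl

instance : IsProbabilityMeasure (walkLaw d) := by
  rw [walkLaw_eq]; infer_instance

lemma stepLaw_prod {A : Set ℝ} {D : Set (Fin d × Bool)} :
    stepLaw d (A ×ˢ D)
      = expMeasure 1 A * (PMF.uniformOfFintype (Fin d × Bool)).toMeasure D := by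
  have : IsProbabilityMeasure (expMeasure 1) := isProbabilityMeasure_expMeasure one_pos
  rw [stepLaw, Measure.prod_prod]

/-- The restart of the walk in `prod_concat_box` rests on this: a holding time that outlives `s` has
a fresh exponential excess, independent of the direction. -/
lemma stepLaw_memoryless {s : ℝ} (hs : 0 ≤ s) {B : Set (ℝ × (Fin d × Bool))}
    (hB : MeasurableSet B) :
    stepLaw d (B ∩ {q | s < q.1})
      = ENNReal.ofReal (Real.exp (-s)) * stepLaw d {q | (s + q.1, q.2) ∈ B} := by
  have : IsProbabilityMeasure (expMeasure 1) := isProbabilityMeasure_expMeasure one_pos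
  have h1 : MeasurableSet (B ∩ {q : ℝ × (Fin d × Bool) | s < q.1}) :=
    hB.inter (measurableSet_lt measurable_const measurable_fst)
  have h2 : MeasurableSet {q : ℝ × (Fin d × Bool) | (s + q.1, q.2) ∈ B} :=
    hB.preimage (by fun_prop)
  have h3 : Measurable fun x => (PMF.uniformOfFintype (Fin d × Bool)).toMeasure
      (Prod.mk x ⁻¹' B) := measurable_measure_prodMk_left hB
  rw [stepLaw, Measure.prod_apply h1, Measure.prod_apply h2]
  have := setLIntegral_Ioi_expMeasure_one hs h3
  rw [← lintegral_indicator measurableSet_Ioi] at this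
  refine Eq.trans (lintegral_congr fun x => ?_) this
  by_cases hx : s < x
  · rw [indicator_of_mem (by exact hx)]
    congr 1; ext q; simp [hx]
  · rw [indicator_of_notMem (by exact hx)]
    convert measure_empty (μ := (PMF.uniformOfFintype (Fin d × Bool)).toMeasure)
    ext q; simp [hx]

lemma stepLaw_fst_gt {s : ℝ} (hs : 0 ≤ s) :
    stepLaw d {q | s < q.1} = ENNReal.ofReal (Real.exp (-s)) := by
  have : {q : ℝ × (Fin d × Bool) | s < q.1} = Ioi s ×ˢ univ := by ext; simp
  rw [this, stepLaw_prod, expMeasure_one_Ioi hs, measure_univ, mul_one]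

lemma stepLaw_fst_le {s : ℝ} (hs : 0 ≤ s) :
    stepLaw d {q | q.1 ≤ s} = ENNReal.ofReal (1 - Real.exp (-s)) := by
  have : {q : ℝ × (Fin d × Bool) | q.1 ≤ s} = Iic s ×ˢ univ := by ext; simp
  rw [this, stepLaw_prod, expMeasure_one_Iic hs, measure_univ, mul_one]

lemma stepLaw_fst_le_snd_eq {s : ℝ} (hs : 0 ≤ s) (p : Fin d × Bool) :
    stepLaw d {q | q.1 ≤ s ∧ q.2 = p}
      = ENNReal.ofReal (1 - Real.exp (-s)) * (2 * d : ℝ≥0∞)⁻¹ := by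
  have : {q : ℝ × (Fin d × Bool) | q.1 ≤ s ∧ q.2 = p} = Iic s ×ˢ {p} := by ext; simp
  rw [this, stepLaw_prod, expMeasure_one_Iic hs, PMF.toMeasure_apply_singleton _ _ (by simp)]
  simp [mul_comm]

/-- The walks all of whose first `n` steps lie in prescribed sets. -/
def box (n : ℕ) (B : ℕ → Set (ℝ × (Fin d × Bool))) : Set (WalkSpace d) := {w | ∀ i < n, w i ∈ B i}

lemma box_eq_pi (n : ℕ) (B : ℕ → Set (ℝ × (Fin d × Bool))) :
    box n B = Set.pi (Finset.range n) B := by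
  ext w; simp [box]

lemma measurableSet_box (n : ℕ) {B : ℕ → Set (ℝ × (Fin d × Bool))}
    (hB : ∀ i, MeasurableSet (B i)) : MeasurableSet (box n B) := by
  rw [box_eq_pi]
  exact MeasurableSet.pi (Finset.countable_toSet _) fun i _ => hB i

lemma walkLaw_box (n : ℕ) {B : ℕ → Set (ℝ × (Fin d × Bool))} (hB : ∀ i, MeasurableSet (B i)) :
    walkLaw d (box n B) = ∏ i ∈ Finset.range n, stepLaw d (B i) := by
  rw [box_eq_pi, walkLaw_eq, Measure.infinitePi_pi _ fun i _ => hB i]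

/-- A cylinder over finitely many coordinates is an initial box padded with `univ`, and cylinders
determine the infinite product. Initial boxes suit induction on the number of steps. -/
lemma eq_walkLaw {μ : Measure (WalkSpace d)}
    (h : ∀ (n : ℕ) (B : ℕ → Set (ℝ × (Fin d × Bool))), (∀ i, MeasurableSet (B i)) →
      μ (box n B) = ∏ i ∈ Finset.range n, stepLaw d (B i)) : μ = walkLaw d := by
  classical
  rw [walkLaw_eq]
  refine Measure.eq_infinitePi _ fun s t ht => ?_
  obtain ⟨n, hn⟩ := s.exists_nat_subset_range
  have h1 : Set.pi (s : Set ℕ) t = box n fun i => if i ∈ s then t i else univ := by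
    ext w
    simp only [Set.mem_pi, Finset.mem_coe, box, mem_ofPred_eq]
    constructor
    · intro H i _
      by_cases hi : i ∈ s
      · simpa [hi] using H i hi
      · simp [hi]
    · intro H i hi
      have := H i (Finset.mem_range.1 (hn hi))
      rwa [if_pos hi] at this
  rw [h1, h _ _ (fun i => by by_cases hi : i ∈ s <;> simp [hi, ht])]
  rw [← Finset.prod_subset hn]
  · exact Finset.prod_congr rfl fun i hi => by simp [hi]
  · intro i _ hi; simp [hi]

/-- Put a step in front of a walk. -/
def consWalk (p : (ℝ × (Fin d × Bool)) × WalkSpace d) : WalkSpace d :=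
  fun n => Nat.casesOn n p.1 p.2

@[simp] lemma consWalk_zero (p : (ℝ × (Fin d × Bool)) × WalkSpace d) : consWalk p 0 = p.1 := rfl
@[simp] lemma consWalk_succ (p : (ℝ × (Fin d × Bool)) × WalkSpace d) (n : ℕ) :
    consWalk p (n + 1) = p.2 n := rfl

lemma measurable_consWalk : Measurable (consWalk (d := d)) := by
  refine measurable_pi_iff.2 fun n => ?_
  cases n with
  | zero => exact measurable_fst
  | succ n => exact (measurable_pi_apply n).comp measurable_snd

lemma measurePreserving_consWalk :
    MeasurePreserving consWalk ((stepLaw d).prod (walkLaw d)) (walkLaw d) := by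
  refine ⟨measurable_consWalk, eq_walkLaw fun n B hB => ?_⟩
  rw [Measure.map_apply measurable_consWalk (measurableSet_box n hB)]
  cases n with
  | zero => simp [box]
  | succ n =>
    have : consWalk ⁻¹' box (n + 1) B = B 0 ×ˢ box n fun i => B (i + 1) := by
      ext p
      simp only [box, mem_preimage, mem_ofPred_eq, mem_prod]
      constructor
      · exact fun H => ⟨H 0 (by simp), fun i hi => H (i + 1) (by omega)⟩
      · rintro ⟨h0, H⟩ i hi
        cases i with
        | zero => exact h0
        | succ i => exact H i (by omega)
    rw [this, Measure.prod_prod, walkLaw_box n fun i => hB (i + 1), Finset.prod_range_succ', mul_comm]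

/-- Holding times are positive and add up to infinity. -/
def GoodWalk (w : WalkSpace d) : Prop := (∀ n, 0 < (w n).1) ∧ ∀ t, ∃ n, t < jumpTime w n

lemma measurePreserving_eval_walkLaw (n : ℕ) :
    MeasurePreserving (fun w : WalkSpace d => w n) (walkLaw d) (stepLaw d) := by
  rw [walkLaw_eq]
  exact measurePreserving_eval_infinitePi (fun _ : ℕ => stepLaw d) n

lemma walkLaw_forall_le {t : ℝ} (ht : 0 ≤ t) (k : ℕ) :
    walkLaw d {w | ∀ i < k, (w i).1 ≤ t} = ENNReal.ofReal (1 - Real.exp (-t)) ^ k := by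
  have hB : ∀ i : ℕ, MeasurableSet {q : ℝ × (Fin d × Bool) | q.1 ≤ t} := fun _ =>
    measurableSet_le measurable_fst measurable_const
  have := walkLaw_box k hB
  rw [Finset.prod_congr rfl fun i _ => stepLaw_fst_le ht] at this
  simpa [box] using this

lemma jumpTime_zero (w : WalkSpace d) : jumpTime w 0 = (w 0).1 := by simp [jumpTime]

lemma jumpTime_succ (w : WalkSpace d) (n : ℕ) :
    jumpTime w (n + 1) = jumpTime w n + (w (n + 1)).1 := by
  simp [jumpTime, Finset.sum_range_succ]

lemma le_jumpTime {w : WalkSpace d} (hw : ∀ n, 0 < (w n).1) {i n : ℕ} (hi : i ≤ n) :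
    (w i).1 ≤ jumpTime w n :=
  Finset.single_le_sum (f := fun i => (w i).1) (fun j _ => (hw j).le)
    (Finset.mem_range.2 (by omega))

/-- Divergence of the jump times needs no law of large numbers: the first `k` holding times all stay
below `m` with probability `(1 - e^{-m})^k → 0`, and a single one above `m` carries the jump times
past `m`. -/
lemma ae_goodWalk : ∀ᵐ w ∂(walkLaw d), GoodWalk w := by
  have h1 : ∀ᵐ w ∂(walkLaw d), ∀ n, 0 < (w n).1 := by
    refine ae_all_iff.2 fun n => ?_
    have h : ∀ᵐ q ∂(stepLaw d), 0 < q.1 := by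
      rw [ae_iff]
      have := stepLaw_fst_le (d := d) le_rfl
      simpa using this
    exact (measurePreserving_eval_walkLaw n).quasiMeasurePreserving.ae h
  have h2 : ∀ᵐ w ∂(walkLaw d), ∀ m : ℕ, ∃ n, (m : ℝ) < (w n).1 := by
    refine ae_all_iff.2 fun m => ?_
    rw [ae_iff]
    have hlt : ENNReal.ofReal (1 - Real.exp (-(m : ℝ))) < 1 := by
      rw [← ENNReal.ofReal_one, ENNReal.ofReal_lt_ofReal_iff one_pos]
      linarith [Real.exp_pos (-(m : ℝ))]
    refine le_antisymm (ge_of_tendsto' (ENNReal.tendsto_pow_atTop_nhds_zero_of_lt_one hlt)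
      fun k => ?_) zero_le
    rw [← walkLaw_forall_le (d := d) (Nat.cast_nonneg m) k]
    refine measure_mono fun w hw => ?_
    simp only [mem_ofPred_eq, not_exists, not_lt] at hw ⊢
    exact fun i _ => hw i
  filter_upwards [h1, h2] with w hw1 hw2
  refine ⟨hw1, fun t => ?_⟩
  obtain ⟨m, hm⟩ := exists_nat_ge t
  obtain ⟨n, hn⟩ := hw2 m
  exact ⟨n, hm.trans_lt (hn.trans_le (le_jumpTime hw1 le_rfl))⟩

lemma GoodWalk.strictMono {w : WalkSpace d} (hw : GoodWalk w) : StrictMono (jumpTime w) :=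
  strictMono_nat_of_lt_succ fun n => by rw [jumpTime_succ]; linarith [hw.1 (n + 1)]

lemma GoodWalk.exists_eq {w : WalkSpace d} (hw : GoodWalk w) (t : ℝ) :
    ∃ N : ℕ, {n : ℕ | jumpTime w n ≤ t} = Set.Iio N := by
  classical
  have hex := hw.2 t
  refine ⟨Nat.find hex, ?_⟩
  ext n
  simp only [mem_ofPred_eq, mem_Iio, Nat.lt_find_iff, not_lt]
  exact ⟨fun h m hm => (hw.strictMono.monotone hm).trans h, fun h => h n le_rfl⟩

/-- `jumpCount` is an `ncard`, which is zero on infinite sets; for good walks the set is a finite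
initial segment of `ℕ` and the count means what it should. -/
lemma GoodWalk.lt_jumpCount {w : WalkSpace d} (hw : GoodWalk w) {t : ℝ} {n : ℕ} :
    n < jumpCount w t ↔ jumpTime w n ≤ t := by
  obtain ⟨N, hN⟩ := hw.exists_eq t
  have h1 : jumpCount w t = N := by
    rw [jumpCount, hN, ← Finset.coe_Iio, Set.ncard_coe_finset]; simp
  rw [h1, ← mem_Iio, ← hN]; rfl

lemma GoodWalk.jumpCount_eq {w : WalkSpace d} (hw : GoodWalk w) {t : ℝ} {N : ℕ}
    (h : ∀ n, jumpTime w n ≤ t ↔ n < N) : jumpCount w t = N := by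
  refine le_antisymm ?_ ?_
  · by_contra hc
    push Not at hc
    exact lt_irrefl _ ((h N).1 (hw.lt_jumpCount.1 hc))
  · by_contra hc
    push Not at hc
    exact lt_irrefl _ (hw.lt_jumpCount.2 ((h _).2 hc))

lemma GoodWalk.jumpCount_mono {w : WalkSpace d} (hw : GoodWalk w) {s t : ℝ} (h : s ≤ t) :
    jumpCount w s ≤ jumpCount w t := by
  by_contra hc
  push Not at hc
  exact lt_irrefl _ (hw.lt_jumpCount.2 ((hw.lt_jumpCount.1 hc).trans h))

lemma GoodWalk.jumpCount_of_nonpos {w : WalkSpace d} (hw : GoodWalk w) {t : ℝ} (ht : t ≤ 0) :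
    jumpCount w t = 0 :=
  hw.jumpCount_eq fun n => by
    have := (hw.1 0).trans_le (le_jumpTime hw.1 (Nat.zero_le n))
    simp; linarith

lemma measurable_jumpTime (n : ℕ) : Measurable fun w : WalkSpace d => jumpTime w n := by
  unfold jumpTime; fun_prop

lemma measurable_jumpCount : Measurable fun p : WalkSpace d × ℝ => jumpCount p.1 p.2 := by
  refine measurable_ncard.comp (measurable_set_iff.2 fun n => ?_)
  exact measurableSet_setOfPred.1 (measurableSet_le ((measurable_jumpTime n).comp measurable_fst)
      measurable_snd)

lemma measurable_walk : Measurable fun p : WalkSpace d × ℝ => walk p.1 p.2 := by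
  have h : Measurable fun q : WalkSpace d × ℕ => ∑ n ∈ Finset.range q.2, unitStep (q.1 n).2 := by
    refine measurable_from_prod_countable_left fun k => ?_
    refine measurable_pi_iff.2 fun i => ?_
    simp only [Finset.sum_apply]
    refine Finset.measurable_sum _ fun n _ => ?_
    exact (Measurable.of_discrete (f := fun p : Fin d × Bool => unitStep p i)).comp (by fun_prop)
  exact h.comp (measurable_fst.prodMk measurable_jumpCount)

end Walk

/-! ### Markov property of the walk. -/

section Concat

variable {d : ℕ} [NeZero d]

lemma jumpTime_consWalk_succ (q : ℝ × (Fin d × Bool)) (w : WalkSpace d) (n : ℕ) :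
    jumpTime (consWalk (q, w)) (n + 1) = q.1 + jumpTime w n := by
  rw [jumpTime, Finset.sum_range_succ', add_comm]
  rfl

lemma GoodWalk.consWalk {q : ℝ × (Fin d × Bool)} {w : WalkSpace d} (hq : 0 < q.1)
    (hw : GoodWalk w) : GoodWalk (consWalk (q, w)) := by
  refine ⟨fun n => ?_, fun t => ?_⟩
  · cases n with
    | zero => exact hq
    | succ n => exact hw.1 n
  · obtain ⟨n, hn⟩ := hw.2 (t - q.1)
    exact ⟨n + 1, by rw [jumpTime_consWalk_succ]; linarith⟩

lemma jumpCount_consWalk_of_lt {q : ℝ × (Fin d × Bool)} {w : WalkSpace d} (hq : 0 < q.1)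
    (hw : GoodWalk w) {s : ℝ} (hs : s < q.1) : jumpCount (consWalk (q, w)) s = 0 :=
  (hw.consWalk hq).jumpCount_eq fun n => by
    have h : q.1 ≤ jumpTime (PAM.consWalk (q, w)) n :=
      le_jumpTime (hw.consWalk hq).1 (Nat.zero_le n)
    simp; linarith

lemma jumpCount_consWalk_of_le {q : ℝ × (Fin d × Bool)} {w : WalkSpace d} (hq : 0 < q.1)
    (hw : GoodWalk w) {s : ℝ} (hs : q.1 ≤ s) :
    jumpCount (consWalk (q, w)) s = jumpCount w (s - q.1) + 1 :=
  (hw.consWalk hq).jumpCount_eq fun n => by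
    cases n with
    | zero => simp [jumpTime_zero, hs]
    | succ n =>
      rw [jumpTime_consWalk_succ, Nat.add_lt_add_iff_right, hw.lt_jumpCount]
      constructor <;> intro h <;> linarith

/-- The walk that follows `w` up to time `s` and then `w'`. -/
def concat (s : ℝ) (w w' : WalkSpace d) : WalkSpace d := fun k =>
  if k < jumpCount w s then w k
  else if k = jumpCount w s then
    -- The step in progress at time `s` is resampled: its holding time becomes the time elapsed
    -- since the last jump plus the first holding time of `w'`.
    (s - ∑ i ∈ Finset.range (jumpCount w s), (w i).1 + (w' 0).1, (w' 0).2)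
  else w' (k - jumpCount w s)

lemma measurable_jumpCount_left (s : ℝ) : Measurable fun w : WalkSpace d => jumpCount w s := by
  have h : Measurable fun w : WalkSpace d => (w, s) := measurable_prodMk_right
  simpa only [Function.comp_def] using measurable_jumpCount.comp h

lemma measurable_concat (s : ℝ) :
    Measurable fun p : WalkSpace d × WalkSpace d => concat s p.1 p.2 := by
  have hN : Measurable fun p : WalkSpace d × WalkSpace d => jumpCount p.1 s :=
    (measurable_jumpCount_left s).comp measurable_fst
  have h1 : Measurable fun p : WalkSpace d × WalkSpace d =>
      ∑ i ∈ Finset.range (jumpCount p.1 s), (p.1 i).1 := by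
    have h : Measurable fun q : WalkSpace d × ℕ => ∑ n ∈ Finset.range q.2, (q.1 n).1 :=
      measurable_from_prod_countable_left fun k => by
        simp only; fun_prop
    exact h.comp (measurable_fst.prodMk hN)
  refine measurable_pi_iff.2 fun k => ?_
  have h2 : Measurable fun p : WalkSpace d × WalkSpace d => p.2 (k - jumpCount p.1 s) := by
    have h : Measurable fun q : WalkSpace d × ℕ => q.1 (k - q.2) :=
      measurable_from_prod_countable_left fun j => by
        simp only; fun_prop
    exact h.comp (measurable_snd.prodMk hN)
  have h3 : Measurable fun p : WalkSpace d × WalkSpace d => p.1 k :=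
    (measurable_pi_apply k).comp measurable_fst
  have h4 : Measurable fun p : WalkSpace d × WalkSpace d => p.2 0 :=
    (measurable_pi_apply 0).comp measurable_snd
  exact Measurable.ite (measurableSet_lt measurable_const hN) h3
    (Measurable.ite (measurableSet_eq_fun measurable_const hN)
      (((measurable_const.sub h1).add h4.fst).prodMk h4.snd) h2)

lemma concat_consWalk_of_lt {q : ℝ × (Fin d × Bool)} {w : WalkSpace d} (hq : 0 < q.1)
    (hw : GoodWalk w) {s : ℝ} (hs : s < q.1) (w' : WalkSpace d) :
    concat s (consWalk (q, w)) w' = consWalk ((s + (w' 0).1, (w' 0).2), fun n => w' (n + 1)) := by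
  funext k
  simp only [concat, jumpCount_consWalk_of_lt hq hw hs]
  cases k <;> simp

lemma concat_consWalk_of_le {q : ℝ × (Fin d × Bool)} {w : WalkSpace d} (hq : 0 < q.1)
    (hw : GoodWalk w) {s : ℝ} (hs : q.1 ≤ s) (w' : WalkSpace d) :
    concat s (consWalk (q, w)) w' = consWalk (q, concat (s - q.1) w w') := by
  funext k
  simp only [concat, jumpCount_consWalk_of_le hq hw hs]
  cases k with
  | zero => simp
  | succ k =>
    simp only [consWalk_succ, concat, Nat.add_lt_add_iff_right, Nat.add_right_cancel_iff,
      Finset.sum_range_succ', consWalk_zero, Nat.add_sub_add_right]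
    rw [sub_add_eq_sub_sub_swap]

/-- Induction on the number of steps, for all `s` at once, by looking at the first holding time of
the first walk. If it exceeds `s`, the concatenation begins with `s` plus a fresh exponential time,
and memorylessness turns this into the part of `B 0` beyond `s`. Otherwise the first step is kept
and the restart happens after the remaining time `s - q.1`. The two parts add up to the measure of
`B 0`. -/
lemma prod_concat_box (n : ℕ) : ∀ (s : ℝ), 0 ≤ s → ∀ (B : ℕ → Set (ℝ × (Fin d × Bool))),
    (∀ i, MeasurableSet (B i)) →
    ((walkLaw d).prod (walkLaw d)) {p | concat s p.1 p.2 ∈ box n B}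
      = ∏ i ∈ Finset.range n, stepLaw d (B i) := by
  induction n with
  | zero => intro s _ B _; simp [box]
  | succ n ih =>
    intro s hs B hB
    have hB' : ∀ i, MeasurableSet (B (i + 1)) := fun i => hB _
    set Q := ∏ i ∈ Finset.range n, stepLaw d (B (i + 1))
    have hmeas : ∀ (s : ℝ) (n : ℕ) (B : ℕ → Set (ℝ × (Fin d × Bool))),
        (∀ i, MeasurableSet (B i)) →
        MeasurableSet {p : WalkSpace d × WalkSpace d | concat s p.1 p.2 ∈ box n B} :=
      fun s n B hB => (measurable_concat s) (measurableSet_box n hB)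
    rw [Measure.prod_apply (hmeas s _ B hB)]
    have hm1 := measurable_measure_prodMk_left (ν := walkLaw d) (hmeas s (n + 1) B hB)
    rw [← measurePreserving_consWalk.lintegral_comp hm1]
    refine (lintegral_prod _ (hm1.comp measurable_consWalk).aemeasurable).trans ?_
    have key : ∀ᵐ q ∂(stepLaw d), ∫⁻ w, walkLaw d (Prod.mk (consWalk (q, w)) ⁻¹'
        {p | concat s p.1 p.2 ∈ box (n + 1) B}) ∂(walkLaw d)
        = ({q | s < q.1}.indicator
            (fun _ => stepLaw d {q | (s + q.1, q.2) ∈ B 0}) q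
          + (B 0 ∩ {q | q.1 ≤ s}).indicator 1 q) * Q := by
      have hpos : ∀ᵐ q ∂(stepLaw d), 0 < q.1 := by
        rw [ae_iff]
        have := stepLaw_fst_le (d := d) le_rfl
        simpa using this
      filter_upwards [hpos] with q hq
      rcases lt_or_ge s q.1 with h | h
      · have h1 : ∀ᵐ w ∂(walkLaw d), walkLaw d (Prod.mk (consWalk (q, w)) ⁻¹'
            {p | concat s p.1 p.2 ∈ box (n + 1) B})
            = stepLaw d {q | (s + q.1, q.2) ∈ B 0} * Q := by
          filter_upwards [ae_goodWalk] with w hw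
          have h2 := walkLaw_box (d := d) (n + 1)
            (B := fun i => Nat.casesOn i {q | (s + q.1, q.2) ∈ B 0} fun i => B (i + 1))
            (fun i => by
              cases i with
              | zero => exact (hB 0).preimage (by fun_prop)
              | succ i => exact hB _)
          rw [Finset.prod_range_succ', mul_comm] at h2
          refine Eq.trans (congrArg _ ?_) h2
          ext w'
          simp only [mem_preimage, mem_ofPred_eq, concat_consWalk_of_lt hq hw h, box]
          refine forall₂_congr fun i _ => ?_
          cases i <;> simp
        rw [lintegral_congr_ae h1, lintegral_const, measure_univ, mul_one,
          indicator_of_mem (by exact h), indicator_of_notMem (by simp [h]), add_zero]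
      · have h1 : ∀ᵐ w ∂(walkLaw d), walkLaw d (Prod.mk (consWalk (q, w)) ⁻¹'
            {p | concat s p.1 p.2 ∈ box (n + 1) B})
            = (B 0).indicator 1 q * walkLaw d (Prod.mk w ⁻¹'
              {p | concat (s - q.1) p.1 p.2 ∈ box n fun i => B (i + 1)}) := by
          filter_upwards [ae_goodWalk] with w hw
          have h3 : Prod.mk (consWalk (q, w)) ⁻¹' {p | concat s p.1 p.2 ∈ box (n + 1) B}
              = {w' | q ∈ B 0 ∧ concat (s - q.1) w w' ∈ box n fun i => B (i + 1)} := by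
            ext w'
            simp only [mem_preimage, mem_ofPred_eq, concat_consWalk_of_le hq hw h, box]
            constructor
            · exact fun H => ⟨H 0 (by simp), fun i hi => H (i + 1) (by omega)⟩
            · rintro ⟨h0, H⟩ i hi
              cases i with
              | zero => exact h0
              | succ i => exact H i (by omega)
          rw [h3]
          by_cases hq0 : q ∈ B 0
          · simp [hq0]
          · simp [hq0]
        rw [lintegral_congr_ae h1, lintegral_const_mul _ (measurable_measure_prodMk_left
          (hmeas _ _ _ hB')), ← Measure.prod_apply (hmeas _ _ _ hB'),
          ih (s - q.1) (by linarith) _ hB',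
          indicator_of_notMem (s := {q : ℝ × (Fin d × Bool) | s < q.1}) (a := q) (by simp [h]),
          zero_add]
        congr 1
        by_cases hq0 : q ∈ B 0 <;> simp [hq0, h]
    have hlt : MeasurableSet {q : ℝ × (Fin d × Bool) | s < q.1} :=
      measurableSet_lt measurable_const measurable_fst
    have hle : MeasurableSet {q : ℝ × (Fin d × Bool) | q.1 ≤ s} :=
      measurableSet_le measurable_fst measurable_const
    have hi1 : Measurable ({q : ℝ × (Fin d × Bool) | s < q.1}.indicator
        (fun _ => stepLaw d {q | (s + q.1, q.2) ∈ B 0})) := measurable_const.indicator hlt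
    have hi2 : Measurable ((B 0 ∩ {q : ℝ × (Fin d × Bool) | q.1 ≤ s}).indicator
        (1 : ℝ × (Fin d × Bool) → ℝ≥0∞)) := measurable_one.indicator ((hB 0).inter hle)
    have hcomp : {q : ℝ × (Fin d × Bool) | q.1 ≤ s} = {q | s < q.1}ᶜ := by ext; simp
    simp only [Function.comp]
    rw [lintegral_congr_ae key, lintegral_mul_const _ (by exact hi1.add hi2), lintegral_add_left hi1,
      lintegral_indicator_const hlt, lintegral_indicator_one ((hB 0).inter hle),
      stepLaw_fst_gt hs, mul_comm (stepLaw d _), ← stepLaw_memoryless hs (hB 0), hcomp,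
      ← sdiff_eq, measure_inter_add_sdiff _ hlt, Finset.prod_range_succ', mul_comm]

/-- The Markov property: a walk that restarts at time `s` is a walk. -/
lemma measurePreserving_concat {s : ℝ} (hs : 0 ≤ s) :
    MeasurePreserving (fun p : WalkSpace d × WalkSpace d => concat s p.1 p.2)
      ((walkLaw d).prod (walkLaw d)) (walkLaw d) := by
  refine ⟨measurable_concat s, eq_walkLaw fun n B hB => ?_⟩
  rw [Measure.map_apply (measurable_concat s) (measurableSet_box n hB)]
  exact prod_concat_box n s hs B hB

lemma ae_prod_goodWalk :
    ∀ᵐ p ∂((walkLaw d).prod (walkLaw d)), GoodWalk p.1 ∧ GoodWalk p.2 :=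
  (Measure.quasiMeasurePreserving_fst.ae ae_goodWalk).and
    (Measure.quasiMeasurePreserving_snd.ae ae_goodWalk)

lemma jumpTime_concat_of_lt {s : ℝ} {w w' : WalkSpace d} {n : ℕ} (hn : n < jumpCount w s) :
    jumpTime (concat s w w') n = jumpTime w n := by
  refine Finset.sum_congr rfl fun i hi => ?_
  rw [Finset.mem_range] at hi
  rw [concat, if_pos (by omega)]

lemma jumpTime_concat_add {s : ℝ} {w w' : WalkSpace d} (n : ℕ) :
    jumpTime (concat s w w') (jumpCount w s + n) = s + jumpTime w' n := by
  induction n with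
  | zero =>
    rw [add_zero, jumpTime, Finset.sum_range_succ, jumpTime_zero]
    rw [Finset.sum_congr rfl (g := fun i => (w i).1)
      fun i hi => by rw [concat, if_pos (Finset.mem_range.1 hi)]]
    simp only [concat, lt_irrefl, if_false, if_true]
    ring
  | succ n ih =>
    rw [← add_assoc, jumpTime_succ, ih, jumpTime_succ, concat, if_neg (by omega), if_neg (by omega),
      add_assoc]
    congr 3
    congr 1
    omega

lemma GoodWalk.elapsed_le {w : WalkSpace d} (hw : GoodWalk w) {s : ℝ} (hs : 0 ≤ s) :
    ∑ i ∈ Finset.range (jumpCount w s), (w i).1 ≤ s := by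
  rcases Nat.eq_zero_or_pos (jumpCount w s) with h | h
  · simpa [h] using hs
  · have := hw.lt_jumpCount.1 (show jumpCount w s - 1 < jumpCount w s by omega)
    rwa [jumpTime, Nat.sub_add_cancel h] at this

lemma GoodWalk.concat {s : ℝ} (hs : 0 ≤ s) {w w' : WalkSpace d} (hw : GoodWalk w)
    (hw' : GoodWalk w') : GoodWalk (concat s w w') := by
  refine ⟨fun n => ?_, fun t => ?_⟩
  · rw [PAM.concat]
    split_ifs with h1 h2
    · exact hw.1 n
    · have := hw.elapsed_le hs
      have := hw'.1 0
      simp only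
      linarith
    · exact hw'.1 _
  · obtain ⟨n, hn⟩ := hw'.2 (t - s)
    exact ⟨jumpCount w s + n, by rw [jumpTime_concat_add]; linarith⟩

lemma walk_concat_of_le {s : ℝ} (hs : 0 ≤ s) {w w' : WalkSpace d} (hw : GoodWalk w)
    (hw' : GoodWalk w') {r : ℝ} (hr : r ≤ s) : walk (concat s w w') r = walk w r := by
  have h1 : jumpCount (concat s w w') r = jumpCount w r := by
    refine (hw.concat hs hw').jumpCount_eq fun n => ?_
    rcases lt_or_ge n (jumpCount w s) with h | h
    · rw [jumpTime_concat_of_lt h, hw.lt_jumpCount]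
    · obtain ⟨m, rfl⟩ := Nat.exists_eq_add_of_le h
      have h2 := (hw'.1 0).trans_le (le_jumpTime hw'.1 (Nat.zero_le m))
      have h3 := hw.jumpCount_mono hr
      rw [jumpTime_concat_add]
      constructor <;> intro h4
      · linarith
      · omega
  rw [walk, walk, h1]
  refine Finset.sum_congr rfl fun n hn => ?_
  rw [Finset.mem_range] at hn
  rw [concat, if_pos (hn.trans_le (hw.jumpCount_mono hr))]

lemma walk_concat_add {s : ℝ} (hs : 0 ≤ s) {w w' : WalkSpace d} (hw : GoodWalk w)
    (hw' : GoodWalk w') {r : ℝ} (hr : 0 ≤ r) :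
    walk (concat s w w') (s + r) = walk w s + walk w' r := by
  have h1 : jumpCount (concat s w w') (s + r) = jumpCount w s + jumpCount w' r := by
    refine (hw.concat hs hw').jumpCount_eq fun n => ?_
    rcases lt_or_ge n (jumpCount w s) with h | h
    · rw [jumpTime_concat_of_lt h]
      have := hw.lt_jumpCount.1 h
      constructor <;> intro
      · omega
      · linarith
    · obtain ⟨m, rfl⟩ := Nat.exists_eq_add_of_le h
      rw [jumpTime_concat_add, Nat.add_lt_add_iff_left, hw'.lt_jumpCount]
      constructor <;> intro <;> linarith
  rw [walk, walk, walk, h1, Finset.sum_range_add]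
  congr 1
  · refine Finset.sum_congr rfl fun n hn => ?_
    rw [concat, if_pos (Finset.mem_range.1 hn)]
  · refine Finset.sum_congr rfl fun n _ => ?_
    cases n with
    | zero => simp [concat]
    | succ n =>
      rw [concat, if_neg (by omega), if_neg (by omega)]
      congr 3
      omega

lemma GoodWalk.walk_zero {w : WalkSpace d} (hw : GoodWalk w) : walk w 0 = 0 := by
  simp [walk, hw.jumpCount_of_nonpos le_rfl]

lemma GoodWalk.walkAt_zero_left {w : WalkSpace d} (hw : GoodWalk w) (t : ℝ) :
    walkAt 0 w t = 0 := by
  simp [walkAt, hw.walk_zero]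

lemma walkAt_concat_of_le {κ s : ℝ} (hκ : 0 ≤ κ) (hs : 0 ≤ s) {w w' : WalkSpace d}
    (hw : GoodWalk w) (hw' : GoodWalk w') {r : ℝ} (hr : r ≤ s) :
    walkAt κ (concat (2 * d * κ * s) w w') r = walkAt κ w r :=
  walk_concat_of_le (by positivity) hw hw' (by gcongr)

lemma walkAt_concat_add {κ s : ℝ} (hκ : 0 ≤ κ) (hs : 0 ≤ s) {w w' : WalkSpace d}
    (hw : GoodWalk w) (hw' : GoodWalk w') {r : ℝ} (hr : 0 ≤ r) :
    walkAt κ (concat (2 * d * κ * s) w w') (s + r) = walkAt κ w s + walkAt κ w' r := by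
  rw [walkAt, mul_add]
  exact walk_concat_add (by positivity) hw hw' (by positivity)

lemma measurable_walkAt (κ : ℝ) : Measurable fun p : WalkSpace d × ℝ => walkAt κ p.1 p.2 := by
  have h : Measurable fun p : WalkSpace d × ℝ => (p.1, 2 * d * κ * p.2) := by fun_prop
  simpa only [Function.comp_def, walkAt] using measurable_walk.comp h

lemma measurable_walkAt_left (κ t : ℝ) : Measurable fun w : WalkSpace d => walkAt κ w t := by
  have h : Measurable fun w : WalkSpace d => (w, t) := measurable_prodMk_right
  simpa only [Function.comp_def] using (measurable_walkAt κ).comp h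

/-! ### Walks that follow a prescribed sequence of steps. -/

/-- The position after the first `j` of the steps `p`. -/
def stepSum (p : ℕ → Fin d × Bool) (j : ℕ) : Site d := ∑ i ∈ Finset.range j, unitStep (p i)

/-- The walks which take the first `k` of the steps `p` within time `t`, and no other step up to
then. -/
def pathEvent (t : ℝ) (k : ℕ) (p : ℕ → Fin d × Bool) : Set (WalkSpace d) :=
  {w | (∀ i < k, (w i).1 ≤ t / k ∧ (w i).2 = p i) ∧ t < (w k).1}

lemma pathEvent_eq_box (t : ℝ) (k : ℕ) (p : ℕ → Fin d × Bool) :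
    pathEvent t k p = box (k + 1) fun i => if i < k then {q | q.1 ≤ t / k ∧ q.2 = p i}
      else {q | t < q.1} := by
  ext w
  simp only [pathEvent, box, mem_ofPred_eq, Nat.lt_succ_iff]
  constructor
  · rintro ⟨h1, h2⟩ i hi
    by_cases h : i < k
    · rw [if_pos h]; exact h1 i h
    · obtain rfl : i = k := by omega
      rw [if_neg h]; exact h2
  · intro H
    refine ⟨fun i hi => ?_, ?_⟩
    · have := H i hi.le
      rwa [if_pos hi] at this
    · have := H k le_rfl
      rwa [if_neg (lt_irrefl k)] at this

lemma measurableSet_pathEvent_steps (t : ℝ) (k : ℕ) (p : ℕ → Fin d × Bool) (i : ℕ) :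
    MeasurableSet (if i < k then {q : ℝ × (Fin d × Bool) | q.1 ≤ t / k ∧ q.2 = p i}
      else {q | t < q.1}) := by
  split_ifs with h
  · exact (measurableSet_le measurable_fst measurable_const).inter
      (measurable_snd (measurableSet_singleton (p i)))
  · exact measurableSet_lt measurable_const measurable_fst

lemma measurableSet_pathEvent (t : ℝ) (k : ℕ) (p : ℕ → Fin d × Bool) :
    MeasurableSet (pathEvent t k p) := by
  rw [pathEvent_eq_box]
  exact measurableSet_box _ (measurableSet_pathEvent_steps t k p)

/-- Bounding each of the first `k` holding times by `t / k` is more than bounding their sum by `t`,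
but it makes the event a box with an explicit product as its probability. -/
lemma walkLaw_pathEvent {t : ℝ} (ht : 0 ≤ t) (k : ℕ) (p : ℕ → Fin d × Bool) :
    walkLaw d (pathEvent t k p)
      = (ENNReal.ofReal (1 - Real.exp (-(t / k))) * (2 * d : ℝ≥0∞)⁻¹) ^ k
        * ENNReal.ofReal (Real.exp (-t)) := by
  rw [pathEvent_eq_box, walkLaw_box _ (measurableSet_pathEvent_steps t k p),
    Finset.prod_range_succ, if_neg (lt_irrefl k), stepLaw_fst_gt ht]
  congr 1
  rw [Finset.prod_congr rfl (g := fun _ => ENNReal.ofReal (1 - Real.exp (-(t / k)))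
    * (2 * d : ℝ≥0∞)⁻¹), Finset.prod_const, Finset.card_range]
  intro i hi
  rw [if_pos (Finset.mem_range.1 hi), stepLaw_fst_le_snd_eq (by positivity)]

lemma walkLaw_pathEvent_pos {t : ℝ} (ht : 0 < t) (k : ℕ) (p : ℕ → Fin d × Bool) :
    0 < walkLaw d (pathEvent t k p) := by
  rw [walkLaw_pathEvent ht.le]
  refine ENNReal.mul_pos ?_ (by simp [Real.exp_pos])
  rcases Nat.eq_zero_or_pos k with rfl | hk
  · simp
  · refine pow_ne_zero _ (mul_ne_zero ?_ (by simp [ENNReal.mul_eq_top]))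
    have : (0 : ℝ) < t / k := by positivity
    simp [this]

lemma GoodWalk.jumpCount_le_of_mem_pathEvent {w : WalkSpace d} (hw : GoodWalk w) {t : ℝ}
    {k : ℕ} {p : ℕ → Fin d × Bool} (h : w ∈ pathEvent t k p) {s : ℝ} (hs : s ≤ t) :
    jumpCount w s ≤ k := by
  by_contra hc
  push Not at hc
  have := hw.lt_jumpCount.1 hc
  linarith [le_jumpTime hw.1 (le_refl k), h.2]

lemma GoodWalk.jumpCount_eq_of_mem_pathEvent {w : WalkSpace d} (hw : GoodWalk w) {t : ℝ}
    {k : ℕ} {p : ℕ → Fin d × Bool} (h : w ∈ pathEvent t k p) : jumpCount w t = k := by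
  refine le_antisymm (hw.jumpCount_le_of_mem_pathEvent h le_rfl) ?_
  rcases Nat.eq_zero_or_pos k with rfl | hk
  · simp
  have h1 : jumpTime w (k - 1) ≤ t := by
    rw [jumpTime, Nat.sub_add_cancel hk]
    calc ∑ i ∈ Finset.range k, (w i).1 ≤ ∑ i ∈ Finset.range k, t / k :=
          Finset.sum_le_sum fun i hi => (h.1 i (Finset.mem_range.1 hi)).1
      _ = t := by simp; field_simp
  have := hw.lt_jumpCount.2 h1
  omega

lemma walk_eq_stepSum {w : WalkSpace d} {t s : ℝ} {k : ℕ} {p : ℕ → Fin d × Bool}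
    (h : w ∈ pathEvent t k p) (hk : jumpCount w s ≤ k) : walk w s = stepSum p (jumpCount w s) :=
  Finset.sum_congr rfl fun i hi => by
    rw [(h.1 i ((Finset.mem_range.1 hi).trans_le hk)).2]

lemma GoodWalk.exists_walk_eq_stepSum {w : WalkSpace d} (hw : GoodWalk w) {t : ℝ} {k : ℕ}
    {p : ℕ → Fin d × Bool} (h : w ∈ pathEvent t k p) {s : ℝ} (hs : s ≤ t) :
    ∃ j ≤ k, walk w s = stepSum p j :=
  ⟨_, hw.jumpCount_le_of_mem_pathEvent h hs,
    walk_eq_stepSum h (hw.jumpCount_le_of_mem_pathEvent h hs)⟩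

lemma GoodWalk.walk_eq_stepSum_end {w : WalkSpace d} (hw : GoodWalk w) {t : ℝ} {k : ℕ}
    {p : ℕ → Fin d × Bool} (h : w ∈ pathEvent t k p) : walk w t = stepSum p k := by
  rw [walk_eq_stepSum h (hw.jumpCount_le_of_mem_pathEvent h le_rfl),
    hw.jumpCount_eq_of_mem_pathEvent h]

/-- Every site can be reached by finitely many steps. -/
lemma exists_stepSum_eq (y : Site d) : ∃ (k : ℕ) (p : ℕ → Fin d × Bool), stepSum p k = y := by
  have hconcat : ∀ (k l : ℕ) (p q : ℕ → Fin d × Bool),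
      stepSum (fun i => if i < k then p i else q (i - k)) (k + l) = stepSum p k + stepSum q l := by
    intro k l p q
    rw [stepSum, Finset.sum_range_add]
    congr 1
    · exact Finset.sum_congr rfl fun i hi => by rw [if_pos (Finset.mem_range.1 hi)]
    · exact Finset.sum_congr rfl fun i _ => by simp
  have hsingle : ∀ (i : Fin d) (n : ℕ) (b : Bool),
      stepSum (fun _ => (i, b)) n = Pi.single i (if b then (n : ℤ) else -(n : ℤ)) := by
    intro i n b
    rw [stepSum, Finset.sum_const, Finset.card_range, unitStep, ← Pi.single_smul]
    congr 1
    cases b <;> simp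
  have hall : ∀ s : Finset (Fin d), ∃ (k : ℕ) (p : ℕ → Fin d × Bool),
      stepSum p k = ∑ i ∈ s, Pi.single i (y i) := by
    classical
    intro s
    induction s using Finset.induction_on with
    | empty => exact ⟨0, fun _ => (0, true), by simp [stepSum]⟩
    | insert i s hi ih =>
      obtain ⟨k, p, h⟩ := ih
      refine ⟨(y i).natAbs + k, fun j => if j < (y i).natAbs then (i, decide (0 ≤ y i))
        else p (j - (y i).natAbs), ?_⟩
      rw [hconcat _ _ (fun _ => (i, decide (0 ≤ y i))), hsingle, h, Finset.sum_insert hi]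
      congr 2
      by_cases h0 : 0 ≤ y i
      · simp [h0]
      · simp [h0, abs_of_neg (not_le.1 h0)]
  obtain ⟨k, p, h⟩ := hall Finset.univ
  exact ⟨k, p, by rw [h, Finset.univ_sum_single]⟩

/-- The number of jumps controls the distance covered. -/
lemma sum_natAbs_walk_le (w : WalkSpace d) (t : ℝ) : ∑ i, (walk w t i).natAbs ≤ jumpCount w t := by
  have h1 : ∀ q : Fin d × Bool, ∑ i, (unitStep q i).natAbs = 1 := by
    intro q
    rw [Finset.sum_eq_single q.1]
    · cases h : q.2 <;> simp [unitStep, h]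
    · intro i _ hi; simp [unitStep, hi]
    · simp
  calc ∑ i, (walk w t i).natAbs
      ≤ ∑ i, ∑ n ∈ Finset.range (jumpCount w t), (unitStep (w n).2 i).natAbs := by
        refine Finset.sum_le_sum fun i _ => ?_
        rw [walk, Finset.sum_apply]
        exact Int.natAbs_sum_le _ _
    _ = jumpCount w t := by rw [Finset.sum_comm]; simp [h1]

/-- With `k` jumps by time `t`, the first `k` holding times are at most `t` each. The lost factor `1
/ k!` is not needed. -/
lemma walkLaw_le_jumpCount {t : ℝ} (ht : 0 ≤ t) (k : ℕ) :
    walkLaw d {w | k ≤ jumpCount w t} ≤ ENNReal.ofReal t ^ k := by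
  calc walkLaw d {w | k ≤ jumpCount w t} ≤ walkLaw d {w | ∀ i < k, (w i).1 ≤ t} := by
        refine measure_mono_ae ?_
        filter_upwards [ae_goodWalk] with w hw
        intro (h : k ≤ jumpCount w t) i hi
        exact (le_jumpTime hw.1 le_rfl).trans (hw.lt_jumpCount.1 (hi.trans_le h))
    _ = ENNReal.ofReal (1 - Real.exp (-t)) ^ k := walkLaw_forall_le ht k
    _ ≤ ENNReal.ofReal t ^ k := by
        gcongr
        linarith [Real.add_one_le_exp (-t)]

end Concat

/-! ### Feynman–Kac functionals in a fixed environment. -/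

section FeynmanKac

variable {d : ℕ} [NeZero d]

/-- Environments that are measurable and locally integrable in time. -/
structure LocInt (v : ℝ≥0 → Config d) : Prop where
  meas : ∀ x, Measurable fun s => v s x
  int : ∀ (x : Site d) (t : ℝ), 0 ≤ t →
    IntervalIntegrable (fun s : ℝ => v s.toNNReal x) volume 0 t

lemma LocInt.intervalIntegrable {v : ℝ≥0 → Config d} (hv : LocInt v) (x : Site d) {a b : ℝ}
    (ha : 0 ≤ a) (hb : 0 ≤ b) : IntervalIntegrable (fun s : ℝ => v s.toNNReal x) volume a b :=
  (hv.int x a ha).symm.trans (hv.int x b hb)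

lemma LocInt.shift {v : ℝ≥0 → Config d} (hv : LocInt v) (s : ℝ≥0) (y : Site d) :
    LocInt (shift s y v) where
  meas x := (hv.meas (y + x)).comp (measurable_const_add s)
  int x t ht := by
    have h := (hv.intervalIntegrable (y + x) s.coe_nonneg (add_nonneg s.coe_nonneg ht)).comp_add_left (s : ℝ)
    have h0 : (s : ℝ) - s = 0 := sub_self _
    have h1 : (s : ℝ) + t - s = t := by ring
    simp only [h0, h1] at h
    refine h.congr fun r hr => ?_
    rw [uIoc_of_le ht] at hr
    simp only [PAM.shift]
    rw [Real.toNNReal_add s.coe_nonneg hr.1.le, Real.toNNReal_coe]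

/-- The exponent in the Feynman-Kac formula along a given walk. -/
def action (v : ℝ≥0 → Config d) (κ : ℝ) (x : Site d) (t : ℝ) (w : WalkSpace d) : ℝ :=
  ∫ s in (0 : ℝ)..t, v (t - s).toNNReal (x + walkAt κ w s)

/-- The Feynman-Kac weight of a walk. -/
def weight (v : ℝ≥0 → Config d) (κ γ : ℝ) (x : Site d) (t : ℝ) (w : WalkSpace d) : ℝ≥0∞ :=
  ENNReal.ofReal (Real.exp (γ * action v κ x t w))

/-- The solution of the parabolic Anderson model with initial condition `1`. -/
def totalMass (v : ℝ≥0 → Config d) (κ γ : ℝ) (x : Site d) (t : ℝ) : ℝ≥0∞ :=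
  ∫⁻ w, weight v κ γ x t w ∂(walkLaw d)

lemma pamSol_eq (v : ℝ≥0 → Config d) (κ γ : ℝ) (x : Site d) (t : ℝ) :
    pamSol v κ γ x t = ∫⁻ w, {w | x + walkAt κ w t = 0}.indicator (weight v κ γ x t) w
      ∂(walkLaw d) := rfl

lemma measurable_comp_walkAt {α : Type*} [MeasurableSpace α] {f : α → Site d → ℝ}
    (hf : ∀ y, Measurable fun a => f a y) (κ : ℝ) (x : Site d) {a : WalkSpace d × ℝ → α}
    (ha : Measurable a) : Measurable fun p => f (a p) (x + walkAt κ p.1 p.2) := by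
  have h1 : Measurable fun q : α × Site d => f q.1 (x + q.2) :=
    measurable_from_prod_countable_left fun y => hf (x + y)
  exact h1.comp (ha.prodMk (measurable_walkAt κ))

lemma LocInt.measurable_uncurry {v : ℝ≥0 → Config d} (hv : LocInt v) (κ : ℝ) (x : Site d)
    (t : ℝ) : Measurable fun p : WalkSpace d × ℝ => v (t - p.2).toNNReal (x + walkAt κ p.1 p.2) :=
  measurable_comp_walkAt (f := v) hv.meas κ x (by fun_prop)

lemma LocInt.measurable_action {v : ℝ≥0 → Config d} (hv : LocInt v) (κ : ℝ) (x : Site d)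
    (t : ℝ) : Measurable (action v κ x t) := by
  have h := (hv.measurable_uncurry κ x t).stronglyMeasurable
  have h1 : ∀ μ : Measure ℝ, SFinite μ → StronglyMeasurable fun w : WalkSpace d =>
      ∫ s, v (t - s).toNNReal (x + walkAt κ w s) ∂μ := fun μ _ => h.integral_prod_right
  unfold action
  simp only [intervalIntegral]
  exact ((h1 _ inferInstance).sub (h1 _ inferInstance)).measurable

lemma LocInt.measurable_weight {v : ℝ≥0 → Config d} (hv : LocInt v) (κ γ : ℝ) (x : Site d)
    (t : ℝ) : Measurable (weight v κ γ x t) :=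
  ((hv.measurable_action κ x t).const_mul γ).exp.ennreal_ofReal

lemma measurableSet_walkAt_eq (κ t : ℝ) (x : Site d) :
    MeasurableSet {w : WalkSpace d | x + walkAt κ w t = 0} := by
  have : {w : WalkSpace d | x + walkAt κ w t = 0} = (fun w => walkAt κ w t) ⁻¹' {-x} := by
    ext w; simp [add_eq_zero_iff_neg_eq, eq_comm]
  rw [this]
  exact measurable_walkAt_left κ t (measurableSet_singleton _)

/-- Integrals over the sites visited control the integral along the walk. -/
lemma LocInt.intervalIntegrable_walk {v : ℝ≥0 → Config d} (hv : LocInt v) {κ : ℝ} (x : Site d)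
    {t : ℝ} (ht : 0 ≤ t) {w : WalkSpace d} {B : Finset (Site d)}
    (hB : ∀ s ≤ t, walkAt κ w s ∈ B) :
    IntervalIntegrable (fun s => v (t - s).toNNReal (x + walkAt κ w s)) volume 0 t ∧
    |action v κ x t w| ≤ ∑ y ∈ B, ∫ s in (0 : ℝ)..t, |v s.toNNReal (x + y)| := by
  have h1 : ∀ y, IntervalIntegrable (fun s : ℝ => |v (t - s).toNNReal (x + y)|) volume 0 t := by
    intro y
    have := ((hv.int (x + y) t ht).abs.comp_sub_left t).symm
    simpa using this
  have h2 : IntervalIntegrable (fun s : ℝ => ∑ y ∈ B, |v (t - s).toNNReal (x + y)|) volume 0 t := by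
    have := IntervalIntegrable.sum B (f := fun y (s : ℝ) => |v (t - s).toNNReal (x + y)|)
      fun y _ => h1 y
    refine this.congr fun s _ => ?_
    simp
  have h3 : ∀ s ≤ t, |v (t - s).toNNReal (x + walkAt κ w s)|
      ≤ ∑ y ∈ B, |v (t - s).toNNReal (x + y)| := fun s hs =>
    Finset.single_le_sum (f := fun y => |v (t - s).toNNReal (x + y)|)
      (fun _ _ => abs_nonneg _) (hB s hs)
  have hm : Measurable fun s => v (t - s).toNNReal (x + walkAt κ w s) :=
    (hv.measurable_uncurry κ x t).comp measurable_prodMk_left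
  have h4 : IntervalIntegrable (fun s => v (t - s).toNNReal (x + walkAt κ w s)) volume 0 t := by
    refine h2.mono_fun' hm.aestronglyMeasurable ?_
    refine (ae_restrict_iff' measurableSet_uIoc).2 (.of_forall fun s hs => ?_)
    rw [uIoc_of_le ht] at hs
    exact h3 s hs.2
  refine ⟨h4, ?_⟩
  calc |action v κ x t w| ≤ ∫ s in (0 : ℝ)..t, |v (t - s).toNNReal (x + walkAt κ w s)| :=
        intervalIntegral.abs_integral_le_integral_abs ht
    _ ≤ ∫ s in (0 : ℝ)..t, ∑ y ∈ B, |v (t - s).toNNReal (x + y)| :=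
        intervalIntegral.integral_mono_on ht h4.abs h2 fun s hs => h3 s hs.2
    _ = ∑ y ∈ B, ∫ s in (0 : ℝ)..t, |v (t - s).toNNReal (x + y)| :=
        intervalIntegral.integral_finsetSum fun y _ => h1 y
    _ = _ := by
        refine Finset.sum_congr rfl fun y _ => ?_
        simpa using intervalIntegral.integral_comp_sub_left
          (fun s : ℝ => |v s.toNNReal (x + y)|) (a := 0) (b := t) t

lemma GoodWalk.exists_finset {κ : ℝ} (hκ : 0 ≤ κ) {w : WalkSpace d} (hw : GoodWalk w) (t : ℝ) :
    ∃ B : Finset (Site d), ∀ s ≤ t, walkAt κ w s ∈ B := by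
  classical
  refine ⟨(Finset.range (jumpCount w (2 * d * κ * t) + 1)).image
    fun j => ∑ n ∈ Finset.range j, unitStep (w n).2, fun s hs => Finset.mem_image.2
      ⟨jumpCount w (2 * d * κ * s), ?_, rfl⟩⟩
  rw [Finset.mem_range, Nat.lt_succ_iff]
  exact hw.jumpCount_mono (by gcongr)

/-- The environment is read backwards: the first `t` units of the walk see it on `[s, t + s]`, the
last `s` units on `[0, s]`. So the first piece lives in the environment shifted by `s`, the second
in the original one; `z` only recentres the coordinates. -/
lemma LocInt.action_concat {v : ℝ≥0 → Config d} (hv : LocInt v) {κ : ℝ} (hκ : 0 ≤ κ)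
    (x z : Site d) {s t : ℝ} (hs : 0 ≤ s) (ht : 0 ≤ t) {w w' : WalkSpace d} (hw : GoodWalk w)
    (hw' : GoodWalk w') :
    action v κ x (t + s) (concat (2 * d * κ * t) w w')
      = action (PAM.shift s.toNNReal z v) κ (x - z) t w
        + action v κ (x + walkAt κ w t) s w' := by
  obtain ⟨B, hB⟩ := (hw.concat (s := 2 * d * κ * t) (by positivity) hw').exists_finset hκ (t + s)
  have hi := (hv.intervalIntegrable_walk x (add_nonneg ht hs) hB).1
  rw [action, ← intervalIntegral.integral_add_adjacent_intervals (b := t)]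
  · congr 1
    · refine intervalIntegral.integral_congr fun r hr => ?_
      rw [uIcc_of_le ht] at hr
      simp only [PAM.shift]
      rw [walkAt_concat_of_le hκ ht hw hw' hr.2, show t + s - r = s + (t - r) by ring,
        Real.toNNReal_add hs (by linarith [hr.2])]
      congr 1
      abel
    · have := intervalIntegral.integral_comp_add_left (a := 0) (b := s)
        (fun r => v (t + s - r).toNNReal (x + walkAt κ (concat (2 * d * κ * t) w w') r)) t
      rw [add_zero] at this
      rw [← this, action]
      refine intervalIntegral.integral_congr fun r hr => ?_
      rw [uIcc_of_le hs] at hr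
      rw [walkAt_concat_add hκ ht hw hw' hr.1, show t + s - (t + r) = s - r by ring, add_assoc]
  · refine hi.mono_set ?_
    rw [uIcc_of_le ht, uIcc_of_le (by linarith)]
    exact Icc_subset_Icc_right (by linarith)
  · refine hi.mono_set ?_
    rw [uIcc_of_le (by linarith), uIcc_of_le (by linarith)]
    exact Icc_subset_Icc_left ht

lemma LocInt.weight_concat {v : ℝ≥0 → Config d} (hv : LocInt v) {κ : ℝ} (hκ : 0 ≤ κ) (γ : ℝ)
    (x z : Site d) {s t : ℝ} (hs : 0 ≤ s) (ht : 0 ≤ t) {w w' : WalkSpace d} (hw : GoodWalk w)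
    (hw' : GoodWalk w') :
    weight v κ γ x (t + s) (concat (2 * d * κ * t) w w')
      = weight (PAM.shift s.toNNReal z v) κ γ (x - z) t w
        * weight v κ γ (x + walkAt κ w t) s w' := by
  rw [weight, weight, weight, hv.action_concat hκ x z hs ht hw hw', mul_add, Real.exp_add,
    ENNReal.ofReal_mul (Real.exp_nonneg _)]

/-- Passing through `z` at time `t` bounds the solution from below. -/
lemma LocInt.mul_le_pamSol {v : ℝ≥0 → Config d} (hv : LocInt v) {κ : ℝ} (hκ : 0 ≤ κ) (γ : ℝ)
    (x z : Site d) {s t : ℝ} (hs : 0 ≤ s) (ht : 0 ≤ t) :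
    pamSol (PAM.shift s.toNNReal z v) κ γ (x - z) t * pamSol v κ γ z s
      ≤ pamSol v κ γ x (t + s) := by
  have hm1 := ((hv.shift s.toNNReal z).measurable_weight κ γ (x - z) t).indicator
    (measurableSet_walkAt_eq κ t (x - z))
  have hm2 := (hv.measurable_weight κ γ z s).indicator (measurableSet_walkAt_eq κ s z)
  have hm3 := (hv.measurable_weight κ γ x (t + s)).indicator (measurableSet_walkAt_eq κ (t + s) x)
  rw [pamSol_eq, pamSol_eq, pamSol_eq, ← lintegral_prod_mul hm1.aemeasurable hm2.aemeasurable,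
    ← (measurePreserving_concat (s := 2 * d * κ * t) (by positivity)).lintegral_comp hm3]
  refine lintegral_mono_ae ?_
  filter_upwards [ae_prod_goodWalk] with p ⟨h1, h2⟩
  by_cases ha : x - z + walkAt κ p.1 t = 0
  · by_cases hb : z + walkAt κ p.2 s = 0
    · have hz : x + walkAt κ p.1 t = z := by
        rw [← sub_eq_zero, ← ha]; abel
      rw [indicator_of_mem (by exact ha), indicator_of_mem (by exact hb), indicator_of_mem,
        hv.weight_concat hκ γ x z hs ht h1 h2, hz]
      change x + walkAt κ _ (t + s) = 0
      rw [walkAt_concat_add hκ ht h1 h2 hs, ← add_assoc, hz, hb]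
    · rw [indicator_of_notMem (s := {w | z + walkAt κ w s = 0}) (by exact hb), mul_zero]
      exact zero_le
  · rw [indicator_of_notMem (s := {w | x - z + walkAt κ w t = 0}) (by exact ha), zero_mul]
    exact zero_le

lemma pamSol_le_totalMass (v : ℝ≥0 → Config d) (κ γ : ℝ) (x : Site d) (t : ℝ) :
    pamSol v κ γ x t ≤ totalMass v κ γ x t :=
  lintegral_mono fun _ => indicator_le_self _ _ _

/-- On `pathEvent` the walk stays in `B`, so whatever the jump times are, the action is at least
minus the integral of `|v|` summed over `B`. -/
lemma LocInt.pathEvent_le_pamSol {v : ℝ≥0 → Config d} (hv : LocInt v) {κ γ : ℝ} (hκ : 0 ≤ κ)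
    (hγ : 0 ≤ γ) (x : Site d) {t : ℝ} (ht : 0 ≤ t) {k : ℕ} {p : ℕ → Fin d × Bool}
    {B : Finset (Site d)} (hB : ∀ j ≤ k, stepSum p j ∈ B) (hp : x + stepSum p k = 0) :
    walkLaw d (pathEvent (2 * d * κ * t) k p)
      * ENNReal.ofReal (Real.exp (-(γ * ∑ y ∈ B, ∫ s in (0 : ℝ)..t, |v s.toNNReal (x + y)|)))
      ≤ pamSol v κ γ x t := by
  rw [mul_comm, pamSol_eq, ← lintegral_indicator_const (measurableSet_pathEvent _ k p)]
  refine lintegral_mono_ae ?_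
  filter_upwards [ae_goodWalk] with w hw
  by_cases h : w ∈ pathEvent (2 * d * κ * t) k p
  · rw [indicator_of_mem h, indicator_of_mem]
    · refine ENNReal.ofReal_le_ofReal (Real.exp_le_exp.2 ?_)
      have h1 := (hv.intervalIntegrable_walk (κ := κ) x ht (w := w) (B := B) fun s hs => by
        obtain ⟨j, hj, h⟩ := hw.exists_walk_eq_stepSum h
          (s := 2 * d * κ * s) (by gcongr)
        rw [walkAt, h]; exact hB j hj).2
      rw [← mul_neg]
      exact mul_le_mul_of_nonneg_left (by linarith [neg_abs_le (action v κ x t w)]) hγ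
    · change x + walkAt κ w t = 0
      rw [walkAt, hw.walk_eq_stepSum_end h, hp]
  · rw [indicator_of_notMem h]; exact zero_le

lemma LocInt.pamSol_pos {v : ℝ≥0 → Config d} (hv : LocInt v) {κ γ : ℝ} (hκ : 0 < κ)
    (hγ : 0 ≤ γ) (x : Site d) {t : ℝ} (ht : 0 < t) : 0 < pamSol v κ γ x t := by
  classical
  obtain ⟨k, p, hp⟩ := exists_stepSum_eq (-x)
  have hd : (0 : ℝ) < d := by exact_mod_cast Nat.pos_of_ne_zero (NeZero.ne d)
  refine lt_of_lt_of_le (ENNReal.mul_pos ?_ ?_) (hv.pathEvent_le_pamSol hκ.le hγ x ht.le (p := p)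
    (k := k) (B := (Finset.range (k + 1)).image (stepSum p))
    (fun j hj => Finset.mem_image_of_mem _ (by simpa using hj)) (by simp [hp]))
  · exact (walkLaw_pathEvent_pos (by positivity) k p).ne'
  · simp [Real.exp_pos]

/-- The walk which stays put. -/
lemma LocInt.exp_le_pamSol {v : ℝ≥0 → Config d} {κ γ : ℝ} (hκ : 0 ≤ κ) {t : ℝ} (ht : 0 ≤ t) :
    ENNReal.ofReal (Real.exp (-(2 * d * κ * t) + γ * ∫ s in (0 : ℝ)..t, v s.toNNReal 0))
      ≤ pamSol v κ γ 0 t := by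
  have h0 := walkLaw_pathEvent (d := d) (t := 2 * d * κ * t) (by positivity) 0 fun _ => (0, true)
  rw [pow_zero, one_mul] at h0
  rw [Real.exp_add, ENNReal.ofReal_mul (Real.exp_nonneg _), ← h0, mul_comm, pamSol_eq,
    ← lintegral_indicator_const (measurableSet_pathEvent _ 0 _)]
  refine lintegral_mono_ae ?_
  filter_upwards [ae_goodWalk] with w hw
  by_cases h : w ∈ pathEvent (2 * d * κ * t) 0 fun _ => ((0 : Fin d), true)
  · have hX : ∀ s ≤ t, walkAt κ w s = 0 := by
      intro s hs
      obtain ⟨j, hj, h⟩ := hw.exists_walk_eq_stepSum h (s := 2 * d * κ * s) (by gcongr)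
      obtain rfl : j = 0 := by omega
      rw [walkAt, h]; simp [stepSum]
    rw [indicator_of_mem h, indicator_of_mem (by simp [hX t le_rfl]), weight]
    refine le_of_eq ?_
    congr 3
    rw [action]
    have h1 := intervalIntegral.integral_comp_sub_left (a := 0) (b := t)
      (fun s : ℝ => v s.toNNReal 0) t
    rw [sub_self, sub_zero] at h1
    rw [← h1]
    refine intervalIntegral.integral_congr fun s hs => ?_
    rw [uIcc_of_le ht] at hs
    simp [hX s hs.2]
  · rw [indicator_of_notMem h]; exact zero_le

/-- At `κ = 0` the walk never moves, so a plain time integral of the field is the logarithm of a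
total mass. Measurability results for Feynman–Kac functionals thereby cover time integrals too. -/
lemma totalMass_zero_one (v : ℝ≥0 → Config d) (x : Site d) (t : ℝ) :
    totalMass v 0 1 x t
      = ENNReal.ofReal (Real.exp (∫ s in (0 : ℝ)..t, v s.toNNReal x)) := by
  have : ∀ᵐ w ∂(walkLaw d), weight v 0 1 x t w
      = ENNReal.ofReal (Real.exp (∫ s in (0 : ℝ)..t, v s.toNNReal x)) := by
    filter_upwards [ae_goodWalk] with w hw
    have h1 := intervalIntegral.integral_comp_sub_left (a := 0) (b := t)
      (fun s : ℝ => v s.toNNReal x) t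
    rw [sub_self, sub_zero] at h1
    rw [weight, one_mul, action, ← h1]
    simp [hw.walkAt_zero_left]
  rw [totalMass, lintegral_congr_ae this, lintegral_const, measure_univ, mul_one]

lemma action_of_jumpCount_eq_zero {v : ℝ≥0 → Config d} {κ : ℝ} (hκ : 0 ≤ κ) (x : Site d) {t : ℝ}
    (ht : 0 ≤ t) {w : WalkSpace d} (hw : GoodWalk w) (h : jumpCount w (2 * d * κ * t) = 0) :
    action v κ x t w = ∫ s in (0 : ℝ)..t, v s.toNNReal x := by
  have h1 := intervalIntegral.integral_comp_sub_left (a := 0) (b := t)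
      (fun s : ℝ => v s.toNNReal x) t
  rw [sub_self, sub_zero] at h1
  rw [action, ← h1]
  refine intervalIntegral.integral_congr fun s hs => ?_
  rw [uIcc_of_le ht] at hs
  have h2 : jumpCount w (2 * d * κ * s) = 0 :=
    Nat.eq_zero_of_le_zero ((hw.jumpCount_mono (by have := hs.2; gcongr)).trans h.le)
  simp [walkAt, walk, h2]

/-- One more time block: either the walk stays where it is, or it pays for a jump. -/
lemma LocInt.totalMass_add_le {v : ℝ≥0 → Config d} (hv : LocInt v) {κ γ M : ℝ} (hκ : 0 ≤ κ)
    (hγ : 0 ≤ γ) (x : Site d) {s t : ℝ} (hs : 0 ≤ s) (ht : 0 ≤ t)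
    (hM : ∀ y, ∀ᵐ r : ℝ, 0 ≤ r → v r.toNNReal y ≤ M) :
    totalMass v κ γ x (t + s)
      ≤ ENNReal.ofReal (Real.exp (γ * ∫ r in (0 : ℝ)..t, PAM.shift s.toNNReal 0 v r.toNNReal x))
          * totalMass v κ γ x s
        + ENNReal.ofReal (Real.exp (γ * (M * t)))
          * ∑' y, walkLaw d {w | 1 ≤ jumpCount w (2 * d * κ * t) ∧ walkAt κ w t = y}
            * totalMass v κ γ (x + y) s := by
  set A : Set (WalkSpace d) := {w | 1 ≤ jumpCount w (2 * d * κ * t)} with hA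
  have hAm : MeasurableSet A := measurableSet_le measurable_const (measurable_jumpCount_left _)
  set v' := PAM.shift s.toNNReal 0 v with hv'
  set Z : Site d → ℝ≥0∞ := fun y => totalMass v κ γ (x + y) s with hZ
  have hX : Measurable fun w : WalkSpace d => walkAt κ w t := measurable_walkAt_left κ t
  have hZm : Measurable fun w : WalkSpace d => Z (walkAt κ w t) :=
    (Measurable.of_discrete (f := Z)).comp hX
  have hM' : ∀ᵐ r : ℝ, ∀ y, 0 ≤ r → v' r.toNNReal y ≤ M := by
    refine ae_all_iff.2 fun y => ?_
    have h1 : ∀ᵐ r : ℝ, 0 ≤ s + r → v (s + r).toNNReal (0 + y) ≤ M :=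
      (measurePreserving_add_left volume s).quasiMeasurePreserving.ae (hM (0 + y))
    filter_upwards [h1] with r hr h0
    have := hr (add_nonneg hs h0)
    rwa [Real.toNNReal_add hs h0] at this
  have hdecomp : totalMass v κ γ x (t + s)
      = ∫⁻ w, weight v' κ γ x t w * Z (walkAt κ w t) ∂(walkLaw d) := by
    have hm := hv.measurable_weight κ γ x (t + s)
    have hc : MeasurePreserving _ _ (walkLaw d) :=
      measurePreserving_concat (d := d) (s := 2 * d * κ * t) (by positivity)
    rw [totalMass, ← hc.lintegral_comp hm]
    refine (lintegral_prod _ (hm.comp hc.measurable).aemeasurable).trans (lintegral_congr_ae ?_)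
    filter_upwards [ae_goodWalk] with w hw
    simp only [hZ, totalMass]
    rw [← lintegral_const_mul _ (hv.measurable_weight κ γ _ s)]
    refine lintegral_congr_ae ?_
    filter_upwards [ae_goodWalk] with w' hw'
    rw [Function.comp_apply, hv.weight_concat hκ γ x 0 hs ht hw hw', sub_zero]
  have hbound : ∀ᵐ w ∂(walkLaw d), weight v' κ γ x t w * Z (walkAt κ w t)
      ≤ ENNReal.ofReal (Real.exp (γ * ∫ r in (0 : ℝ)..t, v' r.toNNReal x)) * totalMass v κ γ x s
        + ENNReal.ofReal (Real.exp (γ * (M * t)))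
          * A.indicator (fun w => Z (walkAt κ w t)) w := by
    filter_upwards [ae_goodWalk] with w hw
    by_cases h : w ∈ A
    · rw [indicator_of_mem h]
      -- After a jump nothing about the path inside the block is kept: it contributes at most `exp
      -- (γ M t)`.
      refine le_add_of_nonneg_of_le zero_le ?_
      gcongr
      refine ENNReal.ofReal_le_ofReal (Real.exp_le_exp.2 (mul_le_mul_of_nonneg_left ?_ hγ))
      obtain ⟨B, hB⟩ := hw.exists_finset hκ t
      have hi := ((hv.shift s.toNNReal 0).intervalIntegrable_walk x ht hB).1
      have h1 : ∀ᵐ r : ℝ, ∀ y, 0 ≤ t - r → v' (t - r).toNNReal y ≤ M :=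
        (Measure.measurePreserving_sub_left volume t).quasiMeasurePreserving.ae hM'
      calc action v' κ x t w ≤ ∫ _ in (0 : ℝ)..t, M := by
            refine intervalIntegral.integral_mono_ae_restrict ht hi (by simp) ?_
            refine (ae_restrict_iff' measurableSet_Icc).2 ?_
            filter_upwards [h1] with r hr hr'
            exact hr _ (by linarith [hr'.2])
        _ = M * t := by simp [mul_comm]
    · rw [indicator_of_notMem h, mul_zero, add_zero]
      have h0 : jumpCount w (2 * d * κ * t) = 0 := by
        by_contra hc; exact h (Nat.one_le_iff_ne_zero.2 hc)
      have h1 : walkAt κ w t = 0 := by simp [walkAt, walk, h0]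
      rw [h1, weight, action_of_jumpCount_eq_zero hκ x ht hw h0]
      simp [hZ]
  have hsum : ∫⁻ w, A.indicator (fun w => Z (walkAt κ w t)) w ∂(walkLaw d)
      = ∑' y, walkLaw d {w | 1 ≤ jumpCount w (2 * d * κ * t) ∧ walkAt κ w t = y} * Z y := by
    have hms : ∀ y, MeasurableSet (A ∩ {w | walkAt κ w t = y}) := fun y =>
      hAm.inter (hX (measurableSet_singleton y))
    have h1 : ∀ w, A.indicator (fun w => Z (walkAt κ w t)) w
        = ∑' y, (A ∩ {w | walkAt κ w t = y}).indicator (fun _ => Z y) w := by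
      intro w
      rw [tsum_eq_single (walkAt κ w t)]
      · by_cases h : w ∈ A <;> simp [h]
      · intro y hy
        exact indicator_of_notMem (fun hc => hy hc.2.symm) _
    simp only [h1]
    rw [lintegral_tsum fun y => (measurable_const.indicator (hms y)).aemeasurable]
    refine tsum_congr fun y => ?_
    rw [lintegral_indicator_const (hms y), mul_comm]
    rfl
  rw [hdecomp]
  refine (lintegral_mono_ae hbound).trans (le_of_eq ?_)
  rw [lintegral_add_left measurable_const, lintegral_const, measure_univ, mul_one,
    lintegral_const_mul _ (hZm.indicator hAm), hsum]

end FeynmanKac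

/-! ### Time integrals as limits of averages at random times. -/

section Sampling

/-- The uniform law on `(0, 1]`. -/
def unifLaw : Measure ℝ := volume.restrict (Ioc (0 : ℝ) 1)

instance : IsProbabilityMeasure unifLaw := ⟨by simp [unifLaw]⟩

/-- The law of a sequence of independent uniform variables. -/
def sampleLaw : Measure (ℕ → ℝ) := Measure.infinitePi fun _ : ℕ => unifLaw

instance : IsProbabilityMeasure sampleLaw := by unfold sampleLaw; infer_instance

lemma measurePreserving_eval_sampleLaw (i : ℕ) :
    MeasurePreserving (fun u : ℕ → ℝ => u i) sampleLaw unifLaw :=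
  measurePreserving_eval_infinitePi (fun _ : ℕ => unifLaw) i

lemma ae_sampleLaw_mem : ∀ᵐ u ∂sampleLaw, ∀ i, u i ∈ Ioc (0 : ℝ) 1 :=
  ae_all_iff.2 fun i => (measurePreserving_eval_sampleLaw i).quasiMeasurePreserving.ae
    (ae_restrict_mem measurableSet_Ioc)

lemma strong_law_sampleLaw {g : ℝ → ℝ} (hg : Measurable g) (hi : IntegrableOn g (Ioc 0 1)) :
    ∀ᵐ u ∂sampleLaw, Tendsto (fun n : ℕ => (∑ i ∈ Finset.range n, g (u i)) / n) atTop
      (𝓝 (∫ s in (0 : ℝ)..1, g s)) := by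
  have hmp := measurePreserving_eval_sampleLaw
  have h := strong_law_ae_real (μ := sampleLaw) (fun i u => g (u i))
    ((hmp 0).integrable_comp_of_integrable hi)
    (fun i j hij => (iIndepFun_infinitePi (P := fun _ : ℕ => unifLaw) (X := fun _ => g)
      fun _ => hg).indepFun hij)
    (fun i => by
      refine ⟨(hg.comp (measurable_pi_apply i)).aemeasurable,
        (hg.comp (measurable_pi_apply 0)).aemeasurable, ?_⟩
      have h1 : ∀ j, Measure.map (fun u : ℕ → ℝ => g (u j)) sampleLaw = unifLaw.map g := fun j => by
        rw [← (hmp j).map_eq, Measure.map_map hg (hmp j).measurable]; rfl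
      rw [h1, h1])
  have h2 : ∫ u, g (u 0) ∂sampleLaw = ∫ s in (0 : ℝ)..1, g s := by
    rw [intervalIntegral.integral_of_le zero_le_one]
    have := integral_map (hmp 0).measurable.aemeasurable (f := g) (μ := sampleLaw)
      (by rw [(hmp 0).map_eq]; exact hg.aestronglyMeasurable)
    rw [← this, (hmp 0).map_eq]; rfl
  rwa [h2] at h

/-- One sequence of sampling points serves for almost all parameters. -/
lemma ae_sample_tendsto {E : Type*} [MeasurableSpace E] {μ : Measure E} [SFinite μ]
    {f : E × ℝ → ℝ} (hf : Measurable f)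
    (hi : ∀ᵐ e ∂μ, IntegrableOn (fun s => f (e, s)) (Ioc 0 1)) :
    ∀ᵐ u ∂sampleLaw, ∀ᵐ e ∂μ,
      Tendsto (fun n : ℕ => (∑ i ∈ Finset.range n, f (e, u i)) / n) atTop
        (𝓝 (∫ s in (0 : ℝ)..1, f (e, s))) := by
  have hm : MeasurableSet {p : E × (ℕ → ℝ) | Tendsto
      (fun n : ℕ => (∑ i ∈ Finset.range n, f (p.1, p.2 i)) / n) atTop
        (𝓝 (∫ s in (0 : ℝ)..1, f (p.1, s)))} := by
    have h1 : Measurable fun e => ∫ s in (0 : ℝ)..1, f (e, s) := by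
      simp only [intervalIntegral.integral_of_le zero_le_one]
      exact hf.stronglyMeasurable.integral_prod_right'.measurable
    have h2 : ∀ n : ℕ, Measurable fun p : E × (ℕ → ℝ) =>
        (∑ i ∈ Finset.range n, f (p.1, p.2 i)) / n - ∫ s in (0 : ℝ)..1, f (p.1, s) := by
      intro n
      refine Measurable.sub (Measurable.div_const ?_ _) (h1.comp measurable_fst)
      exact Finset.measurable_sum _ fun i _ => hf.comp (by fun_prop)
    have h3 := measurableSet_tendsto (𝓝 (0 : ℝ)) (l := atTop) h2
    convert h3 using 3 with p
    exact (tendsto_sub_nhds_zero_iff).symm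
  have h : ∀ᵐ e ∂μ, ∀ᵐ u ∂sampleLaw,
      Tendsto (fun n : ℕ => (∑ i ∈ Finset.range n, f (e, u i)) / n) atTop
        (𝓝 (∫ s in (0 : ℝ)..1, f (e, s))) := by
    filter_upwards [hi] with e he
    exact strong_law_sampleLaw (hf.comp measurable_prodMk_left) he
  exact (Measure.ae_ae_comm hm).1 h

end Sampling

/-! ### Versions of Feynman–Kac functionals that depend on countably many times. -/

section Representation

variable {d : ℕ} [NeZero d]

/-- The restriction of a trajectory to `[0, τ]`. -/
def restrictPath (τ : ℝ≥0) (v : ℝ≥0 → Config d) : Iic τ → Config d := fun s => v s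

/-- The point of `[0, τ]` at the fraction `u` of the way back from `τ`. -/
def sampleTime (τ : ℝ≥0) (u : ℝ) : Iic τ := ⟨τ - τ * u.toNNReal, mem_Iic.2 tsub_le_self⟩

/-- A version of `action` that is measurable for the product `σ`-algebra. -/
def sampledAction (u : ℕ → ℝ) (τ : ℝ≥0) (v : Iic τ → Config d) (κ : ℝ) (x : Site d)
    (w : WalkSpace d) : ℝ :=
  τ * limsup (fun n : ℕ => (∑ i ∈ Finset.range n,
    v (sampleTime τ (u i)) (x + walkAt κ w (τ * u i))) / n) atTop

/-- The Feynman-Kac weight of a set of walks. -/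
def fkOn (A : Set (WalkSpace d)) (v : ℝ≥0 → Config d) (κ γ : ℝ) (x : Site d) (t : ℝ) : ℝ≥0∞ :=
  ∫⁻ w in A, weight v κ γ x t w ∂(walkLaw d)

/-- A version of `fkOn` that is measurable for the product `σ`-algebra. -/
def sampledFkOn (A : Set (WalkSpace d)) (u : ℕ → ℝ) (τ : ℝ≥0) (v : Iic τ → Config d) (κ γ : ℝ)
    (x : Site d) : ℝ≥0∞ :=
  ∫⁻ w in A, ENNReal.ofReal (Real.exp (γ * sampledAction u τ v κ x w)) ∂(walkLaw d)

lemma pamSol_eq_fkOn (v : ℝ≥0 → Config d) (κ γ : ℝ) (x : Site d) (t : ℝ) :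
    pamSol v κ γ x t = fkOn {w | x + walkAt κ w t = 0} v κ γ x t := by
  rw [pamSol_eq, fkOn, lintegral_indicator (measurableSet_walkAt_eq κ t x)]

lemma totalMass_eq_fkOn (v : ℝ≥0 → Config d) (κ γ : ℝ) (x : Site d) (t : ℝ) :
    totalMass v κ γ x t = fkOn univ v κ γ x t := by
  rw [totalMass, fkOn, Measure.restrict_univ]

lemma measurable_sampledFkOn (A : Set (WalkSpace d)) (u : ℕ → ℝ) (τ : ℝ≥0) (κ γ : ℝ)
    (x : Site d) : Measurable fun v : Iic τ → Config d => sampledFkOn A u τ v κ γ x := by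
  have h : Measurable fun p : (Iic τ → Config d) × WalkSpace d =>
      sampledAction u τ p.1 κ x p.2 := by
    refine Measurable.const_mul (Measurable.limsup fun n => Measurable.div_const
      (Finset.measurable_sum _ fun i _ => ?_) _) _
    have h1 : Measurable fun q : (Iic τ → Config d) × Site d =>
        q.1 (sampleTime τ (u i)) (x + q.2) :=
      measurable_from_prod_countable_left fun y =>
        (measurable_pi_apply (x + y)).comp (measurable_pi_apply (sampleTime τ (u i)))
    exact h1.comp (measurable_fst.prodMk
      ((measurable_walkAt_left κ (τ * u i)).comp measurable_snd))
  exact (h.const_mul γ).exp.ennreal_ofReal.lintegral_prod_right'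

lemma measurable_restrictPath (τ : ℝ≥0) : Measurable (restrictPath (d := d) τ) :=
  measurable_pi_iff.2 fun s => measurable_pi_apply (s : ℝ≥0)

variable {Ω : Type*} [MeasurableSpace Ω]

/-- Rescaling time to `(0, 1]` makes the action a mean value. By the strong law, almost every
sampling sequence recovers it for almost all pairs of environment and walk. The sampled side reads
the environment only up to time `τ`. -/
lemma ae_fkOn_eq_sampledFkOn {Q : Measure Ω} [SFinite Q] {ξ : ℝ≥0 → Ω → Config d}
    (hξ : Measurable fun p : ℝ≥0 × Ω => ξ p.1 p.2) (hQ : ∀ᵐ ω ∂Q, LocInt (path ξ ω))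
    (A : Set (WalkSpace d)) {κ : ℝ} (hκ : 0 ≤ κ) (γ : ℝ) (x : Site d) (τ : ℝ≥0) :
    ∀ᵐ u ∂sampleLaw, ∀ᵐ ω ∂Q,
      fkOn A (path ξ ω) κ γ x τ = sampledFkOn A u τ (restrictPath τ (path ξ ω)) κ γ x := by
  have hm : Measurable fun p : (Ω × WalkSpace d) × ℝ =>
      ξ ((τ : ℝ) - τ * p.2).toNNReal p.1.1 (x + walkAt κ p.1.2 (τ * p.2)) := by
    have h1 : Measurable fun q : (ℝ≥0 × Ω) × Site d => ξ q.1.1 q.1.2 (x + q.2) :=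
      measurable_from_prod_countable_left fun y => (measurable_pi_apply (x + y)).comp hξ
    have h2 : Measurable fun p : (Ω × WalkSpace d) × ℝ => walkAt κ p.1.2 (τ * p.2) := by
      have h : Measurable fun p : (Ω × WalkSpace d) × ℝ => (p.1.2, τ * p.2) := by fun_prop
      simpa only [Function.comp_def] using (measurable_walkAt κ).comp h
    have h3 : Measurable fun p : (Ω × WalkSpace d) × ℝ =>
        ((((τ : ℝ) - τ * p.2).toNNReal, p.1.1), walkAt κ p.1.2 (τ * p.2)) :=
      Measurable.prodMk (by fun_prop) h2
    exact h1.comp h3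
  have hgood : ∀ᵐ p ∂(Q.prod (walkLaw d)), LocInt (path ξ p.1) ∧ GoodWalk p.2 :=
    (Measure.quasiMeasurePreserving_fst.ae hQ).and
      (Measure.quasiMeasurePreserving_snd.ae ae_goodWalk)
  have hcov : ∀ (F : ℝ → ℝ), ∫ s in (0 : ℝ)..τ, F s = τ * ∫ s in (0 : ℝ)..1, F (τ * s) := by
    intro F
    have := intervalIntegral.smul_integral_comp_mul_left F (a := 0) (b := 1) (τ : ℝ)
    simpa only [smul_eq_mul, mul_zero, mul_one] using this.symm
  have h := ae_sample_tendsto (μ := Q.prod (walkLaw d)) hm (by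
    filter_upwards [hgood] with p ⟨h1, h2⟩
    obtain ⟨B, hB⟩ := h2.exists_finset hκ (τ : ℝ)
    have h3 := (h1.intervalIntegrable_walk x τ.coe_nonneg hB).1
    rcases eq_or_ne (τ : ℝ) 0 with h0 | h0
    · simp [h0]
    have h4 := h3.comp_mul_left (c := (τ : ℝ))
    rw [zero_div, div_self h0, intervalIntegrable_iff_integrableOn_Ioc_of_le zero_le_one] at h4
    exact h4)
  filter_upwards [h, ae_sampleLaw_mem] with u hu hmem
  have h1 := Measure.ae_ae_of_ae_prod hu
  filter_upwards [h1] with ω h1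
  refine lintegral_congr_ae (ae_restrict_of_ae ?_)
  filter_upwards [h1] with w h1
  have h2 : action (path ξ ω) κ x τ w
      = sampledAction u τ (restrictPath τ (path ξ ω)) κ x w := by
    rw [action, hcov, sampledAction]
    refine congrArg _ (h1.limsup_eq.symm.trans (congrArg (fun g => limsup g atTop) ?_))
    funext n
    congr 1
    refine Finset.sum_congr rfl fun i _ => ?_
    have h3 : ((τ : ℝ) - τ * u i).toNNReal = sampleTime τ (u i) := by
      change _ = τ - τ * (u i).toNNReal
      rw [NNReal.sub_def, NNReal.coe_mul, Real.coe_toNNReal _ (hmem i).1.le]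
    rw [h3]
    rfl
  rw [weight, h2]

end Representation

/-! ### Stationary fields and almost sure versions of path functionals. -/

section Rep

variable {d : ℕ} [NeZero d] {Ω : Type*} [MeasurableSpace Ω]

lemma shift_zero (v : ℝ≥0 → Config d) : shift 0 0 v = v := by
  funext t x; simp [shift]

lemma shift_shift (s s' : ℝ≥0) (y y' : Site d) (v : ℝ≥0 → Config d) :
    shift s y (shift s' y' v) = shift (s' + s) (y' + y) v := by
  funext t x; simp [shift, add_assoc]

lemma measurable_shift (s : ℝ≥0) (y : Site d) : Measurable (shift (d := d) s y) :=
  measurable_pi_iff.2 fun t => measurable_pi_iff.2 fun x =>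
    (measurable_pi_apply (y + x)).comp (measurable_pi_apply (s + t))

/-- Jointly measurable, stationary fields with a finite mean. -/
structure IsField (P : Measure Ω) (ξ : ℝ≥0 → Ω → Config d) : Prop where
  measurable : Measurable fun p : ℝ≥0 × Ω => ξ p.1 p.2
  stationary : IsStationary P ξ
  integrable : Integrable (fun ω => ξ 0 ω 0) P

lemma IsEnvironment.isField {P : Measure Ω} {ξ : ℝ≥0 → Ω → Config d} (h : IsEnvironment P ξ) :
    IsField P ξ := ⟨h.measurable, h.stationary, h.integrable⟩

lemma measurable_path {ξ : ℝ≥0 → Ω → Config d} (h : Measurable fun p : ℝ≥0 × Ω => ξ p.1 p.2) :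
    Measurable (path ξ) :=
  measurable_pi_iff.2 fun _ => h.comp measurable_prodMk_left

lemma measurable_shift_path {ξ : ℝ≥0 → Ω → Config d}
    (h : Measurable fun p : ℝ≥0 × Ω => ξ p.1 p.2) (s : ℝ≥0) (y : Site d) :
    Measurable fun ω => shift s y (path ξ ω) := (measurable_shift s y).comp (measurable_path h)

variable {P : Measure Ω} [IsProbabilityMeasure P] {ξ : ℝ≥0 → Ω → Config d}

/-- The field of absolute values. -/
def absEnv (v : ℝ≥0 → Config d) : ℝ≥0 → Config d := fun s x => |v s x|

lemma measurable_absEnv : Measurable (absEnv (d := d)) :=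
  measurable_pi_iff.2 fun t => measurable_pi_iff.2 fun x =>
    Measurable.norm (f := fun v : ℝ≥0 → Config d => v t x)
      ((measurable_pi_apply x).comp (measurable_pi_apply t))

lemma IsField.abs (h : IsField P ξ) : IsField P fun t ω x => |ξ t ω x| where
  measurable := measurable_pi_iff.2 fun x => (measurable_pi_iff.1 h.measurable x).norm
  stationary s y := by
    have h1 := congrArg (Measure.map (PAM.absEnv (d := d))) (h.stationary s y)
    rw [Measure.map_map measurable_absEnv
        (measurable_shift_path h.measurable s y),
      Measure.map_map measurable_absEnv (measurable_path h.measurable)] at h1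
    exact h1
  integrable := h.integrable.abs

lemma IsField.identDistrib (h : IsField P ξ) (s : ℝ≥0) (x : Site d) :
    IdentDistrib (fun ω => ξ s ω x) (fun ω => ξ 0 ω 0) P P := by
  have hm : Measurable fun v : ℝ≥0 → Config d => v 0 0 :=
    (measurable_pi_apply (0 : Site d)).comp (measurable_pi_apply (0 : ℝ≥0))
  have hp := measurable_path h.measurable
  refine ⟨(measurable_pi_iff.1 (measurable_pi_iff.1 hp s) x).aemeasurable,
    (measurable_pi_iff.1 (measurable_pi_iff.1 hp 0) 0).aemeasurable, ?_⟩
  have h1 := congrArg (Measure.map fun v : ℝ≥0 → Config d => v 0 0) (h.stationary s x)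
  rw [Measure.map_map hm (measurable_shift_path h.measurable s x), Measure.map_map hm hp] at h1
  convert h1 using 2
  · funext ω
    simp [shift, path]
  · rfl

/-- Tonelli. The measure is general because the law of the process restarted by the Markov kernel
needs the same conclusion. -/
lemma ae_locInt_of_lintegral_le {Q : Measure Ω} [IsFiniteMeasure Q]
    (hξ : Measurable fun p : ℝ≥0 × Ω => ξ p.1 p.2) {C : ℝ≥0∞} (hC : C ≠ ⊤)
    (h : ∀ s x, ∫⁻ ω, ‖ξ s ω x‖ₑ ∂Q ≤ C) : ∀ᵐ ω ∂Q, LocInt (path ξ ω) := by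
  have hmx : ∀ x, Measurable fun p : ℝ≥0 × Ω => ξ p.1 p.2 x := measurable_pi_iff.1 hξ
  have h1 : ∀ (x : Site d) (n : ℕ), ∀ᵐ ω ∂Q,
      IntegrableOn (fun s : ℝ => ξ s.toNNReal ω x) (Ioc 0 n) := by
    intro x n
    have hm : Measurable fun p : Ω × ℝ => ‖ξ p.2.toNNReal p.1 x‖ₑ :=
      ((hmx x).comp (f := fun p : Ω × ℝ => (p.2.toNNReal, p.1)) (by fun_prop)).enorm
    have h2 : ∫⁻ ω, (∫⁻ s : ℝ in Ioc (0 : ℝ) (n : ℝ), ‖ξ s.toNNReal ω x‖ₑ) ∂Q ≠ ⊤ := by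
      rw [lintegral_lintegral_swap hm.aemeasurable]
      refine ne_top_of_le_ne_top ?_ (lintegral_mono fun s => h s.toNNReal x)
      simp [ENNReal.mul_eq_top, hC]
    filter_upwards [ae_lt_top hm.lintegral_prod_right' h2] with ω hω
    exact ⟨((hmx x).comp (f := fun s : ℝ => (s.toNNReal, ω))
      (by fun_prop)).aestronglyMeasurable, hω⟩
  filter_upwards [ae_all_iff.2 fun x => ae_all_iff.2 (h1 x)] with ω hω
  refine ⟨fun x => (hmx x).comp measurable_prodMk_right, fun x t ht => ?_⟩
  obtain ⟨n, hn⟩ := exists_nat_ge t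
  rw [intervalIntegrable_iff_integrableOn_Ioc_of_le ht]
  exact (hω x n).mono_set (Ioc_subset_Ioc_right hn)

lemma IsField.ae_locInt (h : IsField P ξ) : ∀ᵐ ω ∂P, LocInt (path ξ ω) := by
  refine ae_locInt_of_lintegral_le h.measurable (C := ∫⁻ ω, ‖ξ 0 ω 0‖ₑ ∂P)
    h.integrable.2.ne fun s x => le_of_eq ?_
  exact ((h.identDistrib s x).comp measurable_enorm).lintegral_eq

/-- Functionals of the trajectory which, on all translates of `ξ`, agree almost surely with a
functional that is measurable for the product `σ`-algebra. -/
def IsPathFunctional (P : Measure Ω) (ξ : ℝ≥0 → Ω → Config d) {β : Type*} [MeasurableSpace β]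
    (F : (ℝ≥0 → Config d) → β) : Prop :=
  ∃ G : (ℝ≥0 → Config d) → β, Measurable G ∧
    ∀ (s : ℝ≥0) (y : Site d), ∀ᵐ ω ∂P, F (shift s y (path ξ ω)) = G (shift s y (path ξ ω))

namespace IsPathFunctional

variable {β : Type*} [MeasurableSpace β] {F : (ℝ≥0 → Config d) → β}

lemma comp {δ : Type*} [MeasurableSpace δ] {g : β → δ} (hg : Measurable g)
    (hF : IsPathFunctional P ξ F) : IsPathFunctional P ξ fun v => g (F v) := by
  obtain ⟨G, hG, h⟩ := hF
  refine ⟨fun v => g (G v), hg.comp hG, fun s y => ?_⟩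
  filter_upwards [h s y] with ω hω
  rw [hω]

lemma comp_shift (hF : IsPathFunctional P ξ F) (s : ℝ≥0) (y : Site d) :
    IsPathFunctional P ξ fun v => F (shift s y v) := by
  obtain ⟨G, hG, h⟩ := hF
  refine ⟨fun v => G (shift s y v), hG.comp (measurable_shift s y), fun s' y' => ?_⟩
  simp only [shift_shift]
  exact h _ _

lemma aemeasurable (hF : IsPathFunctional P ξ F)
    (hξ : Measurable fun p : ℝ≥0 × Ω => ξ p.1 p.2) :
    AEMeasurable (fun ω => F (path ξ ω)) P := by
  obtain ⟨G, hG, h⟩ := hF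
  refine ⟨_, hG.comp (measurable_path hξ), ?_⟩
  have := h 0 0
  simp only [shift_zero] at this
  exact this

lemma identDistrib (hF : IsPathFunctional P ξ F) (hξ : IsField P ξ) (s : ℝ≥0) (y : Site d) :
    IdentDistrib (fun ω => F (shift s y (path ξ ω))) (fun ω => F (path ξ ω)) P P := by
  refine ⟨(hF.comp_shift s y).aemeasurable hξ.measurable, hF.aemeasurable hξ.measurable, ?_⟩
  obtain ⟨G, hG, h⟩ := hF
  have h0 := h 0 0
  simp only [shift_zero] at h0
  have hp := measurable_path hξ.measurable
  rw [Measure.map_congr (h s y), Measure.map_congr h0]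
  have h1 := congrArg (Measure.map G) (hξ.stationary s y)
  rwa [Measure.map_map hG (measurable_shift_path hξ.measurable s y), Measure.map_map hG hp] at h1

end IsPathFunctional

/-- The version must be the same for all translates. Two sampling sequences that are good for the
original path give versions that agree almost surely under its law, hence by stationarity along
every translate. Choosing `u'` good for the given translate as well shows that the version with the
fixed `u` is correct there. -/
lemma IsField.isPathFunctional_fkOn (h : IsField P ξ) (A : Set (WalkSpace d)) {κ : ℝ}
    (hκ : 0 ≤ κ) (γ : ℝ) (x : Site d) {t : ℝ} (ht : 0 ≤ t) :
    IsPathFunctional P ξ fun v => fkOn A v κ γ x t := by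
  lift t to ℝ≥0 using ht
  have hrep : ∀ (s : ℝ≥0) (y : Site d), ∀ᵐ u ∂sampleLaw, ∀ᵐ ω ∂P,
      fkOn A (shift s y (path ξ ω)) κ γ x t
        = sampledFkOn A u t (restrictPath t (shift s y (path ξ ω))) κ γ x := by
    intro s y
    refine ae_fkOn_eq_sampledFkOn (ξ := fun r ω z => ξ (s + r) ω (y + z)) ?_ ?_ A hκ γ x t
    · exact measurable_pi_iff.2 fun z => (measurable_pi_iff.1 h.measurable (y + z)).comp
        (f := fun p : ℝ≥0 × Ω => (s + p.1, p.2)) (by fun_prop)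
    · filter_upwards [h.ae_locInt] with ω hω
      exact hω.shift s y
  have h0 := hrep 0 0
  simp only [shift_zero] at h0
  have hG : ∀ u, Measurable fun v : ℝ≥0 → Config d =>
      sampledFkOn A u t (restrictPath t v) κ γ x := fun u =>
    (measurable_sampledFkOn A u t κ γ x).comp (measurable_restrictPath t)
  obtain ⟨u, hu⟩ := h0.exists
  refine ⟨_, hG u, fun s y => ?_⟩
  obtain ⟨u', hu', hs'⟩ := (h0.and (hrep s y)).exists
  have hp := measurable_path h.measurable
  have hS : MeasurableSet {v : ℝ≥0 → Config d | sampledFkOn A u t (restrictPath t v) κ γ x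
      = sampledFkOn A u' t (restrictPath t v) κ γ x} := measurableSet_eq_fun (hG u) (hG u')
  have h1 : ∀ᵐ v ∂(P.map (path ξ)), sampledFkOn A u t (restrictPath t v) κ γ x
      = sampledFkOn A u' t (restrictPath t v) κ γ x := by
    rw [ae_map_iff hp.aemeasurable hS]
    filter_upwards [hu, hu'] with ω h2 h3
    rw [← h2, h3]
  rw [← h.stationary s y,
    ae_map_iff (measurable_shift_path h.measurable s y).aemeasurable hS] at h1
  filter_upwards [h1, hs'] with ω h2 h3
  rw [h3, h2]

lemma IsField.isPathFunctional_pamSol (h : IsField P ξ) {κ : ℝ}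
    (hκ : 0 ≤ κ) (γ : ℝ) (x : Site d) {t : ℝ} (ht : 0 ≤ t) :
    IsPathFunctional P ξ fun v => pamSol v κ γ x t := by
  simp only [pamSol_eq_fkOn]
  exact h.isPathFunctional_fkOn _ hκ γ x ht

lemma IsField.isPathFunctional_totalMass (h : IsField P ξ) {κ : ℝ}
    (hκ : 0 ≤ κ) (γ : ℝ) (x : Site d) {t : ℝ} (ht : 0 ≤ t) :
    IsPathFunctional P ξ fun v => totalMass v κ γ x t := by
  simp only [totalMass_eq_fkOn]
  exact h.isPathFunctional_fkOn _ hκ γ x ht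

lemma integral_eq_log_totalMass (v : ℝ≥0 → Config d) (x : Site d) (t : ℝ) :
    ∫ s in (0 : ℝ)..t, v s.toNNReal x = Real.log (totalMass v 0 1 x t).toReal := by
  rw [totalMass_zero_one, ENNReal.toReal_ofReal (Real.exp_nonneg _), Real.log_exp]

lemma IsField.isPathFunctional_integral (h : IsField P ξ) (x : Site d) {t : ℝ} (ht : 0 ≤ t) :
    IsPathFunctional P ξ fun v => ∫ s in (0 : ℝ)..t, v s.toNNReal x := by
  simp only [integral_eq_log_totalMass]
  exact (h.isPathFunctional_totalMass le_rfl 1 x ht).comp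
    (g := fun z : ℝ≥0∞ => Real.log z.toReal) (by fun_prop)

lemma IsField.isPathFunctional_integral_abs (h : IsField P ξ) (x : Site d) {t : ℝ}
    (ht : 0 ≤ t) : IsPathFunctional P ξ fun v => ∫ s in (0 : ℝ)..t, |v s.toNNReal x| := by
  obtain ⟨G, hG, hF⟩ := h.abs.isPathFunctional_integral x ht
  exact ⟨fun v => G (absEnv v), hG.comp measurable_absEnv, hF⟩

/-- The mean of a time integral. -/
lemma IsField.integral_integral (h : IsField P ξ) (x : Site d) {t : ℝ} (ht : 0 ≤ t) :
    Integrable (fun ω => ∫ s in (0 : ℝ)..t, ξ s.toNNReal ω x) P ∧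
      ∫ ω, (∫ s in (0 : ℝ)..t, ξ s.toNNReal ω x) ∂P = t * density P ξ := by
  have hm : Measurable fun p : Ω × ℝ => ξ p.2.toNNReal p.1 x :=
    (measurable_pi_iff.1 h.measurable x).comp
      (f := fun p : Ω × ℝ => (p.2.toNNReal, p.1)) (by fun_prop)
  have hi : Integrable (fun p : Ω × ℝ => ξ p.2.toNNReal p.1 x)
      (P.prod (volume.restrict (Ioc 0 t))) := by
    refine ⟨hm.aestronglyMeasurable, ?_⟩
    have h1 : ∀ s : ℝ, ∫⁻ ω, ‖ξ s.toNNReal ω x‖ₑ ∂P = ∫⁻ ω, ‖ξ 0 ω 0‖ₑ ∂P := fun s =>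
      ((h.identDistrib s.toNNReal x).comp measurable_enorm).lintegral_eq
    rw [HasFiniteIntegral, lintegral_prod_symm _ hm.enorm.aemeasurable]
    simp only [h1, lintegral_const]
    exact ENNReal.mul_lt_top h.integrable.2 (by simp)
  simp only [intervalIntegral.integral_of_le ht]
  refine ⟨hi.integral_prod_left, ?_⟩
  rw [integral_integral_swap hi]
  have h2 : ∀ s : ℝ, ∫ ω, ξ s.toNNReal ω x ∂P = density P ξ := fun s =>
    (h.identDistrib s.toNNReal x).integral_eq
  simp [h2, ht]

end Rep

/-! ### A covering argument for superadditive processes. -/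

section Superadditive

variable {X : Type*} [MeasurableSpace X] {μ : Measure X} [IsProbabilityMeasure μ] {T : X → X}

lemma sum_le_sum_of_subset_of_nonpos {s t : Finset ℕ} {f : ℕ → ℝ} (h : s ⊆ t)
    (hf : ∀ j, f j ≤ 0) : ∑ j ∈ t, f j ≤ ∑ j ∈ s, f j := by
  have := Finset.sum_le_sum_of_subset_of_nonneg (f := fun j => -f j) h
    fun j _ _ => neg_nonneg.2 (hf j)
  simpa using this

/-- Cover an orbit segment by blocks on which a superadditive process is nonnegative, except for
single bad points and for an end of length at most `N`. -/
lemma superadditive_cover {H : ℕ → X → ℝ} {φ ψ : X → ℝ} {x : X} {N : ℕ}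
    (h0 : ∀ i, 0 ≤ H 0 (T^[i] x))
    (hsup : ∀ i m n, H m (T^[i] x) + H n (T^[m + i] x) ≤ H (m + n) (T^[i] x))
    (hφ : ∀ y, φ y ≤ 0) (hψ : ∀ y, ψ y ≤ 0) (hψ1 : ∀ y, ψ y ≤ H 1 y)
    (hτ : ∀ y, ∃ n, 1 ≤ n ∧ n ≤ N ∧ φ y ≤ H n y) (M : ℕ) : ∀ i,
    ∑ j ∈ Finset.range M, φ (T^[j + i] x) + ∑ j ∈ Finset.Ico (M - N) M, ψ (T^[j + i] x)
      ≤ H M (T^[i] x) := by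
  have hstep : ∀ M i, ∑ j ∈ Finset.range M, ψ (T^[j + i] x) ≤ H M (T^[i] x) := by
    intro M
    induction M with
    | zero => intro i; simpa using h0 i
    | succ M ih =>
      intro i
      rw [Finset.sum_range_succ', add_comm]
      refine le_trans (add_le_add ?_ ?_) ((hsup i 1 M).trans_eq (by rw [add_comm 1]))
      · rw [zero_add]; exact hψ1 _
      · refine le_trans (le_of_eq ?_) (ih (1 + i))
        exact Finset.sum_congr rfl fun j _ => by rw [add_assoc]
  induction M using Nat.strong_induction_on with
  | _ M ih =>
    intro i
    -- Greedy covering: the block at the current point is used if it fits; otherwise fewer than `N`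
    -- points remain, and unit steps cover them.
    obtain ⟨n, hn1, hnN, hn⟩ := hτ (T^[i] x)
    rcases le_or_gt n M with h | h
    · rcases Nat.eq_zero_or_pos M with rfl | hM
      · omega
      have h1 := ih (M - n) (by omega) (n + i)
      have h2 := hsup i n (M - n)
      rw [Nat.add_sub_cancel' h] at h2
      have h3 : ∑ j ∈ Finset.range M, φ (T^[j + i] x)
          ≤ φ (T^[i] x) + ∑ j ∈ Finset.range (M - n), φ (T^[j + (n + i)] x) := by
        have h4 : ∑ j ∈ Finset.range (M - n), φ (T^[j + (n + i)] x)
            = ∑ j ∈ Finset.Ico n M, φ (T^[j + i] x) := by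
          rw [Finset.sum_Ico_eq_sum_range]
          exact Finset.sum_congr rfl fun j _ => by rw [add_comm n j, add_assoc]
        rw [h4, ← Finset.sum_range_add_sum_Ico _ h]
        gcongr
        have : φ (T^[i] x) = φ (T^[0 + i] x) := by rw [zero_add]
        rw [this, ← Finset.sum_singleton (fun j => φ (T^[j + i] x)) 0]
        refine sum_le_sum_of_subset_of_nonpos ?_ fun j => hφ _
        simpa using (show 0 < n from hn1)
      have h5 : ∑ j ∈ Finset.Ico (M - N) M, ψ (T^[j + i] x)
          ≤ ∑ j ∈ Finset.Ico (M - n - N) (M - n), ψ (T^[j + (n + i)] x) := by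
        have h4 : ∑ j ∈ Finset.Ico (M - n - N) (M - n), ψ (T^[j + (n + i)] x)
            = ∑ j ∈ Finset.Ico (M - n - N + n) M, ψ (T^[j + i] x) := by
          have := Finset.sum_Ico_add' (fun j => ψ (T^[j + i] x)) (M - n - N) (M - n) n
          rw [Nat.sub_add_cancel h] at this
          rw [← this]
          exact Finset.sum_congr rfl fun j _ => by rw [add_assoc]
        rw [h4]
        exact sum_le_sum_of_subset_of_nonpos (Finset.Ico_subset_Ico_left (by omega))
          fun j => hψ _
      linarith
    · have h1 : M - N = 0 := by omega
      rw [h1, ← Finset.range_eq_Ico]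
      have := Finset.sum_nonpos (s := Finset.range M) fun j _ => hφ (T^[j + i] x)
      linarith [hstep M i]

/-- A superadditive process that is nonnegative at some positive time, from almost every starting
point, does not have a negative mean rate. -/
lemma superadditive_exists_integral_ge (hT : MeasurePreserving T μ μ) {H : ℕ → X → ℝ}
    (hm : ∀ n, Measurable (H n)) (hint : ∀ n, Integrable (H n) μ) (h0 : ∀ᵐ x ∂μ, 0 ≤ H 0 x)
    (hsup : ∀ m n, ∀ᵐ x ∂μ, H m x + H n (T^[m] x) ≤ H (m + n) x)
    (hpos : ∀ᵐ x ∂μ, ∃ n, 1 ≤ n ∧ 0 ≤ H n x) {ε : ℝ} (hε : 0 < ε) :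
    ∃ M : ℕ, 1 ≤ M ∧ -ε * M ≤ ∫ x, H M x ∂μ := by
  classical
  set ψ : X → ℝ := fun x => min (H 1 x) 0 with hψdef
  set A : ℕ → Set X := fun N => {x | ∃ n, 1 ≤ n ∧ n ≤ N ∧ 0 ≤ H n x} with hA
  set φ : ℕ → X → ℝ := fun N => (A N)ᶜ.indicator ψ with hφdef
  have hψ0 : ∀ x, ψ x ≤ 0 := fun x => min_le_right _ _
  have hφ0 : ∀ N x, φ N x ≤ 0 := fun N => indicator_nonpos fun y _ => hψ0 y
  have hψm : Measurable ψ := (hm 1).min measurable_const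
  have hψi : Integrable ψ μ := (hint 1).inf (integrable_const 0)
  have hAm : ∀ N, MeasurableSet (A N) := by
    intro N
    have : A N = ⋃ n ∈ Finset.Icc 1 N, {x | 0 ≤ H n x} := by
      ext x; simp [hA, and_assoc]
    rw [this]
    exact Finset.measurableSet_biUnion _ fun n _ => measurableSet_le measurable_const (hm n)
  have hφi : ∀ N, Integrable (φ N) μ := fun N => hψi.indicator (hAm N).compl
  -- As the permitted block length grows, the bad set shrinks to a null set.
  have hlim : Tendsto (fun N => ∫ x, φ N x ∂μ) atTop (𝓝 (∫ _, (0 : ℝ) ∂μ)) := by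
    refine tendsto_integral_of_dominated_convergence (fun x => |ψ x|)
      (fun N => (hφi N).aestronglyMeasurable) hψi.abs (fun N => .of_forall fun x => ?_) ?_
    · exact norm_indicator_le_norm_self ψ x
    · filter_upwards [hpos] with x ⟨n, hn1, hn⟩
      refine tendsto_const_nhds.congr' ?_
      filter_upwards [eventually_ge_atTop n] with N hN
      exact (indicator_of_notMem (not_not.2 ⟨n, hn1, hN, hn⟩) _).symm
  rw [integral_zero] at hlim
  obtain ⟨N, hN, hN1⟩ := ((hlim.eventually (lt_mem_nhds (show -(ε / 2) < 0 by linarith))).and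
    (eventually_ge_atTop 1)).exists
  have hit : ∀ i, MeasurePreserving T^[i] μ μ := fun i => hT.iterate i
  have hcover : ∀ M, ∑ j ∈ Finset.range M, ∫ x, φ N x ∂μ
      + ∑ j ∈ Finset.Ico (M - N) M, ∫ x, ψ x ∂μ ≤ ∫ x, H M x ∂μ := by
    intro M
    have hcomp : ∀ {f : X → ℝ}, Measurable f → Integrable f μ → ∀ j,
        Integrable (fun x => f (T^[j] x)) μ ∧ ∫ x, f (T^[j] x) ∂μ = ∫ x, f x ∂μ := by
      intro f hfm hf j
      refine ⟨(hit j).integrable_comp_of_integrable hf, ?_⟩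
      have := integral_map (hit j).measurable.aemeasurable (f := f) (μ := μ)
        (by rw [(hit j).map_eq]; exact hfm.aestronglyMeasurable)
      rw [← this, (hit j).map_eq]
    have hφm : Measurable (φ N) := hψm.indicator (hAm N).compl
    rw [← Finset.sum_congr rfl fun j _ => (hcomp hφm (hφi N) j).2,
      ← Finset.sum_congr rfl fun j _ => (hcomp hψm hψi j).2,
      ← integral_finsetSum _ fun j _ => (hcomp hφm (hφi N) j).1,
      ← integral_finsetSum _ fun j _ => (hcomp hψm hψi j).1,
      ← integral_add (integrable_finsetSum _ fun j _ => (hcomp hφm (hφi N) j).1)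
        (integrable_finsetSum _ fun j _ => (hcomp hψm hψi j).1)]
    refine integral_mono_ae ((integrable_finsetSum _ fun j _ => (hcomp hφm (hφi N) j).1).add
        (integrable_finsetSum _ fun j _ => (hcomp hψm hψi j).1)) (hint M) ?_
    have h1 : ∀ᵐ x ∂μ, ∀ i, 0 ≤ H 0 (T^[i] x) :=
      ae_all_iff.2 fun i => (hit i).quasiMeasurePreserving.ae h0
    have h2 : ∀ᵐ x ∂μ, ∀ i m n, H m (T^[i] x) + H n (T^[m + i] x) ≤ H (m + n) (T^[i] x) := by
      refine ae_all_iff.2 fun i => ae_all_iff.2 fun m => ae_all_iff.2 fun n => ?_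
      have := (hit i).quasiMeasurePreserving.ae (hsup m n)
      filter_upwards [this] with x hx
      rwa [Function.iterate_add_apply]
    filter_upwards [h1, h2] with x hx1 hx2
    refine superadditive_cover (i := 0) (N := N) hx1 hx2 (hφ0 N) hψ0 (fun y => min_le_left _ _) ?_ M
    intro y
    by_cases hy : y ∈ A N
    · obtain ⟨n, hn1, hnN, hn⟩ := hy
      exact ⟨n, hn1, hnN, (hφ0 N y).trans hn⟩
    · refine ⟨1, le_rfl, hN1, ?_⟩
      refine (indicator_of_mem (s := (A N)ᶜ) hy ψ).trans_le ?_
      exact min_le_left _ _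
  -- `M` is so large that the final stretch of at most `N` unit steps costs at most `ε M / 2`; the
  -- bad points cost at most another `ε M / 2`.
  obtain ⟨M, hM⟩ := exists_nat_ge (max 1 (2 * (N * -∫ x, ψ x ∂μ) / ε))
  have hM1 : (1 : ℝ) ≤ M := (le_max_left _ _).trans hM
  have hM2 := (le_max_right _ _).trans hM
  rw [div_le_iff₀ hε] at hM2
  refine ⟨M, by exact_mod_cast hM1, ?_⟩
  have h1 := hcover M
  simp only [Finset.sum_const, Finset.card_range, Nat.card_Ico, nsmul_eq_mul] at h1
  have hψint : ∫ x, ψ x ∂μ ≤ 0 := integral_nonpos hψ0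
  have h2 : ((M - (M - N) : ℕ) : ℝ) ≤ N := by
    have : M - (M - N) ≤ N := by omega
    exact_mod_cast this
  nlinarith

/-- Upper bound for the rate of a superadditive process. -/
lemma superadditive_rate_le (hT : MeasurePreserving T μ μ) {G : ℕ → X → ℝ}
    (hm : ∀ n, Measurable (G n)) (hint : ∀ n, Integrable (G n) μ) (h0 : ∀ᵐ x ∂μ, 0 ≤ G 0 x)
    (hsup : ∀ m n, ∀ᵐ x ∂μ, G m x + G n (T^[m] x) ≤ G (m + n) x) {a l : ℝ}
    (hl : ∀ n : ℕ, 1 ≤ n → ∫ x, G n x ∂μ ≤ l * n)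
    (ha : ∀ᵐ x ∂μ, ∃ n : ℕ, 1 ≤ n ∧ a * n ≤ G n x) : a ≤ l := by
  refine le_of_forall_pos_le_add fun ε hε => ?_
  -- Subtracting a linear process keeps superadditivity and turns the hypothesis into nonnegativity
  -- at some time.
  obtain ⟨M, hM1, hM⟩ := superadditive_exists_integral_ge hT (H := fun n x => G n x - a * n)
    (fun n => (hm n).sub_const _) (fun n => (hint n).sub (integrable_const _))
    (by simpa using h0) (fun m n => by
      filter_upwards [hsup m n] with x hx
      push_cast
      linarith) (by
      filter_upwards [ha] with x ⟨n, hn, h⟩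
      exact ⟨n, hn, by linarith⟩) hε
  rw [integral_sub (hint M) (integrable_const _)] at hM
  simp only [integral_const, probReal_univ, smul_eq_mul, one_mul] at hM
  have h1 := hl M hM1
  have hMpos : (0 : ℝ) < M := by exact_mod_cast hM1
  nlinarith

/-- Lower bound for the rate of a superadditive process. -/
lemma superadditive_integral_le (hT : MeasurePreserving T μ μ) {G : ℕ → X → ℝ}
    (hm : ∀ n, Measurable (G n)) (hint : ∀ n, Integrable (G n) μ) (h0 : ∀ᵐ x ∂μ, 0 ≤ G 0 x)
    (hsup : ∀ m n, ∀ᵐ x ∂μ, G m x + G n (T^[m] x) ≤ G (m + n) x) {a : ℝ}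
    (ha : ∀ᵐ x ∂μ, ∃ n : ℕ, 1 ≤ n ∧ G n x ≤ a * n) : ∫ x, G 1 x ∂μ ≤ a := by
  have hit : ∀ i, MeasurePreserving T^[i] μ μ := fun i => hT.iterate i
  have hcomp : ∀ j, Integrable (fun x => G 1 (T^[j] x)) μ ∧
      ∫ x, G 1 (T^[j] x) ∂μ = ∫ x, G 1 x ∂μ := by
    intro j
    refine ⟨(hit j).integrable_comp_of_integrable (hint 1), ?_⟩
    have := integral_map (hit j).measurable.aemeasurable (f := G 1) (μ := μ)
      (by rw [(hit j).map_eq]; exact (hm 1).aestronglyMeasurable)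
    rw [← this, (hit j).map_eq]
  have hSint : ∀ n, Integrable (fun x => ∑ j ∈ Finset.range n, G 1 (T^[j] x)) μ := fun n =>
    integrable_finsetSum _ fun j _ => (hcomp j).1
  have hle : ∀ n, ∀ᵐ x ∂μ, ∑ j ∈ Finset.range n, G 1 (T^[j] x) ≤ G n x := by
    intro n
    induction n with
    | zero => simpa using h0
    | succ n ih =>
      filter_upwards [ih, hsup n 1] with x h1 h2
      rw [Finset.sum_range_succ]
      linarith
  refine le_of_forall_pos_le_add fun ε hε => ?_
  -- Birkhoff sums of `G 1` lie below `G`, so this additive process is nonnegative whenever `G n ≤ a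
  -- n`; its mean is `M (a - ∫ G 1)`.
  obtain ⟨M, hM1, hM⟩ := superadditive_exists_integral_ge hT
    (H := fun n x => a * n - ∑ j ∈ Finset.range n, G 1 (T^[j] x))
    (fun n => measurable_const.sub (Finset.measurable_sum _ fun j _ =>
      (hm 1).comp (hit j).measurable))
    (fun n => (integrable_const _).sub (hSint n)) (by simp) (fun m n => .of_forall fun x => by
      rw [Finset.sum_range_add]
      simp only [← Function.iterate_add_apply, add_comm m]
      push_cast
      linarith) (by
      filter_upwards [ha, ae_all_iff.2 hle] with x ⟨n, hn, h⟩ h2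
      exact ⟨n, hn, by linarith [h2 n]⟩) hε
  rw [integral_sub (integrable_const _) (hSint M), integral_finsetSum _ fun j _ => (hcomp j).1,
    Finset.sum_congr rfl fun j _ => (hcomp j).2] at hM
  simp only [integral_const, probReal_univ, smul_eq_mul, one_mul, Finset.sum_const,
    Finset.card_range, nsmul_eq_mul] at hM
  have hMpos : (0 : ℝ) < M := by exact_mod_cast hM1
  nlinarith

end Superadditive

/-! ### The logarithm of the solution. -/

section LogSolution

variable {d : ℕ} [NeZero d]

/-- The logarithm of the solution at the origin. -/
def logSol (v : ℝ≥0 → Config d) (κ γ t : ℝ) : ℝ := Real.log (pamSol v κ γ 0 t).toReal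

lemma log_add_log_le {a b c : ℝ≥0∞} (ha : 0 < a) (hb : 0 < b) (h : a * b ≤ c) (hc : c < ⊤) :
    Real.log a.toReal + Real.log b.toReal ≤ Real.log c.toReal := by
  have hab := h.trans_lt hc
  have ha' : a ≠ ⊤ := by rintro rfl; simp [ENNReal.top_mul hb.ne'] at hab
  have hb' : b ≠ ⊤ := by rintro rfl; simp [ENNReal.mul_top ha.ne'] at hab
  have h1 := ENNReal.toReal_pos ha.ne' ha'
  have h2 := ENNReal.toReal_pos hb.ne' hb'
  rw [← Real.log_mul h1.ne' h2.ne', ← ENNReal.toReal_mul]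
  exact Real.log_le_log (by rw [ENNReal.toReal_mul]; positivity) (ENNReal.toReal_mono hc.ne h)

lemma pamSol_zero_pos {v : ℝ≥0 → Config d} {κ γ : ℝ} (hκ : 0 ≤ κ) {t : ℝ} (ht : 0 ≤ t) :
    0 < pamSol v κ γ 0 t :=
  lt_of_lt_of_le (by simp [Real.exp_pos]) (LocInt.exp_le_pamSol hκ ht)

lemma LocInt.logSol_add_le {v : ℝ≥0 → Config d} (hv : LocInt v) {κ γ : ℝ} (hκ : 0 ≤ κ) {s t : ℝ}
    (hs : 0 ≤ s) (ht : 0 ≤ t) (hfin : pamSol v κ γ 0 (s + t) < ⊤) :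
    logSol v κ γ s + logSol (PAM.shift s.toNNReal 0 v) κ γ t ≤ logSol v κ γ (s + t) := by
  have := hv.mul_le_pamSol hκ γ 0 0 hs ht
  rw [sub_zero, add_comm t s] at this
  rw [add_comm]
  exact log_add_log_le (pamSol_zero_pos hκ ht) (pamSol_zero_pos hκ hs) this hfin

lemma logSol_ge {v : ℝ≥0 → Config d} {κ γ : ℝ} (hκ : 0 ≤ κ) {t : ℝ} (ht : 0 ≤ t)
    (hfin : pamSol v κ γ 0 t < ⊤) :
    -(2 * d * κ * t) + γ * ∫ s in (0 : ℝ)..t, v s.toNNReal 0 ≤ logSol v κ γ t := by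
  have h := (ENNReal.ofReal_le_iff_le_toReal hfin.ne).1 (LocInt.exp_le_pamSol hκ ht)
  have h1 := Real.log_le_log (Real.exp_pos _) h
  rwa [Real.log_exp] at h1

/-- Finiteness at integer times gives finiteness at all times. -/
lemma LocInt.pamSol_lt_top {v : ℝ≥0 → Config d} (hv : LocInt v) {κ γ : ℝ} (hκ : 0 ≤ κ)
    (h : ∀ n : ℕ, pamSol v κ γ 0 n < ⊤) {t : ℝ} (ht : 0 ≤ t) : pamSol v κ γ 0 t < ⊤ := by
  obtain ⟨n, hn⟩ := exists_nat_ge t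
  have h1 := hv.mul_le_pamSol hκ γ 0 0 ht (sub_nonneg.2 hn)
  rw [sub_zero, sub_add_cancel] at h1
  by_contra hc
  rw [not_lt_top_iff.1 hc, ENNReal.mul_top (pamSol_zero_pos hκ (sub_nonneg.2 hn)).ne', top_le_iff]
    at h1
  exact (h n).ne h1

end LogSolution

/-! ### Borel–Cantelli for identically distributed variables. -/

section Edges

variable {Ω : Type*} [MeasurableSpace Ω] {P : Measure Ω} [IsProbabilityMeasure P]

/-- Integrability makes the sum over `k` of the probabilities of `(j + 1) X > k` finite, so
Borel–Cantelli applies without any independence. -/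
lemma ae_eventually_lt_of_identDistrib {X : Ω → ℝ} {Y : ℕ → Ω → ℝ} (hX : Integrable X P)
    (hX0 : ∀ ω, 0 ≤ X ω) (h : ∀ k, IdentDistrib (Y k) X P P) :
    ∀ᵐ ω ∂P, ∀ ε > 0, ∀ᶠ k : ℕ in atTop, Y k ω ≤ ε * k := by
  have key : ∀ j : ℕ, ∀ᵐ ω ∂P, ∀ᶠ k : ℕ in atTop, Y k ω ≤ 1 / ((j : ℝ) + 1) * k := by
    intro j
    have hj : (0 : ℝ) < (j : ℝ) + 1 := by positivity
    have h1 : ∑' k : ℕ, P {ω | ((j : ℝ) + 1) * X ω ∈ Ioi (k : ℝ)} < ⊤ := by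
      let _ : MeasureSpace Ω := ⟨P⟩
      exact tsum_prob_mem_Ioi_lt_top (X := fun ω => ((j : ℝ) + 1) * X ω) (hX.const_mul _)
        fun ω => mul_nonneg hj.le (hX0 ω)
    have h2 : ∀ k : ℕ, P {ω | ((j : ℝ) + 1) * Y k ω ∈ Ioi (k : ℝ)}
        = P {ω | ((j : ℝ) + 1) * X ω ∈ Ioi (k : ℝ)} := fun k =>
      ((h k).comp (measurable_const_mul ((j : ℝ) + 1))).measure_mem_eq measurableSet_Ioi
    simp only [← h2] at h1
    filter_upwards [ae_eventually_notMem h1.ne] with ω hω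
    filter_upwards [hω] with k hk
    simp only [mem_Ioi, not_lt] at hk
    rw [div_mul_eq_mul_div, one_mul, le_div_iff₀ hj]
    linarith
  filter_upwards [ae_all_iff.2 key] with ω hω ε hε
  obtain ⟨j, hj⟩ := exists_nat_one_div_lt hε
  filter_upwards [hω j] with k hk
  exact hk.trans (mul_le_mul_of_nonneg_right hj.le (Nat.cast_nonneg k))

end Edges

/-! ### The exponent, comparison of translates and the zero-one law. -/

section Lyapunov

variable {d : ℕ} [NeZero d] {Ω : Type*} [MeasurableSpace Ω]
  {P : Measure Ω} [IsProbabilityMeasure P] {ξ : ℝ≥0 → Ω → Config d}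

lemma IsField.isPathFunctional_logSol (h : IsField P ξ) {κ : ℝ} (hκ : 0 ≤ κ) (γ : ℝ) {t : ℝ}
    (ht : 0 ≤ t) : IsPathFunctional P ξ fun v => logSol v κ γ t :=
  (h.isPathFunctional_pamSol hκ γ 0 ht).comp (g := fun z : ℝ≥0∞ => Real.log z.toReal)
    (by fun_prop)

lemma IsEnvironment.ae_pamSol_lt_top (h : IsEnvironment P ξ) {κ γ : ℝ} (hκ : 0 ≤ κ)
    (hγ : 0 ≤ γ) (s : ℝ≥0) (y : Site d) :
    ∀ᵐ ω ∂P, ∀ t : ℝ, 0 ≤ t → pamSol (shift s y (path ξ ω)) κ γ 0 t < ⊤ := by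
  obtain ⟨c, hc⟩ := h.log_bound κ γ hκ hγ
  have h1 : ∀ n : ℕ, ∀ᵐ ω ∂P, pamSol (shift s y (path ξ ω)) κ γ 0 n < ⊤ := fun n =>
    ((h.isField.isPathFunctional_pamSol hκ γ 0 (Nat.cast_nonneg n)).identDistrib
      h.isField s y).symm.ae_mem_snd (t := Iio ⊤) measurableSet_Iio (hc n (Nat.cast_nonneg n)).1
  filter_upwards [ae_all_iff.2 h1, h.isField.ae_locInt] with ω h2 h3 t ht
  exact (h3.shift s y).pamSol_lt_top hκ h2 ht

lemma IsEnvironment.integrable_logSol (h : IsEnvironment P ξ) {κ γ : ℝ} (hκ : 0 ≤ κ)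
    (hγ : 0 ≤ γ) {t : ℝ} (ht : 0 ≤ t) : Integrable (fun ω => logSol (path ξ ω) κ γ t) P := by
  obtain ⟨c, hc⟩ := h.log_bound κ γ hκ hγ
  exact (hc t ht).2.1

/-- The Lyapunov exponent as the supremum of the mean growth rates. -/
def lyapunov (P : Measure Ω) (ξ : ℝ≥0 → Ω → Config d) (γ κ : ℝ) : ℝ :=
  sSup ((fun t : ℝ => (∫ ω, logSol (path ξ ω) κ γ t ∂P) / t) '' Ioi 0)

lemma IsEnvironment.integral_logSol_le (h : IsEnvironment P ξ) {κ γ : ℝ} (hκ : 0 ≤ κ)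
    (hγ : 0 ≤ γ) {t : ℝ} (ht : 0 < t) :
    ∫ ω, logSol (path ξ ω) κ γ t ∂P ≤ lyapunov P ξ γ κ * t := by
  obtain ⟨c, hc⟩ := h.log_bound κ γ hκ hγ
  rw [← div_le_iff₀ ht]
  refine le_csSup ⟨c, ?_⟩ ⟨t, ht, rfl⟩
  rintro _ ⟨s, hs, rfl⟩
  simp only
  rw [div_le_iff₀ hs]
  exact (hc s (le_of_lt hs)).2.2

lemma IsEnvironment.exists_lt_integral_logSol {κ γ a : ℝ} (ha : a < lyapunov P ξ γ κ) :
    ∃ t : ℝ, 0 < t ∧ a * t < ∫ ω, logSol (path ξ ω) κ γ t ∂P := by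
  obtain ⟨_, ⟨t, ht, rfl⟩, h⟩ := exists_lt_of_lt_csSup ((nonempty_Ioi).image _) ha
  exact ⟨t, ht, (lt_div_iff₀ ht).1 h⟩

/-- Integrals of `|ξ|` over far away time intervals are negligible. -/
lemma IsField.ae_eventually_integral_abs_le (h : IsField P ξ) (τ : ℝ≥0) (s : ℝ≥0) (y : Site d)
    {r : ℝ} (hr : 0 ≤ r) : ∀ᵐ ω ∂P, ∀ ε > 0, ∀ᶠ k : ℕ in atTop,
      ∫ q in (0 : ℝ)..r, |shift (s + k * τ) y (path ξ ω) q.toNNReal 0| ≤ ε * k :=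
  ae_eventually_lt_of_identDistrib (h.abs.integral_integral 0 hr).1
    (fun _ => intervalIntegral.integral_nonneg hr fun _ _ => abs_nonneg _)
    fun k => (h.isPathFunctional_integral_abs 0 hr).identDistrib h (s + k * τ) y

/-- The solution in a translated environment is not much larger than the solution. -/
lemma IsEnvironment.ae_eventually_logSol_shift_le (h : IsEnvironment P ξ) {κ γ : ℝ} (hκ : 0 < κ)
    (hγ : 0 ≤ γ) {s : ℝ≥0} (hs : 0 < s) (y : Site d) {τ : ℝ≥0} {K : ℕ} (hK : s < K * τ) :
    ∀ᵐ ω ∂P, ∀ ε > 0, ∀ᶠ k : ℕ in atTop,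
      logSol (shift s y (path ξ ω)) κ γ (k * τ) ≤ logSol (path ξ ω) κ γ ((k + K : ℕ) * τ) + ε * k := by
  classical
  obtain ⟨n, p, hp⟩ := exists_stepSum_eq y
  set B : Finset (Site d) := (Finset.range (n + 1)).image (stepSum p) with hB
  -- The travel time from `0` to `y`, chosen so that `r + (s + k τ) = (k + K) τ` is again a multiple
  -- of `τ`.
  set r : ℝ := K * τ - s with hr
  have hr0 : 0 < r := by
    rw [hr, sub_pos]; exact_mod_cast hK
  have hd : (0 : ℝ) < d := by exact_mod_cast Nat.pos_of_ne_zero (NeZero.ne d)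
  have h1 : ∀ᵐ ω ∂P, ∀ z ∈ B, ∀ ε > 0, ∀ᶠ k : ℕ in atTop,
      ∫ q in (0 : ℝ)..r, |shift (s + k * τ) z (path ξ ω) q.toNNReal 0| ≤ ε * k :=
    (B.eventually_all).2 fun z _ => h.isField.ae_eventually_integral_abs_le τ s z hr0.le
  have hfin := h.ae_pamSol_lt_top hκ.le hγ 0 0
  simp only [shift_zero] at hfin
  filter_upwards [h1, hfin, h.isField.ae_locInt] with ω h1 h2 hv ε hε
  set v := path ξ ω
  set c₀ := walkLaw d (pathEvent (2 * d * κ * r) n p) with hc₀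
  have hc₀pos : 0 < c₀ := walkLaw_pathEvent_pos (by positivity) n p
  set C : ℝ := Real.log c₀.toReal + Real.log (pamSol v κ γ y s).toReal with hC
  set δ : ℝ := ε / (2 * (γ + 1) * (B.card + 1)) with hδ
  have hδ0 : 0 < δ := by positivity
  have h3 : ∀ᶠ k : ℕ in atTop, ∀ z ∈ B,
      ∫ q in (0 : ℝ)..r, |shift (s + k * τ) z v q.toNNReal 0| ≤ δ * k :=
    (B.eventually_all).2 fun z hz => h1 z hz δ hδ0
  have h4 : ∀ᶠ k : ℕ in atTop, -C ≤ ε / 2 * k :=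
    (tendsto_natCast_atTop_atTop.const_mul_atTop (by positivity)).eventually_ge_atTop _
  filter_upwards [h3, h4] with k h3 h4
  have hkτ : (0 : ℝ) ≤ k * τ := by positivity
  -- The walk goes from `0` to `y` while the environment is read on `[s + kτ, (k + K)τ]`, makes a
  -- loop at `y` on `[s, s + kτ]`, and reaches `0` on `[0, s]`. The last factor does not depend on
  -- `k`, and the first costs `o(k)`.
  have e1 := hv.mul_le_pamSol hκ.le γ 0 y (s := s + k * τ) (by positivity) hr0.le
  have e2 := hv.mul_le_pamSol hκ.le γ y y s.coe_nonneg hkτ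
  have hs1 : ((s : ℝ) + k * τ).toNNReal = s + k * τ := by
    rw [← NNReal.coe_natCast, ← NNReal.coe_mul, ← NNReal.coe_add, Real.toNNReal_coe]
  have ht1 : r + (s + k * τ) = ((k + K : ℕ) : ℝ) * τ := by rw [hr]; push_cast; ring
  rw [sub_self, Real.toNNReal_coe, add_comm ((k : ℝ) * τ)] at e2
  rw [hs1, ht1, zero_sub] at e1
  have e3 := (hv.shift (s + k * τ) y).pathEvent_le_pamSol hκ.le hγ (-y) hr0.le (k := n) (p := p)
    (B := B) (fun j hj => Finset.mem_image_of_mem _ (by simpa [Nat.lt_succ_iff] using hj))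
    (by simp [hp])
  set S : ℝ := ∑ z ∈ B, ∫ q in (0 : ℝ)..r, |shift (s + k * τ) y v q.toNNReal (-y + z)| with hS
  have hSle : γ * S ≤ ε / 2 * k := by
    have : S ≤ ∑ z ∈ B, δ * k := by
      refine Finset.sum_le_sum fun z hz => le_trans (le_of_eq ?_) (h3 z hz)
      simp [shift]
    rw [Finset.sum_const, nsmul_eq_mul] at this
    have h5 : γ * (B.card * (δ * k)) ≤ ε / 2 * k := by
      have : (γ + 1) * (B.card + 1) * δ = ε / 2 := by rw [hδ]; field_simp
      rw [← this]
      have : γ * B.card ≤ (γ + 1) * (B.card + 1) := by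
        have : (0 : ℝ) ≤ B.card := by positivity
        nlinarith
      have h6 : 0 ≤ δ * k := by positivity
      nlinarith
    exact (mul_le_mul_of_nonneg_left this hγ).trans h5
  have hfinK := h2 (((k + K : ℕ) : ℝ) * τ) (by positivity)
  have hpos3 : 0 < c₀ * ENNReal.ofReal (Real.exp (-(γ * S))) :=
    ENNReal.mul_pos hc₀pos.ne' (by simp [Real.exp_pos])
  have e4 : (c₀ * ENNReal.ofReal (Real.exp (-(γ * S))))
      * (pamSol (shift s y v) κ γ 0 (k * τ) * pamSol v κ γ y s)
      ≤ pamSol v κ γ 0 (((k + K : ℕ) : ℝ) * τ) := (mul_le_mul' e3 e2).trans e1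
  have hpos1 : 0 < pamSol (shift s y v) κ γ 0 (k * τ) := pamSol_zero_pos hκ.le hkτ
  have hpos2 : 0 < pamSol v κ γ y s := hv.pamSol_pos hκ hγ y (by exact_mod_cast hs)
  have hpos12 := ENNReal.mul_pos hpos1.ne' hpos2.ne'
  have e5 := log_add_log_le hpos3 hpos12 e4 hfinK
  have hprod : pamSol (shift s y v) κ γ 0 (k * τ) * pamSol v κ γ y s < ⊤ := by
    by_contra hc
    rw [not_lt_top_iff.1 hc, ENNReal.mul_top hpos3.ne', top_le_iff] at e4
    exact hfinK.ne e4
  have e6 := log_add_log_le hpos1 hpos2 le_rfl hprod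
  have e7 : Real.log (c₀ * ENNReal.ofReal (Real.exp (-(γ * S)))).toReal
      = Real.log c₀.toReal - γ * S := by
    rw [ENNReal.toReal_mul, ENNReal.toReal_ofReal (Real.exp_nonneg _), Real.log_mul, Real.log_exp]
    · ring
    · exact (ENNReal.toReal_pos hc₀pos.ne' (measure_ne_top _ _)).ne'
    · exact (Real.exp_pos _).ne'
  rw [e7] at e5
  simp only [logSol]
  linarith

/-- Zero-one law for events that are almost invariant under forward translations. -/
lemma IsEnvironment.zero_one (h : IsEnvironment P ξ) {A : Set (ℝ≥0 → Config d)}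
    (hA : MeasurableSet A)
    (hinv : ∀ s : ℝ≥0, 0 < s → ∀ y, ∀ᵐ ω ∂P, shift s y (path ξ ω) ∈ A → path ξ ω ∈ A) :
    (∀ᵐ ω ∂P, path ξ ω ∉ A) ∨ ∀ᵐ ω ∂P, path ξ ω ∈ A := by
  have hp := measurable_path h.measurable
  have hst : ∀ (s : ℝ≥0) (y : Site d) (B : Set (ℝ≥0 → Config d)), MeasurableSet B →
      P ((fun ω => shift s y (path ξ ω)) ⁻¹' B) = P (path ξ ⁻¹' B) := by
    intro s y B hB
    rw [← Measure.map_apply (measurable_shift_path h.measurable s y) hB, h.stationary s y,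
      Measure.map_apply hp hB]
  have hpos : ∀ s : ℝ≥0, 0 < s → ∀ y, ∀ᵐ ω ∂P, (shift s y (path ξ ω) ∈ A ↔ path ξ ω ∈ A) := by
    intro s hs y
    -- One inclusion up to null sets, together with equal probabilities, gives equality up to null
    -- sets.
    have h1 : ((fun ω => shift s y (path ξ ω)) ⁻¹' A) =ᵐ[P] (path ξ ⁻¹' A) :=
      ae_eq_of_ae_subset_of_measure_ge (hinv s hs y) (hst s y A hA).ge
        ((measurable_shift_path h.measurable s y) hA).nullMeasurableSet (measure_ne_top _ _)
    filter_upwards [h1] with ω hω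
    exact Iff.of_eq hω
  -- To include `s = 0`, a further unit time shift is applied to the translate: by stationarity it
  -- does not affect membership there, and the total shift by `(s + 1, y)` has positive time.
  have hall : ∀ (s : ℝ≥0) (y : Site d), ∀ᵐ ω ∂P, (shift s y (path ξ ω) ∈ A ↔ path ξ ω ∈ A) := by
    intro s y
    have hB : MeasurableSet {v : ℝ≥0 → Config d | shift 1 0 v ∈ A ↔ v ∈ A} :=
      measurableSet_setOfPred.2 ((Measurable.iff (measurableSet_setOfPred.1
        (measurable_shift 1 0 hA)) (measurableSet_setOfPred.1 hA)))
    have h1 : ∀ᵐ v ∂(P.map fun ω => shift s y (path ξ ω)), (shift 1 0 v ∈ A ↔ v ∈ A) := by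
      rw [h.stationary s y, ae_map_iff hp.aemeasurable hB]
      exact hpos 1 one_pos 0
    rw [ae_map_iff (measurable_shift_path h.measurable s y).aemeasurable hB] at h1
    filter_upwards [h1, hpos (s + 1) (by positivity) y] with ω h2 h3
    rw [shift_shift, add_zero] at h2
    rw [← h2, h3]
  rcases h.ergodic A hA hall with h0 | h1
  · left
    rw [ae_iff]
    simp only [not_not]
    exact h0
  · right
    exact (prob_compl_eq_zero_iff (hp hA)).2 h1

end Lyapunov

/-! ### Elementary limit lemmas. -/

section Deterministic

/-- Lowering the slope from `b` to `b'` absorbs both the time lag `K` and the linear error in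
`IsEnvironment.ae_eventually_logSol_shift_le`. -/
lemma eventually_mul_add_lt {b b' : ℝ} (h : b' < b) (K : ℕ) :
    ∀ᶠ n : ℕ in atTop, ∀ f : ℝ, b * n ≤ f + (b - b') / 2 * n → b' * ((n + K : ℕ) : ℝ) < f := by
  have h1 : ∀ᶠ n : ℕ in atTop, b' * K < (b - b') / 2 * n :=
    (tendsto_natCast_atTop_atTop.const_mul_atTop (by linarith)).eventually_gt_atTop _
  filter_upwards [h1] with n hn f hf
  push_cast
  linarith

lemma ae_tendsto_of_forall_lt {Ω ι : Type*} [MeasurableSpace Ω] {P : Measure Ω} {F : Filter ι}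
    {f : Ω → ι → ℝ} {l : ℝ} (h1 : ∀ a < l, ∀ᵐ ω ∂P, ∀ᶠ t in F, a < f ω t)
    (h2 : ∀ a > l, ∀ᵐ ω ∂P, ∀ᶠ t in F, f ω t < a) : ∀ᵐ ω ∂P, Tendsto (f ω) F (𝓝 l) := by
  have h3 : ∀ᵐ ω ∂P, ∀ j : ℕ, (∀ᶠ t in F, l - 1 / ((j : ℝ) + 1) < f ω t) ∧
      ∀ᶠ t in F, f ω t < l + 1 / ((j : ℝ) + 1) := by
    refine ae_all_iff.2 fun j => ?_
    have hj : 0 < 1 / ((j : ℝ) + 1) := by positivity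
    exact (h1 _ (by linarith)).and (h2 _ (by linarith))
  filter_upwards [h3] with ω hω
  refine tendsto_order.2 ⟨fun a ha => ?_, fun a ha => ?_⟩
  · obtain ⟨j, hj⟩ := exists_nat_one_div_lt (sub_pos.2 ha)
    filter_upwards [(hω j).1] with t ht
    linarith
  · obtain ⟨j, hj⟩ := exists_nat_one_div_lt (sub_pos.2 ha)
    filter_upwards [(hω j).2] with t ht
    linarith

end Deterministic

/-! ### Growth along multiples of a fixed time. -/

section Discrete

variable {d : ℕ} [NeZero d] {Ω : Type*} [MeasurableSpace Ω]
  {P : Measure Ω} [IsProbabilityMeasure P] {ξ : ℝ≥0 → Ω → Config d}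

lemma shift_iterate (τ : ℝ≥0) (m : ℕ) (v : ℝ≥0 → Config d) :
    (shift τ 0)^[m] v = shift (m * τ) 0 v := by
  induction m generalizing v with
  | zero => simp [shift_zero]
  | succ m ih =>
    rw [Function.iterate_succ_apply, ih, shift_shift, add_zero]
    congr 1
    push_cast
    ring

lemma IsField.measurePreserving_shift (h : IsField P ξ) (s : ℝ≥0) (y : Site d) :
    MeasurePreserving (shift s y) (P.map (path ξ)) (P.map (path ξ)) := by
  refine ⟨measurable_shift s y, ?_⟩
  rw [Measure.map_map (measurable_shift s y) (measurable_path h.measurable)]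
  exact h.stationary s y

/-- A measurable version of the logarithm of the solution at multiples of a fixed time. -/
lemma IsEnvironment.exists_superadditive (h : IsEnvironment P ξ) {κ γ : ℝ} (hκ : 0 ≤ κ)
    (hγ : 0 ≤ γ) (τ : ℝ≥0) : ∃ G : ℕ → (ℝ≥0 → Config d) → ℝ,
      (∀ n, Measurable (G n)) ∧
      (∀ s y, ∀ᵐ ω ∂P, ∀ n : ℕ,
        logSol (shift s y (path ξ ω)) κ γ (n * τ) = G n (shift s y (path ξ ω))) ∧
      (∀ n, Integrable (G n) (P.map (path ξ))) ∧
      (∀ n, ∫ v, G n v ∂(P.map (path ξ)) = ∫ ω, logSol (path ξ ω) κ γ (n * τ) ∂P) ∧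
      (∀ᵐ v ∂(P.map (path ξ)), 0 ≤ G 0 v) ∧
      (∀ m n, ∀ᵐ v ∂(P.map (path ξ)), G m v + G n ((shift τ 0)^[m] v) ≤ G (m + n) v) := by
  have ht : ∀ n : ℕ, (0 : ℝ) ≤ n * τ := fun n => by positivity
  choose G hGm hG using fun n : ℕ => h.isField.isPathFunctional_logSol hκ γ (ht n)
  have hp := measurable_path h.measurable
  have hG0 : ∀ n : ℕ, ∀ᵐ ω ∂P, logSol (path ξ ω) κ γ (n * τ) = G n (path ξ ω) := by
    intro n
    have := hG n 0 0
    simp only [shift_zero] at this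
    exact this
  have hfin := h.ae_pamSol_lt_top hκ hγ 0 0
  simp only [shift_zero] at hfin
  refine ⟨G, hGm, fun s y => ae_all_iff.2 fun n => hG n s y, fun n => ?_, fun n => ?_, ?_,
    fun m n => ?_⟩
  · rw [integrable_map_measure (hGm n).aestronglyMeasurable hp.aemeasurable]
    exact (h.integrable_logSol hκ hγ (ht n)).congr (hG0 n)
  · rw [integral_map hp.aemeasurable (hGm n).aestronglyMeasurable]
    exact (integral_congr_ae (hG0 n)).symm
  · rw [ae_map_iff hp.aemeasurable (measurableSet_le measurable_const (hGm 0))]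
    filter_upwards [hG0 0, hfin] with ω h1 h2
    rw [← h1]
    have := logSol_ge hκ (ht 0) (h2 _ (ht 0))
    simpa using this
  · have hset : MeasurableSet {v | G m v + G n ((shift τ 0)^[m] v) ≤ G (m + n) v} :=
      measurableSet_le ((hGm m).add ((hGm n).comp ((measurable_shift τ 0).iterate m))) (hGm (m + n))
    rw [ae_map_iff hp.aemeasurable hset]
    filter_upwards [hG0 m, hG0 (m + n), hG n (m * τ) 0, hfin, h.isField.ae_locInt]
      with ω h1 h2 h3 h4 h5
    rw [shift_iterate, ← h1, ← h2, ← h3]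
    have h6 : ((m + n : ℕ) : ℝ) * τ = m * τ + n * τ := by push_cast; ring
    have := h5.logSol_add_le hκ (ht m) (ht n) (h4 _ (add_nonneg (ht m) (ht n)))
    rw [h6]
    convert this using 4
    rw [← NNReal.coe_natCast, ← NNReal.coe_mul, Real.toNNReal_coe]

/-- The set `A` says that `G n / n` exceeds `c` by a fixed margin infinitely often. Comparison of
translates makes it almost invariant, hence null or full. If it were full, `superadditive_rate_le`
would give `c ≤ lyapunov P ξ γ κ * τ`, against the choice of `c`. -/
lemma IsEnvironment.ae_eventually_logSol_lt (h : IsEnvironment P ξ) {κ γ : ℝ} (hκ : 0 < κ)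
    (hγ : 0 ≤ γ) {a : ℝ} (ha : lyapunov P ξ γ κ < a) {τ : ℝ≥0} (hτ : 0 < τ) :
    ∀ᵐ ω ∂P, ∀ᶠ n : ℕ in atTop, logSol (path ξ ω) κ γ (n * τ) < a * (n * τ) := by
  obtain ⟨G, hGm, hG, hint, hintG, h0, hsup⟩ := h.exists_superadditive hκ.le hγ τ
  have hp := measurable_path h.measurable
  have : IsProbabilityMeasure (P.map (path ξ)) := Measure.isProbabilityMeasure_map hp.aemeasurable
  have hτ' : (0 : ℝ) < τ := by exact_mod_cast hτ
  obtain ⟨a', ha', ha'a⟩ := exists_between ha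
  set c : ℝ := a' * τ with hc
  set A : Set (ℝ≥0 → Config d) :=
    {v | ∃ j : ℕ, ∃ᶠ n : ℕ in atTop, (c + 1 / ((j : ℝ) + 1)) * n ≤ G n v} with hA
  have hAm : MeasurableSet A := by
    have : A = ⋃ j : ℕ, ⋂ N : ℕ, ⋃ n : ℕ, {v | N ≤ n ∧ (c + 1 / ((j : ℝ) + 1)) * n ≤ G n v} := by
      ext v
      simp [hA, frequently_atTop]
    rw [this]
    exact .iUnion fun j => .iInter fun N => .iUnion fun n =>
      (MeasurableSet.const _).inter (measurableSet_le measurable_const (hGm n))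
  have hG0 := hG 0 0
  simp only [shift_zero] at hG0
  have hinv : ∀ s : ℝ≥0, 0 < s → ∀ y, ∀ᵐ ω ∂P, shift s y (path ξ ω) ∈ A → path ξ ω ∈ A := by
    intro s hs y
    obtain ⟨K, hK⟩ : ∃ K : ℕ, s < K * τ := by
      obtain ⟨K, hK⟩ := exists_nat_gt (s / τ)
      exact ⟨K, (div_lt_iff₀ hτ).1 hK⟩
    filter_upwards [h.ae_eventually_logSol_shift_le hκ hγ hs y hK, hG0, hG s y] with ω h1 h2 h3
    rintro ⟨j, hj⟩
    -- This halves the margin; the other half pays for the comparison of translates.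
    refine ⟨2 * j + 1, ?_⟩
    have hlt : c + 1 / (((2 * j + 1 : ℕ) : ℝ) + 1) < c + 1 / ((j : ℝ) + 1) := by
      gcongr
      have : (0 : ℝ) ≤ j := Nat.cast_nonneg j
      linarith
    refine (tendsto_add_atTop_nat K).frequently ?_
    refine (hj.and_eventually ((h1 _ (half_pos (sub_pos.2 hlt))).and
      (eventually_mul_add_lt hlt K))).mono ?_
    rintro n ⟨h4, h5, h6⟩
    rw [h2, h3] at h5
    exact (h6 _ (h4.trans h5)).le
  rcases h.zero_one hAm hinv with h1 | h1
  · filter_upwards [h1, hG0] with ω h2 h3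
    simp only [hA, mem_ofPred_eq, not_exists, not_frequently, not_le] at h2
    obtain ⟨j, hj⟩ := exists_nat_one_div_lt (show 0 < (a - a') * τ by
      exact mul_pos (sub_pos.2 ha'a) hτ')
    filter_upwards [h2 j] with n hn
    rw [h3]
    refine hn.trans_le ?_
    have : (c + 1 / ((j : ℝ) + 1)) ≤ a * τ := by rw [hc]; linarith
    calc _ ≤ a * τ * n := by gcongr
      _ = _ := by ring
  · exfalso
    have := superadditive_rate_le (h.isField.measurePreserving_shift τ 0) hGm hint h0 hsup
      (a := c) (l := lyapunov P ξ γ κ * τ) (fun n hn => by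
        rw [hintG]
        have hn' : (0 : ℝ) < n := by exact_mod_cast hn
        exact (h.integral_logSol_le hκ.le hγ (mul_pos hn' hτ')).trans_eq (by ring)) (by
        have hset : MeasurableSet {v | ∃ n : ℕ, 1 ≤ n ∧ c * n ≤ G n v} := by
          simp only [ofPred_exists]
          exact .iUnion fun n =>
            (MeasurableSet.const _).inter (measurableSet_le measurable_const (hGm n))
        rw [ae_map_iff hp.aemeasurable hset]
        filter_upwards [h1] with ω ⟨j, hj⟩
        obtain ⟨n, hn, hn1⟩ := (hj.and_eventually (eventually_ge_atTop 1)).exists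
        refine ⟨n, hn1, le_trans ?_ hn⟩
        gcongr
        have : 0 ≤ 1 / ((j : ℝ) + 1) := by positivity
        linarith)
    exact absurd (le_of_mul_le_mul_right this hτ') (not_le.2 ha')

/-- Mirror image of the upper bound: `A` says that the growth rate of `G` is at least `c`. If it
were null, almost every path would have `G n ≤ c n` for some `n ≥ 1`, and
`superadditive_integral_le` would bound the mean at time `τ` by `c`. -/
lemma IsEnvironment.ae_eventually_lt_logSol (h : IsEnvironment P ξ) {κ γ : ℝ} (hκ : 0 < κ)
    (hγ : 0 ≤ γ) {a : ℝ} {τ : ℝ≥0} (hτ : 0 < τ)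
    (ha : a * τ < ∫ ω, logSol (path ξ ω) κ γ τ ∂P) :
    ∀ᵐ ω ∂P, ∀ᶠ n : ℕ in atTop, a * (n * τ) < logSol (path ξ ω) κ γ (n * τ) := by
  obtain ⟨G, hGm, hG, hint, hintG, h0, hsup⟩ := h.exists_superadditive hκ.le hγ τ
  have hp := measurable_path h.measurable
  have : IsProbabilityMeasure (P.map (path ξ)) := Measure.isProbabilityMeasure_map hp.aemeasurable
  have hτ' : (0 : ℝ) < τ := by exact_mod_cast hτ
  obtain ⟨c, hc1, hc2⟩ := exists_between ha
  set A : Set (ℝ≥0 → Config d) :=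
    {v | ∀ j : ℕ, ∀ᶠ n : ℕ in atTop, (c - 1 / ((j : ℝ) + 1)) * n < G n v} with hA
  have hAm : MeasurableSet A := by
    have : A = ⋂ j : ℕ, ⋃ N : ℕ, ⋂ n : ℕ, ⋂ _ : N ≤ n, {v | (c - 1 / ((j : ℝ) + 1)) * n < G n v} := by
      ext v
      simp [hA, eventually_atTop]
    rw [this]
    exact .iInter fun j => .iUnion fun N => .iInter fun n => .iInter fun _ =>
      measurableSet_lt measurable_const (hGm n)
  have hG0 := hG 0 0
  simp only [shift_zero] at hG0
  have hinv : ∀ s : ℝ≥0, 0 < s → ∀ y, ∀ᵐ ω ∂P, shift s y (path ξ ω) ∈ A → path ξ ω ∈ A := by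
    intro s hs y
    obtain ⟨K, hK⟩ : ∃ K : ℕ, s < K * τ := by
      obtain ⟨K, hK⟩ := exists_nat_gt (s / τ)
      exact ⟨K, (div_lt_iff₀ hτ).1 hK⟩
    filter_upwards [h.ae_eventually_logSol_shift_le hκ hγ hs y hK, hG0, hG s y] with ω h1 h2 h3
    intro h7 j
    have hlt : c - 1 / ((j : ℝ) + 1) < c - 1 / (((2 * j + 1 : ℕ) : ℝ) + 1) := by
      gcongr
      have : (0 : ℝ) ≤ j := Nat.cast_nonneg j
      linarith
    rw [← map_add_atTop_eq_nat K, eventually_map]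
    filter_upwards [h7 (2 * j + 1), h1 _ (half_pos (sub_pos.2 hlt)), eventually_mul_add_lt hlt K]
      with n h4 h5 h6
    rw [h2, h3] at h5
    exact h6 _ (h4.le.trans h5)
  rcases h.zero_one hAm hinv with h1 | h1
  · exfalso
    have := superadditive_integral_le (h.isField.measurePreserving_shift τ 0) hGm hint h0 hsup
      (a := c) (by
        have hset : MeasurableSet {v | ∃ n : ℕ, 1 ≤ n ∧ G n v ≤ c * n} := by
          simp only [ofPred_exists]
          exact .iUnion fun n =>
            (MeasurableSet.const _).inter (measurableSet_le (hGm n) measurable_const)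
        rw [ae_map_iff hp.aemeasurable hset]
        filter_upwards [h1] with ω h2
        simp only [hA, mem_ofPred_eq, not_forall, not_eventually, not_lt] at h2
        obtain ⟨j, hj⟩ := h2
        obtain ⟨n, hn, hn1⟩ := (hj.and_eventually (eventually_ge_atTop 1)).exists
        refine ⟨n, hn1, hn.trans ?_⟩
        gcongr
        have : 0 ≤ 1 / ((j : ℝ) + 1) := by positivity
        linarith)
    rw [hintG] at this
    simp only [Nat.cast_one, one_mul] at this
    linarith
  · filter_upwards [h1, hG0] with ω h2 h3
    obtain ⟨j, hj⟩ := exists_nat_one_div_lt (sub_pos.2 hc1)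
    filter_upwards [h2 j] with n hn
    rw [h3]
    refine lt_of_le_of_lt ?_ hn
    calc a * (n * τ) = a * τ * n := by ring
      _ ≤ _ := by gcongr; linarith

end Discrete

/-! ### All times, and existence of the exponent. -/

section Continuous

variable {d : ℕ} [NeZero d] {Ω : Type*} [MeasurableSpace Ω]
  {P : Measure Ω} [IsProbabilityMeasure P] {ξ : ℝ≥0 → Ω → Config d}

lemma neg_integral_abs_le (v : ℝ≥0 → Config d) (x : Site d) {t : ℝ} (ht : 0 ≤ t) :
    -∫ q in (0 : ℝ)..t, |v q.toNNReal x| ≤ ∫ q in (0 : ℝ)..t, v q.toNNReal x :=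
  (abs_le.1 (intervalIntegral.abs_integral_le_integral_abs ht)).1

/-- Comparison of the solution at two nearby times. -/
lemma LocInt.logSol_le_logSol_add {v : ℝ≥0 → Config d} (hv : LocInt v) {κ γ : ℝ} (hκ : 0 ≤ κ)
    (hγ : 0 ≤ γ) {r s t u : ℝ} (hr : 0 ≤ r) (hrs : r ≤ s) (hst : s ≤ t) (htu : t ≤ u)
    (hfin : pamSol v κ γ 0 t < ⊤) (hfin' : pamSol (PAM.shift s.toNNReal 0 v) κ γ 0 (t - s) < ⊤) :
    logSol v κ γ s ≤ logSol v κ γ t + (2 * d * κ * (u - r)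
      + γ * ∫ q in (0 : ℝ)..(u - r), |PAM.shift r.toNNReal 0 v q.toNNReal 0|) := by
  have h1 := hv.logSol_add_le (γ := γ) hκ (hr.trans hrs) (sub_nonneg.2 hst)
    (by rwa [add_sub_cancel])
  rw [add_sub_cancel] at h1
  have h2 := logSol_ge hκ (sub_nonneg.2 hst) hfin'
  have h3 := neg_integral_abs_le (PAM.shift s.toNNReal 0 v) 0 (sub_nonneg.2 hst)
  -- Enlarging to the window `[r, u]` makes the error uniform over all `s` and `t` in one time
  -- block.
  have h4 : ∫ q in (0 : ℝ)..(t - s), |PAM.shift s.toNNReal 0 v q.toNNReal 0|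
      ≤ ∫ q in (0 : ℝ)..(u - r), |PAM.shift r.toNNReal 0 v q.toNNReal 0| := by
    have e : ∫ q in (0 : ℝ)..(t - s), |PAM.shift s.toNNReal 0 v q.toNNReal 0|
        = ∫ q in (0 : ℝ)..(t - s), |PAM.shift r.toNNReal 0 v (q + (s - r)).toNNReal 0| := by
      refine intervalIntegral.integral_congr fun q hq => ?_
      rw [uIcc_of_le (sub_nonneg.2 hst)] at hq
      simp only [PAM.shift]
      rw [← Real.toNNReal_add (hr.trans hrs) hq.1,
        ← Real.toNNReal_add hr (add_nonneg hq.1 (sub_nonneg.2 hrs))]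
      congr 3
      ring
    rw [e, intervalIntegral.integral_comp_add_right
      (fun q => |PAM.shift r.toNNReal 0 v q.toNNReal 0|)]
    refine intervalIntegral.integral_mono_interval (by linarith) (by linarith) (by linarith)
      (.of_forall fun _ => abs_nonneg _) ?_
    exact ((hv.shift r.toNNReal 0).int 0 _ (by linarith)).abs
  have h5 : 2 * d * κ * (t - s) ≤ 2 * d * κ * (u - r) := by gcongr
  have h6 := mul_le_mul_of_nonneg_left h4 hγ
  have h7 := mul_le_mul_of_nonneg_left h3 hγ
  linarith

lemma IsEnvironment.ae_forall_pamSol_shift_lt_top (h : IsEnvironment P ξ) {κ γ : ℝ} (hκ : 0 ≤ κ)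
    (hγ : 0 ≤ γ) : ∀ᵐ ω ∂P, ∀ s t : ℝ, 0 ≤ s → 0 ≤ t →
      pamSol (path ξ ω) κ γ 0 t < ⊤ ∧ pamSol (shift s.toNNReal 0 (path ξ ω)) κ γ 0 t < ⊤ := by
  have hfin := h.ae_pamSol_lt_top hκ hγ 0 0
  simp only [shift_zero] at hfin
  filter_upwards [hfin, h.isField.ae_locInt] with ω h1 h2 s t hs ht
  refine ⟨h1 t ht, ?_⟩
  have h3 := h2.mul_le_pamSol hκ γ 0 0 hs ht
  rw [sub_zero] at h3
  by_contra hc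
  rw [not_lt_top_iff.1 hc, ENNReal.top_mul (pamSol_zero_pos hκ hs).ne', top_le_iff] at h3
  exact (h1 _ (add_nonneg ht hs)).ne h3

lemma tendsto_natFloor_div {τ : ℝ} (hτ : 0 < τ) :
    Tendsto (fun t : ℝ => ⌊t / τ⌋₊) atTop atTop :=
  tendsto_nat_floor_atTop.comp (tendsto_id.atTop_div_const hτ)

/-- Waiting at the origin from the last grid point until `t`, or from `t` until the next one, loses
at most `2dκτ` plus `γ` times the integral of `|ξ|` over one block, which is `o(t)`. -/
lemma IsEnvironment.ae_eventually_logSol_close (h : IsEnvironment P ξ) {κ γ : ℝ} (hκ : 0 ≤ κ)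
    (hγ : 0 ≤ γ) {τ : ℝ≥0} (hτ : 0 < τ) : ∀ᵐ ω ∂P, ∀ ε > 0, ∀ᶠ t : ℝ in atTop,
      logSol (path ξ ω) κ γ (⌊t / τ⌋₊ * τ) ≤ logSol (path ξ ω) κ γ t + ε * t ∧
      logSol (path ξ ω) κ γ t
        ≤ logSol (path ξ ω) κ γ ((⌊t / τ⌋₊ + 1 : ℕ) * τ) + ε * t := by
  have hτ' : (0 : ℝ) < τ := by exact_mod_cast hτ
  filter_upwards [h.ae_forall_pamSol_shift_lt_top hκ hγ, h.isField.ae_locInt,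
    h.isField.ae_eventually_integral_abs_le τ 0 0 hτ'.le] with ω hfin hv hY ε hε
  have h3 : ∀ᶠ t : ℝ in atTop, 2 * d * κ * τ < ε / 2 * t :=
    (tendsto_id.const_mul_atTop (by linarith)).eventually_gt_atTop _
  filter_upwards [(tendsto_natFloor_div hτ').eventually (hY (ε * τ / (2 * (γ + 1)))
    (by positivity)), h3, eventually_ge_atTop 0] with t h4 h5 ht
  have h7 := Nat.floor_le (div_nonneg ht hτ'.le)
  have h8 := (Nat.lt_floor_add_one (t / τ)).le
  rw [le_div_iff₀ hτ'] at h7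
  rw [div_le_iff₀ hτ'] at h8
  set k := ⌊t / τ⌋₊
  have hk : (0 : ℝ) ≤ k * τ := by positivity
  have hkn : ((k : ℝ) * τ).toNNReal = 0 + k * τ := by
    rw [← NNReal.coe_natCast, ← NNReal.coe_mul, Real.toNNReal_coe, zero_add]
  have hu : ((k : ℝ) + 1) * τ - k * τ = τ := by ring
  have h9 := hv.logSol_le_logSol_add hκ hγ hk le_rfl h7 h8 (hfin 0 t le_rfl ht).1
    (hfin _ _ hk (sub_nonneg.2 h7)).2
  have h10 := hv.logSol_le_logSol_add hκ hγ hk h7 h8 le_rfl (hfin 0 _ le_rfl (ht.trans h8)).1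
    (hfin _ _ ht (sub_nonneg.2 h8)).2
  rw [hu, hkn] at h9 h10
  have h11 : γ * ∫ q in (0 : ℝ)..τ, |shift (0 + k * τ) 0 (path ξ ω) q.toNNReal 0| ≤ ε / 2 * t := by
    calc _ ≤ γ * (ε * τ / (2 * (γ + 1)) * k) := mul_le_mul_of_nonneg_left h4 hγ
      _ = γ / (γ + 1) * (ε / 2 * (k * τ)) := by field_simp
      _ ≤ 1 * (ε / 2 * t) := by
        gcongr
        rw [div_le_one (by positivity)]
        linarith
      _ = _ := one_mul _
  push_cast
  constructor <;> linarith

/-- Existence of the quenched Lyapunov exponent. -/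
theorem IsEnvironment.isQuenchedLyapunov (h : IsEnvironment P ξ) {κ γ : ℝ} (hκ : 0 < κ)
    (hγ : 0 ≤ γ) : IsQuenchedLyapunov P ξ γ κ (lyapunov P ξ γ κ) := by
  have hfin := h.ae_forall_pamSol_shift_lt_top hκ.le hγ
  have hlim : ∀ᵐ ω ∂P, Tendsto (fun t : ℝ => 1 / t * logSol (path ξ ω) κ γ t) atTop
      (𝓝 (lyapunov P ξ γ κ)) := by
    refine ae_tendsto_of_forall_lt (fun a ha => ?_) fun a ha => ?_
    · obtain ⟨b, hab, hb⟩ := exists_between ha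
      -- The lower bound needs a grid whose mean rate exceeds `b`; for the upper bound any grid will
      -- do, and unit steps are used.
      obtain ⟨τ, hτ, hbτ⟩ := exists_lt_integral_logSol hb
      lift τ to ℝ≥0 using hτ.le
      filter_upwards [h.ae_eventually_lt_logSol hκ hγ (by exact_mod_cast hτ) hbτ,
        h.ae_eventually_logSol_close hκ.le hγ (τ := τ) (by exact_mod_cast hτ)] with ω h1 h2
      have h3 : ∀ᶠ t : ℝ in atTop, |b| * τ < (b - a) / 2 * t :=
        (tendsto_id.const_mul_atTop (by linarith)).eventually_gt_atTop _
      filter_upwards [(tendsto_natFloor_div hτ).eventually h1, h2 ((b - a) / 2) (by linarith), h3,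
        eventually_gt_atTop 0] with t h4 h5 h6 ht
      rw [one_div, lt_inv_mul_iff₀ ht]
      have h7 := Nat.floor_le (div_nonneg ht.le hτ.le)
      have h8 := (Nat.lt_floor_add_one (t / τ)).le
      rw [le_div_iff₀ hτ] at h7
      rw [div_le_iff₀ hτ, add_mul, one_mul] at h8
      have h9 : b * t ≤ b * (⌊t / τ⌋₊ * τ) + |b| * τ := by
        rw [← sub_le_iff_le_add', ← mul_sub]
        refine (le_abs_self _).trans ?_
        rw [abs_mul, abs_of_nonneg (by linarith : 0 ≤ t - ⌊t / τ⌋₊ * τ)]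
        gcongr
        linarith
      linarith [h5.1]
    · obtain ⟨b, hb, hba⟩ := exists_between ha
      filter_upwards [h.ae_eventually_logSol_lt hκ hγ hb one_pos,
        h.ae_eventually_logSol_close hκ.le hγ (τ := 1) one_pos] with ω h1 h2
      have h3 : ∀ᶠ t : ℝ in atTop, |b| * 1 < (a - b) / 2 * t :=
        (tendsto_id.const_mul_atTop (by linarith)).eventually_gt_atTop _
      filter_upwards [((tendsto_add_atTop_nat 1).comp (tendsto_natFloor_div one_pos)).eventually h1,
        h2 ((a - b) / 2) (by linarith), h3, eventually_gt_atTop 0] with t h4 h5 h6 ht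
      rw [one_div, inv_mul_lt_iff₀ ht]
      simp only [Function.comp_apply, NNReal.coe_one, mul_one, div_one] at h4 h5 h6
      have h7 := Nat.floor_le ht.le
      have h8 := (Nat.lt_floor_add_one t).le
      have h9 : b * ((⌊t⌋₊ + 1 : ℕ) : ℝ) ≤ b * t + |b| := by
        rw [← sub_le_iff_le_add', ← mul_sub]
        refine (le_abs_self _).trans ?_
        push_cast
        rw [abs_mul, abs_of_nonneg (by linarith : 0 ≤ (⌊t⌋₊ : ℝ) + 1 - t)]
        exact mul_le_of_le_one_right (abs_nonneg _) (by linarith)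
      linarith [h5.2]
  filter_upwards [hfin, hlim] with ω h1 h2
  exact ⟨fun t ht => ⟨pamSol_zero_pos hκ.le ht, (h1 0 t le_rfl ht).1⟩, h2⟩

end Continuous

/-! ### A walk that visits a neighbour of the origin. -/

section Excursion

variable {d : ℕ} [NeZero d]

lemma unitStep_ne_zero (p : Fin d × Bool) : unitStep p ≠ 0 := by
  intro h
  have := congrFun h p.1
  rcases p with ⟨i, b⟩
  cases b <;> simp [unitStep] at this

lemma unitStep_not (p : Fin d × Bool) : unitStep (p.1, !p.2) = -unitStep p := by
  rcases p with ⟨i, b⟩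
  cases b <;> simp [unitStep, ← Pi.single_neg]

lemma IsNeighborOfZero.exists_unitStep {e : Site d} (h : IsNeighborOfZero e) :
    ∃ p, unitStep p = e := by
  classical
  have h' : ∑ i, |e i| = 1 := h
  obtain ⟨i, hi⟩ : ∃ i, e i ≠ 0 := by
    by_contra! hc
    simp [hc] at h'
  have h1 := Finset.add_sum_erase Finset.univ (fun i => |e i|) (Finset.mem_univ i)
  rw [h'] at h1
  have h2 : 1 ≤ |e i| := Int.one_le_abs hi
  have h3 : ∀ j ∈ Finset.univ.erase i, 0 ≤ |e j| := fun _ _ => abs_nonneg _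
  have h4 := Finset.sum_nonneg h3
  have h5 : ∀ j, j ≠ i → e j = 0 := fun j hj =>
    abs_eq_zero.1 ((Finset.sum_eq_zero_iff_of_nonneg h3).1 (by linarith) j (by simp [hj]))
  have h6 : |e i| = 1 := by linarith
  rcases abs_eq (zero_le_one) |>.1 h6 with h7 | h7
  · refine ⟨(i, true), funext fun j => ?_⟩
    by_cases hj : j = i
    · subst hj; simp [unitStep, h7]
    · simp [unitStep, hj, h5 j hj]
  · refine ⟨(i, false), funext fun j => ?_⟩
    by_cases hj : j = i
    · subst hj; simp [unitStep, h7]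
    · simp [unitStep, hj, h5 j hj]

/-- The probability is `(1 - e^{-2dκ}) e^{-2dκ} / (2d)`, and `1 - e^{-x} ≥ x e^{-x}`. -/
lemma le_walkLaw_pathEvent_one {κ : ℝ} (hκ : 0 < κ) (p : ℕ → Fin d × Bool) :
    ENNReal.ofReal (κ * Real.exp (-(4 * d * κ))) ≤ walkLaw d (pathEvent (2 * d * κ * 1) 1 p) := by
  have hd : (0 : ℝ) < d := by exact_mod_cast Nat.pos_of_ne_zero (NeZero.ne d)
  have hd' : (2 * d : ℝ≥0∞)⁻¹ = ENNReal.ofReal ((2 * d)⁻¹) := by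
    rw [ENNReal.ofReal_inv_of_pos (by positivity), ENNReal.ofReal_mul (by norm_num)]
    simp
  have h1 : 2 * d * κ * Real.exp (-(2 * d * κ)) ≤ 1 - Real.exp (-(2 * d * κ)) := by
    have h2 := Real.add_one_le_exp (2 * d * κ)
    have h3 : Real.exp (2 * d * κ) * Real.exp (-(2 * d * κ)) = 1 := by
      rw [← Real.exp_add]; simp
    nlinarith [Real.exp_pos (-(2 * d * κ))]
  have h0 : (0 : ℝ) ≤ 1 - Real.exp (-(2 * d * κ)) := le_trans (by positivity) h1
  rw [walkLaw_pathEvent (by positivity), pow_one, hd', mul_one, Nat.cast_one, div_one,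
    ← ENNReal.ofReal_mul h0, ← ENNReal.ofReal_mul (by positivity)]
  refine ENNReal.ofReal_le_ofReal ?_
  have h4 : -(4 * d * κ) = -(2 * d * κ) + -(2 * d * κ) := by ring
  rw [h4, Real.exp_add, ← mul_assoc]
  refine mul_le_mul_of_nonneg_right ?_ (Real.exp_nonneg _)
  calc κ * Real.exp (-(2 * d * κ)) = 2 * d * κ * Real.exp (-(2 * d * κ)) * (2 * (d : ℝ))⁻¹ := by
        field_simp
    _ ≤ _ := by gcongr

/-- The walk which makes a single step to the origin. -/
lemma LocInt.le_pamSol_one {v : ℝ≥0 → Config d} (hv : LocInt v) {κ γ : ℝ} (hκ : 0 < κ)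
    (hγ : 0 ≤ γ) {x : Site d} {p : Fin d × Bool} (hp : x + unitStep p = 0) :
    ENNReal.ofReal (Real.exp (Real.log κ - 4 * d * κ
      - γ * ((∫ s in (0 : ℝ)..1, |v s.toNNReal x|) + ∫ s in (0 : ℝ)..1, |v s.toNNReal 0|)))
      ≤ pamSol v κ γ x 1 := by
  classical
  have h1 := hv.pathEvent_le_pamSol hκ.le hγ x zero_le_one (k := 1) (p := fun _ => p)
    (B := {0, unitStep p}) (fun j hj => by interval_cases j <;> simp [stepSum])
    (by simpa [stepSum] using hp)
  rw [Finset.sum_pair (unitStep_ne_zero p).symm, hp, add_zero] at h1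
  refine le_trans ?_ h1
  refine le_trans ?_ (mul_le_mul_left (le_walkLaw_pathEvent_one hκ _) _)
  rw [← ENNReal.ofReal_mul (by positivity), sub_eq_add_neg, sub_eq_add_neg, Real.exp_add,
    Real.exp_add, Real.exp_log hκ]

/-- The walk which spends most of its time at a neighbour of the origin. -/
lemma LocInt.logSol_ge_excursion {v : ℝ≥0 → Config d} (hv : LocInt v) {κ γ : ℝ} (hκ : 0 < κ)
    (hγ : 0 ≤ γ) (p : Fin d × Bool) {T : ℝ} (hT : 2 ≤ T) (hfin : pamSol v κ γ 0 T < ⊤) :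
    γ * (∫ s in (0 : ℝ)..T, v s.toNNReal (unitStep p))
      - 2 * γ * ((∫ s in (0 : ℝ)..1, |v s.toNNReal (unitStep p)|)
        + (∫ s in (0 : ℝ)..1, |v s.toNNReal 0|)
        + (∫ s in (0 : ℝ)..1, |PAM.shift (T - 1).toNNReal 0 v s.toNNReal (unitStep p)|)
        + ∫ s in (0 : ℝ)..1, |PAM.shift (T - 1).toNNReal 0 v s.toNNReal 0|)
      - 2 * d * κ * T + 2 * (Real.log κ - 4 * d * κ) ≤ logSol v κ γ T := by
  set e := unitStep p with he
  have h1 := hv.mul_le_pamSol hκ.le γ 0 e (s := T - 1) (t := 1) (by linarith) zero_le_one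
  have h2 := hv.mul_le_pamSol hκ.le γ e e (s := 1) (t := T - 2) zero_le_one (by linarith)
  have h3 := hv.le_pamSol_one hκ hγ (x := e) (p := (p.1, !p.2)) (by rw [unitStep_not, he]; simp)
  have h4 := (hv.shift (T - 1).toNNReal e).le_pamSol_one hκ hγ (x := 0 - e) (p := p) (by simp [he])
  have h5 := LocInt.exp_le_pamSol (v := PAM.shift (1 : ℝ).toNNReal e v) (γ := γ) hκ.le
    (show 0 ≤ T - 2 by linarith)
  rw [sub_self] at h2
  have e1 : 1 + (T - 1) = T := by ring
  have e2 : T - 2 + 1 = T - 1 := by ring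
  rw [e1] at h1
  rw [e2] at h2
  have h6 := (mul_le_mul' h4 ((mul_le_mul' h5 h3).trans h2)).trans h1
  rw [← ENNReal.ofReal_mul (by positivity), ← ENNReal.ofReal_mul (by positivity),
    ← Real.exp_add, ← Real.exp_add, ENNReal.ofReal_le_iff_le_toReal hfin.ne] at h6
  have h7 := Real.log_le_log (Real.exp_pos _) h6
  rw [Real.log_exp] at h7
  refine le_trans ?_ h7
  have e3 : ∀ s : ℝ, PAM.shift (T - 1).toNNReal e v s.toNNReal (0 - e)
      = PAM.shift (T - 1).toNNReal 0 v s.toNNReal 0 := fun s => by simp [PAM.shift]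
  have e4 : ∀ s : ℝ, PAM.shift (T - 1).toNNReal e v s.toNNReal 0
      = PAM.shift (T - 1).toNNReal 0 v s.toNNReal e := fun s => by simp [PAM.shift]
  simp only [e3, e4]
  have i1 : ∀ a b : ℝ, 0 ≤ a → 0 ≤ b → IntervalIntegrable (fun s : ℝ => v s.toNNReal e) volume a b :=
    fun a b ha hb => hv.intervalIntegrable e ha hb
  have e5 : ∫ s in (0 : ℝ)..(T - 2), PAM.shift (1 : ℝ).toNNReal e v s.toNNReal 0
      = ∫ s in (1 : ℝ)..(T - 1), v s.toNNReal e := by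
    have : ∫ s in (0 : ℝ)..(T - 2), PAM.shift (1 : ℝ).toNNReal e v s.toNNReal 0
        = ∫ s in (0 : ℝ)..(T - 2), v (s + 1).toNNReal e := by
      refine intervalIntegral.integral_congr fun s hs => ?_
      rw [uIcc_of_le (by linarith)] at hs
      simp only [PAM.shift, add_zero]
      rw [← Real.toNNReal_add zero_le_one hs.1, add_comm]
    rw [this, intervalIntegral.integral_comp_add_right (fun s => v s.toNNReal e)]
    congr 1; ring
  have e6 : ∫ s in (0 : ℝ)..1, PAM.shift (T - 1).toNNReal 0 v s.toNNReal e
      = ∫ s in (T - 1)..T, v s.toNNReal e := by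
    have : ∫ s in (0 : ℝ)..1, PAM.shift (T - 1).toNNReal 0 v s.toNNReal e
        = ∫ s in (0 : ℝ)..1, v (s + (T - 1)).toNNReal e := by
      refine intervalIntegral.integral_congr fun s hs => ?_
      rw [uIcc_of_le zero_le_one] at hs
      simp only [PAM.shift, zero_add]
      rw [← Real.toNNReal_add (by linarith) hs.1, add_comm]
    rw [this, intervalIntegral.integral_comp_add_right (fun s => v s.toNNReal e)]
    congr 1; ring
  -- Completing the integral at `e` to `[0, T]` costs its two end integrals a second time; hence the
  -- factor 2 in the statement.
  have e7 : ∫ s in (0 : ℝ)..T, v s.toNNReal e = (∫ s in (0 : ℝ)..1, v s.toNNReal e)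
      + (∫ s in (1 : ℝ)..(T - 1), v s.toNNReal e) + ∫ s in (T - 1)..T, v s.toNNReal e := by
    rw [intervalIntegral.integral_add_adjacent_intervals (i1 _ _ le_rfl zero_le_one)
        (i1 _ _ zero_le_one (by linarith)),
      intervalIntegral.integral_add_adjacent_intervals (i1 _ _ le_rfl (by linarith))
        (i1 _ _ (by linarith) (by linarith))]
  rw [e5, e7, ← e6]
  have b1 := (abs_le.1 (intervalIntegral.abs_integral_le_integral_abs
    (f := fun s : ℝ => v s.toNNReal e) (μ := volume) zero_le_one)).2
  have b2 := (abs_le.1 (intervalIntegral.abs_integral_le_integral_abs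
    (f := fun s : ℝ => PAM.shift (T - 1).toNNReal 0 v s.toNNReal e) (μ := volume) zero_le_one)).2
  have b3 : 0 ≤ ∫ s in (0 : ℝ)..1, |v s.toNNReal 0| :=
    intervalIntegral.integral_nonneg zero_le_one fun _ _ => abs_nonneg _
  have b4 : 0 ≤ ∫ s in (0 : ℝ)..1, |PAM.shift (T - 1).toNNReal 0 v s.toNNReal 0| :=
    intervalIntegral.integral_nonneg zero_le_one fun _ _ => abs_nonneg _
  have c1 := mul_le_mul_of_nonneg_left b1 hγ
  have c2 := mul_le_mul_of_nonneg_left b2 hγ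
  have c3 := mul_nonneg hγ b3
  have c4 := mul_nonneg hγ b4
  have c5 : 0 ≤ d * κ := by positivity
  nlinarith

end Excursion

/-! ### The lower bound for small diffusivity. -/

section LowerBound

variable {d : ℕ} [NeZero d] {Ω : Type*} [MeasurableSpace Ω]
  {P : Measure Ω} [IsProbabilityMeasure P] {ξ : ℝ≥0 → Ω → Config d}

lemma IsField.ae_cumulative_eq (h : IsField P ξ) (ρ : ℝ) : ∀ᵐ ω ∂P, ∀ x, ∀ t : ℝ, 0 ≤ t →
    cumulative ξ ρ x t ω = (∫ s in (0 : ℝ)..t, path ξ ω s.toNNReal x) - ρ * t := by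
  filter_upwards [h.ae_locInt] with ω hω x t ht
  refine (intervalIntegral.integral_sub (hω.int x t ht) intervalIntegrable_const).trans ?_
  simp [mul_comm]

/-- Pointwise `f² ≤ θ|f| + f⁴/θ²`, by the first term where `|f| ≤ θ` and by the second elsewhere. A
large second moment and a controlled fourth moment then force a large first moment. -/
lemma lintegral_sq_le {f : Ω → ℝ} (hf : AEMeasurable f P) {θ : ℝ} (hθ : 0 < θ) :
    ∫⁻ ω, ENNReal.ofReal (|f ω| ^ 2) ∂P ≤ ENNReal.ofReal θ * ∫⁻ ω, ENNReal.ofReal |f ω| ∂P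
      + ENNReal.ofReal ((θ ^ 2)⁻¹) * ∫⁻ ω, ENNReal.ofReal (|f ω| ^ 4) ∂P := by
  have hm : AEMeasurable (fun ω => ENNReal.ofReal θ * ENNReal.ofReal |f ω|) P := by fun_prop
  rw [← lintegral_const_mul' _ _ (by simp), ← lintegral_const_mul' _ _ (by simp),
    ← lintegral_add_left' hm]
  refine lintegral_mono fun ω => ?_
  rw [← ENNReal.ofReal_mul hθ.le, ← ENNReal.ofReal_mul (by positivity),
    ← ENNReal.ofReal_add (by positivity) (by positivity)]
  refine ENNReal.ofReal_le_ofReal ?_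
  have h0 := abs_nonneg (f ω)
  rcases le_total |f ω| θ with h | h
  · have : 0 ≤ (θ ^ 2)⁻¹ * |f ω| ^ 4 := by positivity
    nlinarith
  · have h1 : 0 ≤ θ * |f ω| := by positivity
    have h2 : θ ^ 2 ≤ |f ω| ^ 2 := by gcongr
    have h3 : |f ω| ^ 2 ≤ (θ ^ 2)⁻¹ * |f ω| ^ 4 := by
      rw [inv_mul_eq_div, le_div_iff₀ (by positivity)]
      nlinarith [sq_nonneg |f ω|]
    linarith

/-- The difference of the occupation integrals at `0` and `e` is of order `√t`. -/
lemma IsField.exists_integral_abs_ge (h : IsField P ξ) {e : Site d} (hmom : MomentCondition P ξ e) :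
    ∃ c > 0, ∀ᶠ t : ℝ in atTop, c * √t ≤ ∫ ω, |(∫ s in (0 : ℝ)..t, path ξ ω s.toNNReal e)
      - ∫ s in (0 : ℝ)..t, path ξ ω s.toNNReal 0| ∂P := by
  obtain ⟨h1, h2⟩ := hmom
  obtain ⟨a, ha0, ha⟩ := ENNReal.lt_iff_exists_nnreal_btwn.1 h1
  obtain ⟨b, hb, -⟩ := ENNReal.lt_iff_exists_nnreal_btwn.1 h2
  have ha0' : (0 : ℝ) < a := by exact_mod_cast ha0
  -- `(x - y)⁴ ≤ 8 (x⁴ + y⁴)` and both occupation integrals have the same law, whence `16 b`; the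
  -- `1` keeps `B` positive.
  set B : ℝ := 16 * b + 1 with hB
  have hB0 : 0 < B := by positivity
  -- With truncation at `θ √t`, the fourth moment term becomes exactly `a t / 2`.
  set θ : ℝ := √(2 * B / a) with hθ
  have hθ0 : 0 < θ := Real.sqrt_pos.2 (by positivity)
  have hθsq : θ ^ 2 = 2 * B / a := Real.sq_sqrt (by positivity)
  refine ⟨a / (2 * θ), by positivity, ?_⟩
  filter_upwards [eventually_lt_of_lt_liminf ha, eventually_lt_of_limsup_lt hb,
    eventually_gt_atTop 0] with t hat hbt ht
  set J : Site d → Ω → ℝ := fun x ω => ∫ s in (0 : ℝ)..t, path ξ ω s.toNNReal x with hJ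
  have hJint : ∀ x, Integrable (J x) P := fun x => (h.integral_integral x ht.le).1
  have hcum := h.ae_cumulative_eq (density P ξ)
  set ρ := density P ξ
  have hid : IdentDistrib (J e) (J 0) P P := by
    have := (h.isPathFunctional_integral 0 ht.le).identDistrib h 0 e
    simpa [shift, hJ] using this
  have h4 : ∀ x, ∫⁻ ω, ENNReal.ofReal (|cumulative ξ ρ x t ω| ^ 4) ∂P
      = ∫⁻ ω, ENNReal.ofReal (|J x ω - ρ * t| ^ 4) ∂P := by
    intro x
    refine lintegral_congr_ae ?_
    filter_upwards [hcum] with ω hω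
    rw [hω x t ht.le]
  have h4e : ∫⁻ ω, ENNReal.ofReal (|J e ω - ρ * t| ^ 4) ∂P
      = ∫⁻ ω, ENNReal.ofReal (|J 0 ω - ρ * t| ^ 4) ∂P :=
    (hid.comp (u := fun z : ℝ => ENNReal.ofReal (|z - ρ * t| ^ 4)) (by fun_prop)).lintegral_eq
  have h2e : ∫⁻ ω, ENNReal.ofReal (|cumulative ξ ρ 0 t ω - cumulative ξ ρ e t ω| ^ 2) ∂P
      = ∫⁻ ω, ENNReal.ofReal (|J e ω - J 0 ω| ^ 2) ∂P := by
    refine lintegral_congr_ae ?_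
    filter_upwards [hcum] with ω hω
    rw [hω 0 t ht.le, hω e t ht.le, ← abs_sub_comm (J 0 ω)]
    simp [hJ]
  have hX4 : ∫⁻ ω, ENNReal.ofReal (|J e ω - J 0 ω| ^ 4) ∂P ≤ ENNReal.ofReal (B * t ^ 2) := by
    have hle : ∀ ω, ENNReal.ofReal (|J e ω - J 0 ω| ^ 4)
        ≤ ENNReal.ofReal 8 * ENNReal.ofReal (|J e ω - ρ * t| ^ 4)
          + ENNReal.ofReal 8 * ENNReal.ofReal (|J 0 ω - ρ * t| ^ 4) := by
      intro ω
      rw [← ENNReal.ofReal_mul (by norm_num), ← ENNReal.ofReal_mul (by norm_num),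
        ← ENNReal.ofReal_add (by positivity) (by positivity)]
      refine ENNReal.ofReal_le_ofReal ?_
      have e4 : ∀ z : ℝ, |z| ^ 4 = z ^ 4 := fun z => by
        rw [show 4 = 2 * 2 from rfl, pow_mul, pow_mul, sq_abs]
      rw [e4, e4, e4]
      have h5 : (J e ω - J 0 ω) ^ 2 ≤ 2 * ((J e ω - ρ * t) ^ 2 + (J 0 ω - ρ * t) ^ 2) := by
        nlinarith [sq_nonneg ((J e ω - ρ * t) + (J 0 ω - ρ * t))]
      have h6 := pow_le_pow_left₀ (sq_nonneg _) h5 2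
      nlinarith [sq_nonneg ((J e ω - ρ * t) ^ 2 - (J 0 ω - ρ * t) ^ 2)]
    refine (lintegral_mono hle).trans ?_
    rw [lintegral_add_left' (by fun_prop), lintegral_const_mul' _ _ (by simp),
      lintegral_const_mul' _ _ (by simp), h4e, ← h4 0]
    have : ∫⁻ ω, ENNReal.ofReal (|cumulative ξ ρ 0 t ω| ^ 4) ∂P ≤ ENNReal.ofReal (b * t ^ 2) := by
      rw [ENNReal.ofReal_mul (by positivity), ENNReal.ofReal_coe_nnreal]
      exact (ENNReal.div_le_iff (by positivity) (by simp)).1 hbt.le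
    refine (add_le_add (mul_le_mul_right this _) (mul_le_mul_right this _)).trans ?_
    rw [← ENNReal.ofReal_mul (by norm_num), ← ENNReal.ofReal_add (by positivity) (by positivity)]
    refine ENNReal.ofReal_le_ofReal ?_
    rw [hB]
    nlinarith [sq_nonneg t]
  have hX2 : ENNReal.ofReal (a * t) ≤ ∫⁻ ω, ENNReal.ofReal (|J e ω - J 0 ω| ^ 2) ∂P := by
    rw [← h2e, ENNReal.ofReal_mul (by positivity), ENNReal.ofReal_coe_nnreal]
    exact (ENNReal.le_div_iff_mul_le (by simp [ht]) (by simp)).1 hat.le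
  have hst : 0 < √t := Real.sqrt_pos.2 ht
  have hsq : √t ^ 2 = t := Real.sq_sqrt ht.le
  have hXint : Integrable (fun ω => J e ω - J 0 ω) P := (hJint e).sub (hJint 0)
  have key := hX2.trans (lintegral_sq_le hXint.aemeasurable (θ := θ * √t) (by positivity))
  have e1 : ∫⁻ ω, ENNReal.ofReal |J e ω - J 0 ω| ∂P
      = ENNReal.ofReal (∫ ω, |J e ω - J 0 ω| ∂P) :=
    (ofReal_integral_eq_lintegral_ofReal hXint.abs (.of_forall fun _ => abs_nonneg _)).symm
  have hnn : 0 ≤ ∫ ω, |J e ω - J 0 ω| ∂P := integral_nonneg fun _ => abs_nonneg _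
  rw [e1] at key
  have key2 := key.trans (add_le_add_right (mul_le_mul_right hX4 _) _)
  rw [← ENNReal.ofReal_mul (by positivity), ← ENNReal.ofReal_mul (by positivity),
    ← ENNReal.ofReal_add (by positivity) (by positivity),
    ENNReal.ofReal_le_ofReal_iff (by positivity)] at key2
  have e2 : ((θ * √t) ^ 2)⁻¹ * (B * t ^ 2) = a * t / 2 := by
    rw [mul_pow, hsq, hθsq]
    field_simp
  rw [e2] at key2
  have : a / (2 * θ) * √t * (θ * √t) ≤ (∫ ω, |J e ω - J 0 ω| ∂P) * (θ * √t) := by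
    have : a / (2 * θ) * √t * (θ * √t) = a * √t ^ 2 / 2 := by field_simp
    rw [this, hsq]
    linarith
  exact le_of_mul_le_mul_right this (by positivity)

/-- Staying at `0` and visiting the neighbour both bound `log u` from below, and `max x y = (x + y +
|x - y|) / 2` turns the better choice into a gain of half the mean absolute difference. The visit
costs two jumps and some integrals of `|ξ|` over unit intervals, collected in `C`. One time `T`
suffices because the mean rate at every positive time is at most `lyapunov`. -/
lemma IsEnvironment.lyapunov_ge (h : IsEnvironment P ξ) {γ : ℝ} (hγ : 0 ≤ γ) (p : Fin d × Bool) :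
    ∃ C : ℝ, ∀ κ T : ℝ, 0 < κ → κ ≤ 1 → 2 ≤ T →
      γ / 2 * (∫ ω, |(∫ s in (0 : ℝ)..T, path ξ ω s.toNNReal (unitStep p))
        - ∫ s in (0 : ℝ)..T, path ξ ω s.toNNReal 0| ∂P) - C - 2 * Real.log (1 / κ)
        - 2 * d * κ * T ≤ (lyapunov P ξ γ κ - density P ξ * γ) * T := by
  set e := unitStep p
  set ρ' := density P fun t ω x => |ξ t ω x|
  refine ⟨8 * γ * ρ' + 8 * d, fun κ T hκ hκ1 hT => ?_⟩
  have hT0 : 0 ≤ T := by linarith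
  set J : Site d → Ω → ℝ := fun x ω => ∫ s in (0 : ℝ)..T, path ξ ω s.toNNReal x with hJ
  set R : ℝ≥0 → Site d → Ω → ℝ :=
    fun s x ω => ∫ q in (0 : ℝ)..1, |shift s 0 (path ξ ω) q.toNNReal x| with hR
  have hJi : ∀ x, Integrable (J x) P ∧ ∫ ω, J x ω ∂P = T * density P ξ := fun x =>
    h.isField.integral_integral x hT0
  have hRi : ∀ s x, Integrable (R s x) P ∧ ∫ ω, R s x ω ∂P = ρ' := by
    intro s x
    have hid := (h.isField.isPathFunctional_integral_abs x zero_le_one).identDistrib h.isField s 0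
    have h1 := h.isField.abs.integral_integral x zero_le_one
    rw [one_mul] at h1
    exact ⟨hid.symm.integrable_snd h1.1, hid.integral_eq.trans h1.2⟩
  set S : Ω → ℝ := fun ω => R 0 e ω + R 0 0 ω + R (T - 1).toNNReal e ω + R (T - 1).toNNReal 0 ω
  have hS : Integrable S P ∧ ∫ ω, S ω ∂P = 4 * ρ' := by
    have i1 := ((hRi 0 e).1.add (hRi 0 0).1)
    have i2 := i1.add (hRi (T - 1).toNNReal e).1
    refine ⟨i2.add (hRi (T - 1).toNNReal 0).1, ?_⟩
    refine (integral_add i2 (hRi (T - 1).toNNReal 0).1).trans ?_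
    rw [integral_add' i1 (hRi _ _).1, integral_add' (hRi _ _).1 (hRi _ _).1]
    simp only [(hRi _ _).2]
    ring
  have hfin := h.ae_pamSol_lt_top hκ.le hγ 0 0
  simp only [shift_zero] at hfin
  have hlower : ∀ᵐ ω ∂P, (γ / 2 * (J e ω + J 0 ω + |J e ω - J 0 ω|) - 2 * γ * S ω)
      + (-(2 * d * κ * T) + 2 * (Real.log κ - 4 * d * κ)) ≤ logSol (path ξ ω) κ γ T := by
    filter_upwards [hfin, h.isField.ae_locInt] with ω h1 hv
    have h2 := logSol_ge hκ.le hT0 (h1 T hT0)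
    have h3 := hv.logSol_ge_excursion hκ hγ p hT (h1 T hT0)
    have hR0 : ∀ s x, 0 ≤ R s x ω := fun s x =>
      intervalIntegral.integral_nonneg zero_le_one fun _ _ => abs_nonneg _
    have h4 : 0 ≤ γ * S ω := by
      have := hR0 0 e; have := hR0 0 0; have := hR0 (T - 1).toNNReal e
      have := hR0 (T - 1).toNNReal 0
      positivity
    have h5 : Real.log κ ≤ 0 := Real.log_nonpos hκ.le hκ1
    have h6 : 0 ≤ d * κ := by positivity
    rcases le_total (J e ω) (J 0 ω) with h7 | h7
    · rw [abs_of_nonpos (by linarith)]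
      change -(2 * d * κ * T) + γ * J 0 ω ≤ _ at h2
      linarith
    · rw [abs_of_nonneg (by linarith)]
      have h8 : S ω = (∫ s in (0 : ℝ)..1, |path ξ ω s.toNNReal e|)
        + (∫ s in (0 : ℝ)..1, |path ξ ω s.toNNReal 0|)
        + (∫ s in (0 : ℝ)..1, |shift (T - 1).toNNReal 0 (path ξ ω) s.toNNReal e|)
        + ∫ s in (0 : ℝ)..1, |shift (T - 1).toNNReal 0 (path ξ ω) s.toNNReal 0| := by
        simp [S, R, shift_zero]
      rw [← h8] at h3
      change γ * J e ω - 2 * γ * S ω - _ + _ ≤ _ at h3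
      linarith
  have hi1 : Integrable (fun ω => |J e ω - J 0 ω|) P := ((hJi e).1.sub (hJi 0).1).abs
  have hi0 : Integrable (fun ω => J e ω + J 0 ω) P := (hJi e).1.add (hJi 0).1
  have hi2 : Integrable (fun ω => γ / 2 * (J e ω + J 0 ω + |J e ω - J 0 ω|)) P :=
    (hi0.add hi1).const_mul _
  have hi3 : Integrable (fun ω => γ / 2 * (J e ω + J 0 ω + |J e ω - J 0 ω|) - 2 * γ * S ω) P :=
    hi2.sub (hS.1.const_mul _)
  have hmain := integral_mono_ae (hi3.add (integrable_const _))
    (h.integrable_logSol hκ.le hγ hT0) hlower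
  have hlam := h.integral_logSol_le hκ.le hγ (show 0 < T by linarith)
  have hval : ∫ ω, ((γ / 2 * (J e ω + J 0 ω + |J e ω - J 0 ω|) - 2 * γ * S ω)
      + (-(2 * d * κ * T) + 2 * (Real.log κ - 4 * d * κ))) ∂P
      = γ / 2 * (T * density P ξ + T * density P ξ + ∫ ω, |J e ω - J 0 ω| ∂P) - 2 * γ * (4 * ρ')
        + (-(2 * d * κ * T) + 2 * (Real.log κ - 4 * d * κ)) := by
    rw [integral_add hi3 (integrable_const _), integral_sub hi2 (hS.1.const_mul _),
      integral_const_mul, integral_const_mul, hS.2, integral_add hi0 hi1,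
      integral_add (hJi e).1 (hJi 0).1, (hJi e).2, (hJi 0).2]
    simp
  have hmain' := (hval.symm.trans_le hmain).trans hlam
  rw [one_div, Real.log_inv]
  have : (d : ℝ) * κ ≤ d := mul_le_of_le_one_right (Nat.cast_nonneg d) hκ1
  nlinarith

lemma tendsto_log_one_div : Tendsto (fun κ : ℝ => Real.log (1 / κ)) (𝓝[>] 0) atTop := by
  simp only [one_div]
  exact Real.tendsto_log_atTop.comp tendsto_inv_nhdsGT_zero

/-- The lower bound for the Lyapunov exponent at small diffusivity. -/
theorem IsEnvironment.liminf_lyapunov_pos (h : IsEnvironment P ξ) {γ : ℝ} (hγ : 0 < γ)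
    {e : Site d} (he : IsNeighborOfZero e) (hmom : MomentCondition P ξ e) :
    0 < liminf (fun κ : ℝ =>
      ((Real.log (1 / κ) * (lyapunov P ξ γ κ - density P ξ * γ) : ℝ) : EReal)) (𝓝[>] 0) := by
  obtain ⟨p, rfl⟩ := he.exists_unitStep
  obtain ⟨c, hc, hct⟩ := h.isField.exists_integral_abs_ge hmom
  obtain ⟨C, hC⟩ := h.lyapunov_ge hγ.le p
  -- With `T = K log²(1/κ)` the gain `γ c √T / 2` is `4 log(1/κ)`: it pays for the two jumps and for
  -- `C ≤ log(1/κ)`, and leaves `log(1/κ)`.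
  set K : ℝ := (8 / (γ * c)) ^ 2 with hK
  have hK0 : 0 < K := by positivity
  have hsK : √K = 8 / (γ * c) := Real.sqrt_sq (by positivity)
  have hL := tendsto_log_one_div
  have hκL : Tendsto (fun κ : ℝ => 2 * d * (κ * Real.log (1 / κ))) (𝓝[>] 0) (𝓝 0) := by
    have := (tendsto_log_mul_rpow_nhdsGT_zero one_pos).const_mul (-(2 * d : ℝ))
    simp only [mul_zero, Real.rpow_one] at this
    refine this.congr fun κ => ?_
    rw [one_div, Real.log_inv]
    ring
  refine lt_of_lt_of_le (b := ((1 / (2 * K) : ℝ) : EReal)) (by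
    exact_mod_cast (by positivity : 0 < 1 / (2 * K))) (le_liminf_of_le (by isBoundedDefault) ?_)
  have hT : Tendsto (fun κ : ℝ => K * Real.log (1 / κ) ^ 2) (𝓝[>] 0) atTop :=
    ((tendsto_pow_atTop two_ne_zero).comp hL).const_mul_atTop hK0
  have hpos : ∀ᶠ κ : ℝ in 𝓝[>] 0, 0 < κ := self_mem_nhdsWithin
  filter_upwards [hT.eventually hct, hT.eventually_ge_atTop 2, hL.eventually_ge_atTop C,
    hL.eventually_ge_atTop 1, hκL.eventually (gt_mem_nhds (show 0 < 1 / (2 * K) by positivity)), hpos,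
    (hpos.filter_mono le_rfl).and (nhdsWithin_le_nhds (Iic_mem_nhds zero_lt_one))]
    with κ h1 h2 h3 h4 h5 h6 h7
  rw [EReal.coe_le_coe_iff]
  have h8 := hC κ _ h6 h7.2 h2
  set L := Real.log (1 / κ)
  rw [Real.sqrt_mul hK0.le, Real.sqrt_sq (show 0 ≤ L by linarith), hsK] at h1
  have h9 : γ / 2 * (c * (8 / (γ * c) * L)) = 4 * L := by field_simp; ring
  have h10 := mul_le_mul_of_nonneg_left h1 (show 0 ≤ γ / 2 by positivity)
  rw [h9] at h10
  have h11 : L - 2 * d * κ * (K * L ^ 2) ≤ (lyapunov P ξ γ κ - density P ξ * γ) * (K * L ^ 2) := by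
    linarith
  have hL0 : 0 < L := by linarith
  have h12 : 1 - 2 * d * κ * (K * L) ≤ (L * (lyapunov P ξ γ κ - density P ξ * γ)) * K := by
    refine le_of_mul_le_mul_right ?_ hL0
    linarith
  have h13 : 1 / (2 * K) * K = 1 / 2 := by field_simp
  have h14 := mul_lt_mul_of_pos_right h5 hK0
  rw [h13] at h14
  refine le_of_mul_le_mul_right ?_ hK0
  rw [h13]
  linarith

end LowerBound

/-! ### Sums over the landing sites of the walk. -/

section LatticeSums

lemma rpow_tsum_le_tsum_rpow {ι : Type*} (f : ι → ℝ≥0∞) {p : ℝ} (hp : 0 < p) (hp1 : p ≤ 1) :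
    (∑' i, f i) ^ p ≤ ∑' i, f i ^ p := by
  classical
  have h : ∀ s : Finset ι, (∑ i ∈ s, f i) ^ p ≤ ∑ i ∈ s, f i ^ p := by
    intro s
    induction s using Finset.induction_on with
    | empty => simp [hp]
    | insert a s ha ih =>
      rw [Finset.sum_insert ha, Finset.sum_insert ha]
      exact (ENNReal.rpow_add_le_add_rpow _ _ hp.le hp1).trans (by gcongr)
  rw [← ENNReal.le_rpow_inv_iff hp, ENNReal.tsum_eq_iSup_sum]
  refine iSup_le fun s => ?_
  rw [ENNReal.le_rpow_inv_iff hp]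
  exact (h s).trans (ENNReal.sum_le_tsum s)

lemma tsum_prod_int (f : ℤ → ℝ≥0∞) (n : ℕ) :
    ∑' y : Fin n → ℤ, ∏ i, f (y i) = (∑' z, f z) ^ n := by
  induction n with
  | zero => simp
  | succ n ih =>
    rw [← (Fin.consEquiv fun _ : Fin (n + 1) => ℤ).tsum_eq, ENNReal.tsum_prod', pow_succ', ← ih,
      ← ENNReal.tsum_mul_right]
    refine tsum_congr fun z => ?_
    rw [← ENNReal.tsum_mul_left]
    refine tsum_congr fun y => ?_
    simp [Fin.consEquiv, Fin.prod_univ_succ]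

lemma tsum_int_two_inv_pow_le : ∑' z : ℤ, (2⁻¹ : ℝ≥0∞) ^ z.natAbs ≤ 4 := by
  have h2 : ∑' n : ℕ, (2⁻¹ : ℝ≥0∞) ^ n = 2 := by
    rw [ENNReal.tsum_geometric, ENNReal.one_sub_inv_two, inv_inv]
  have h3 : ∑' n : ℕ, (2⁻¹ : ℝ≥0∞) ^ (n + 1) ≤ 2 := by
    refine le_trans (ENNReal.tsum_le_tsum fun n => ?_) h2.le
    exact pow_le_pow_right_of_le_one' (ENNReal.inv_le_one.2 (by norm_num)) n.le_succ
  have h4 := HasSum.of_nat_of_neg_add_one (f := fun z : ℤ => (2⁻¹ : ℝ≥0∞) ^ z.natAbs)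
    (ENNReal.summable.hasSum) (ENNReal.summable.hasSum)
  rw [h4.tsum_eq]
  have h5 : ∀ n : ℕ, (-((n : ℤ) + 1)).natAbs = n + 1 := fun n => by omega
  simp only [h5, Int.natAbs_natCast, h2]
  calc _ ≤ (2 : ℝ≥0∞) + 2 := by gcongr
    _ = 4 := by norm_num

variable {d : ℕ} [NeZero d]

/-- The displacement of the walk, on the event that it has jumped, has small moments. -/
lemma tsum_walkLaw_rpow_le {κ m : ℝ} {t p : ℝ} (hm : 2 * d * κ * t = m) (hm0 : 0 ≤ m) (hp : 0 < p)
    (hmp : m ^ p ≤ 1 / 2) :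
    ∑' y, walkLaw d {w | 1 ≤ jumpCount w (2 * d * κ * t) ∧ walkAt κ w t = y} ^ p
      ≤ ENNReal.ofReal (m ^ p) * (2 * 4 ^ d) := by
  set r : ℝ≥0∞ := ENNReal.ofReal (m ^ p) with hr
  have hr2 : r ≤ 2⁻¹ := by
    rw [hr, ← ENNReal.ofReal_ofNat 2, ← ENNReal.ofReal_inv_of_pos (by norm_num)]
    exact ENNReal.ofReal_le_ofReal (by simpa using hmp)
  have h1 : ∀ y : Site d,
      walkLaw d {w | 1 ≤ jumpCount w (2 * d * κ * t) ∧ walkAt κ w t = y} ^ p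
        ≤ r * (2 * ∏ i, (2⁻¹ : ℝ≥0∞) ^ (y i).natAbs) := by
    intro y
    -- Reaching `y` takes at least `|y|₁` jumps, and one jump is made in any case. One factor `r` is
    -- kept for smallness; the others, at most `1/2` each, make the sum over `y` converge.
    set k := max 1 (∑ i, (y i).natAbs) with hk
    have h2 : walkLaw d {w | 1 ≤ jumpCount w (2 * d * κ * t) ∧ walkAt κ w t = y}
        ≤ ENNReal.ofReal m ^ k := by
      rw [← hm]
      refine le_trans (measure_mono ?_) (walkLaw_le_jumpCount (by rw [hm]; exact hm0) k)
      rintro w ⟨h3, h4⟩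
      refine max_le h3 ?_
      rw [← h4]
      exact sum_natAbs_walk_le w _
    have h3 : (ENNReal.ofReal m ^ k) ^ p = r ^ k := by
      rw [hr, ← ENNReal.ofReal_rpow_of_nonneg hm0 hp.le, ← ENNReal.rpow_natCast,
        ← ENNReal.rpow_natCast, ← ENNReal.rpow_mul, ← ENNReal.rpow_mul, mul_comm]
    calc _ ≤ (ENNReal.ofReal m ^ k) ^ p := by gcongr
      _ = r * r ^ (k - 1) := by
        rw [h3, ← pow_succ', Nat.sub_add_cancel (le_max_left _ _)]
      _ ≤ r * 2⁻¹ ^ (k - 1) := by gcongr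
      _ = r * (2 * 2⁻¹ ^ k) := by
        congr 1
        have hk1 : k = (k - 1) + 1 := (Nat.sub_add_cancel (le_max_left _ _)).symm
        conv_rhs => rw [hk1]
        rw [pow_succ', ← mul_assoc, ENNReal.mul_inv_cancel (by simp) (by simp), one_mul]
      _ ≤ r * (2 * 2⁻¹ ^ (∑ i, (y i).natAbs)) := by
        gcongr _ * (2 * ?_)
        exact pow_le_pow_right_of_le_one' (ENNReal.inv_le_one.2 (by norm_num)) (le_max_right _ _)
      _ = _ := by rw [Finset.prod_pow_eq_pow_sum]
  refine (ENNReal.tsum_le_tsum h1).trans ?_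
  rw [ENNReal.tsum_mul_left, ENNReal.tsum_mul_left, tsum_prod_int fun z => 2⁻¹ ^ z.natAbs]
  gcongr
  exact tsum_int_two_inv_pow_le

end LatticeSums

/-! ### The Markov property of the environment in integrated form. -/

section Markov

variable {d : ℕ} [NeZero d] {Ω : Type*} [MeasurableSpace Ω]
  {P : Measure Ω} [IsProbabilityMeasure P] {ξ : ℝ≥0 → Ω → Config d}

/-- The hypothesis says that the conditional expectation of `X` given `m` is at most `b`.
Equivalently, on `m` the measure with density `X` is at most `b` times `Q`, and `m`-measurable
functions can be integrated against this inequality. -/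
lemma lintegral_mul_le_of_setLIntegral_le {m m0 : MeasurableSpace Ω} {Q : Measure[m0] Ω}
    (hm : m ≤ m0) [IsFiniteMeasure Q] {X Φ : Ω → ℝ≥0∞} (hX : Measurable[m0] X)
    (hΦ : Measurable[m] Φ) {b : ℝ≥0∞}
    (h : ∀ B, MeasurableSet[m] B → ∫⁻ ω in B, X ω ∂Q ≤ b * Q B) :
    ∫⁻ ω, Φ ω * X ω ∂Q ≤ b * ∫⁻ ω, Φ ω ∂Q := by
  have h1 : (Q.withDensity X).trim hm ≤ b • Q.trim hm := by
    refine Measure.le_iff.2 fun B hB => ?_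
    rw [trim_measurableSet_eq hm hB, withDensity_apply _ (hm B hB), Measure.smul_apply,
      trim_measurableSet_eq hm hB, smul_eq_mul]
    exact h B hB
  calc ∫⁻ ω, Φ ω * X ω ∂Q = ∫⁻ ω, Φ ω ∂(Q.withDensity X) := by
        rw [lintegral_withDensity_eq_lintegral_mul _ hX (hΦ.mono hm le_rfl)]
        simp [mul_comm]
    _ = ∫⁻ ω, Φ ω ∂((Q.withDensity X).trim hm) := (lintegral_trim hm hΦ).symm
    _ ≤ ∫⁻ ω, Φ ω ∂(b • Q.trim hm) := lintegral_mono' h1 le_rfl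
    _ = b * ∫⁻ ω, Φ ω ∂Q := by rw [lintegral_smul_measure, lintegral_trim hm hΦ, smul_eq_mul]

variable {S : Set (Config d)} {hS : ∀ t ω, ξ t ω ∈ S} {Pstart : Kernel S Ω}

/-- The kernel that restarts the process from its state at time `t`. -/
def restart (hS : ∀ t ω, ξ t ω ∈ S) (Pstart : Kernel S Ω)
    (hξ : Measurable fun p : ℝ≥0 × Ω => ξ p.1 p.2) (t : ℝ≥0) : Kernel Ω Ω :=
  Pstart.comap (fun ω => (⟨ξ t ω, hS t ω⟩ : S))
    (Measurable.subtype_mk (measurable_pi_iff.1 (measurable_path hξ) t))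

/-- The events before time `t`. -/
abbrev past (ξ : ℝ≥0 → Ω → Config d) (t : ℝ≥0) : MeasurableSpace Ω :=
  ⨆ s : Iic t, MeasurableSpace.comap (ξ s) inferInstance

lemma past_le (hξ : Measurable fun p : ℝ≥0 × Ω => ξ p.1 p.2) (t : ℝ≥0) :
    past ξ t ≤ ‹MeasurableSpace Ω› :=
  iSup_le fun s => (measurable_pi_iff.1 (measurable_path hξ) s).comap_le

lemma measurable_past_restrictPath (ξ : ℝ≥0 → Ω → Config d) (t : ℝ≥0) :
    Measurable[past ξ t] fun ω => restrictPath t (path ξ ω) :=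
  @measurable_pi_lambda _ _ _ (past ξ t) _ _ fun s =>
    (comap_measurable (ξ s)).mono (le_iSup (fun s : Iic t =>
      MeasurableSpace.comap (ξ s) inferInstance) s) le_rfl

lemma HasMarkovProperty.map_restrict (h : HasMarkovProperty P ξ hS Pstart)
    (hξ : Measurable fun p : ℝ≥0 × Ω => ξ p.1 p.2) (t : ℝ≥0) {B : Set Ω}
    (hB : MeasurableSet[past ξ t] B) :
    (P.restrict B).map (fun ω => shift t 0 (path ξ ω))
      = ((P.restrict B).bind (restart hS Pstart hξ t)).map (path ξ) := by
  have hp := measurable_path hξ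
  ext A hA
  rw [Measure.map_apply (measurable_shift_path hξ t 0) hA, Measure.map_apply hp hA,
    Measure.restrict_apply ((measurable_shift_path hξ t 0) hA),
    Measure.bind_apply (hp hA) (Kernel.aemeasurable _), inter_comm]
  exact h t B hB A hA

/-- Over an event of the past, the integral of `Ψ` after time `t` is an integral of restarted
expectations, each at most `b`; the preceding inequality passes from events to weights. -/
lemma HasMarkovProperty.lintegral_mul_le (h : HasMarkovProperty P ξ hS Pstart)
    (hξ : Measurable fun p : ℝ≥0 × Ω => ξ p.1 p.2) (t : ℝ≥0) {Φ : (Iic t → Config d) → ℝ≥0∞}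
    (hΦ : Measurable Φ) {Ψ : (ℝ≥0 → Config d) → ℝ≥0∞} (hΨ : Measurable Ψ) {b : ℝ≥0∞}
    (hb : ∀ᵐ ω ∂P, ∫⁻ ω', Ψ (path ξ ω') ∂(restart hS Pstart hξ t ω) ≤ b) :
    ∫⁻ ω, Φ (restrictPath t (path ξ ω)) * Ψ (shift t 0 (path ξ ω)) ∂P
      ≤ b * ∫⁻ ω, Φ (restrictPath t (path ξ ω)) ∂P := by
  have hp := measurable_path hξ
  refine lintegral_mul_le_of_setLIntegral_le (past_le hξ t) (hΨ.comp (measurable_shift_path hξ t 0))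
    (hΦ.comp (measurable_past_restrictPath ξ t)) fun B hB => ?_
  have h1 := congrArg (fun μ => ∫⁻ v, Ψ v ∂μ) (h.map_restrict hξ t hB)
  beta_reduce at h1
  have hΨp : Measurable fun ω => Ψ (path ξ ω) := hΨ.comp hp
  rw [lintegral_map hΨ (measurable_shift_path hξ t 0), lintegral_map hΨ hp,
    Measure.lintegral_bind (Kernel.aemeasurable _) hΨp.aemeasurable] at h1
  refine h1.trans_le ?_
  calc _ ≤ ∫⁻ ω in B, b ∂P := lintegral_mono_ae (ae_restrict_of_ae hb)
    _ = _ := by simp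

end Markov

/-! ### Recursion for fractional moments of the total mass. -/

section MomentRecursion

variable {d : ℕ} [NeZero d] {Ω : Type*} [MeasurableSpace Ω]
  {P : Measure Ω} [IsProbabilityMeasure P] {ξ : ℝ≥0 → Ω → Config d}
  {S : Set (Config d)} {Pstart : Kernel S Ω}

/-- The sampled version reads the path on `[0, t]` only, so the total mass may serve as a weight
that is measurable for the past. -/
lemma IsField.ae_exists_sampled (h : IsField P ξ) {κ : ℝ} (hκ : 0 ≤ κ) (γ : ℝ) (t : ℝ≥0) :
    ∃ Φ : (Iic t → Config d) → ℝ≥0∞, Measurable Φ ∧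
      ∀ᵐ ω ∂P, totalMass (path ξ ω) κ γ 0 t = Φ (restrictPath t (path ξ ω)) := by
  obtain ⟨u, hu⟩ := (ae_fkOn_eq_sampledFkOn h.measurable h.ae_locInt univ hκ γ 0 t).exists
  refine ⟨_, measurable_sampledFkOn univ u t κ γ 0, ?_⟩
  simpa only [totalMass_eq_fkOn] using hu

/-- Given the past, functionals of the increment of the cumulative field are controlled by their
expectations under the laws of the process started from a fixed state. -/
lemma IsMarkovProcess.lintegral_mul_le (hM : IsMarkovProcess P ξ S Pstart) (h : IsField P ξ)
    {κ : ℝ} (hκ : 0 ≤ κ) (γ p ρ : ℝ) (t T : ℝ≥0) {g : ℝ → ℝ≥0∞} (hg : Measurable g) {b : ℝ≥0∞}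
    (hb : ∀ η, ∫⁻ ω, g (cumulative ξ ρ 0 T ω) ∂(Pstart η) ≤ b) :
    ∫⁻ ω, totalMass (path ξ ω) κ γ 0 t ^ p
        * g ((∫ s in (0 : ℝ)..T, shift t 0 (path ξ ω) s.toNNReal 0) - ρ * T) ∂P
      ≤ b * ∫⁻ ω, totalMass (path ξ ω) κ γ 0 t ^ p ∂P := by
  have := hM.isMarkovKernel
  have hp := measurable_path h.measurable
  set k := restart hM.mem_state Pstart h.measurable t
  have hk : IsMarkovKernel k := Kernel.IsMarkovKernel.comap Pstart _
  -- Averaged over the state at time `t`, the restarted process has the law of the shifted field.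
  -- This is how it inherits local integrability, which is not assumed under the individual laws
  -- `Pstart η`.
  have hmap : P.map (fun ω => shift t 0 (path ξ ω)) = (P.bind k).map (path ξ) := by
    have := hM.markov.map_restrict h.measurable t (B := univ) MeasurableSet.univ
    rwa [Measure.restrict_univ] at this
  have hQ : ∀ᵐ ω ∂(P.bind k), LocInt (path ξ ω) := by
    refine ae_locInt_of_lintegral_le h.measurable (C := ∫⁻ ω, ‖ξ 0 ω 0‖ₑ ∂P)
      h.integrable.2.ne fun s x => ?_
    have hm : Measurable fun v : ℝ≥0 → Config d => ‖v s x‖ₑ :=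
      ((measurable_pi_apply x).comp (measurable_pi_apply s)).enorm
    have h1 := congrArg (fun μ => ∫⁻ v, ‖v s x‖ₑ ∂μ) hmap
    beta_reduce at h1
    rw [lintegral_map hm (measurable_shift_path h.measurable t 0), lintegral_map hm hp] at h1
    refine h1.symm.trans_le (le_of_eq ?_)
    refine Eq.trans ?_ ((h.identDistrib (t + s) x).comp measurable_enorm).lintegral_eq
    simp [shift, path]
  obtain ⟨Φ, hΦ, hΦe⟩ := h.ae_exists_sampled hκ γ t
  have hξt : Measurable fun q : ℝ≥0 × Ω => ξ (t + q.1) q.2 :=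
    h.measurable.comp (f := fun q : ℝ≥0 × Ω => (t + q.1, q.2)) (by fun_prop)
  have e : ∀ ω, path (fun r => ξ (t + r)) ω = shift t 0 (path ξ ω) := by
    intro ω; funext r x; simp [shift, path]
  have hloc : ∀ᵐ ω ∂P, LocInt (path (fun r => ξ (t + r)) ω) := by
    filter_upwards [h.ae_locInt] with ω hω
    rw [e]
    exact hω.shift t 0
  -- One sampling sequence is good both for the shifted field under `P` and for the restarted
  -- process, so a single functional `Ψ` links the two.
  obtain ⟨u, hu1, hu2⟩ := ((ae_fkOn_eq_sampledFkOn hξt hloc univ le_rfl 1 0 T).and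
    (ae_fkOn_eq_sampledFkOn h.measurable hQ univ le_rfl 1 0 T)).exists
  simp only [← totalMass_eq_fkOn] at hu1 hu2
  set Ψ : (ℝ≥0 → Config d) → ℝ≥0∞ := fun v =>
    g (Real.log (sampledFkOn univ u T (restrictPath T v) 0 1 0).toReal - ρ * T) with hΨ
  have hΨm : Measurable Ψ := hg.comp ((Real.measurable_log.comp (ENNReal.measurable_toReal.comp
    ((measurable_sampledFkOn univ u T 0 1 0).comp (measurable_restrictPath T)))).sub_const _)
  have h1 : ∀ᵐ ω ∂P, g ((∫ s in (0 : ℝ)..T, shift t 0 (path ξ ω) s.toNNReal 0) - ρ * T)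
      = Ψ (shift t 0 (path ξ ω)) := by
    filter_upwards [hu1] with ω hω
    rw [e] at hω
    rw [hΨ, integral_eq_log_totalMass, hω]
  have h2 : ∀ᵐ ω ∂(P.bind k), Ψ (path ξ ω) = g (cumulative ξ ρ 0 T ω) := by
    filter_upwards [hu2, hQ] with ω hω hv
    have e : cumulative ξ ρ 0 T ω = (∫ s in (0 : ℝ)..T, path ξ ω s.toNNReal 0) - ρ * T := by
      refine (intervalIntegral.integral_sub (hv.int 0 T T.coe_nonneg)
        intervalIntegrable_const).trans ?_
      simp [mul_comm]
    rw [hΨ, e, integral_eq_log_totalMass, hω]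
  have h3 : ∀ᵐ ω ∂P, ∫⁻ ω', Ψ (path ξ ω') ∂(k ω) ≤ b := by
    filter_upwards [Measure.ae_ae_of_ae_bind (Kernel.aemeasurable _) h2] with ω hω
    rw [lintegral_congr_ae hω]
    exact hb _
  have h4 := hM.markov.lintegral_mul_le h.measurable t (hΦ.pow_const p) hΨm h3
  have e1 : ∫⁻ ω, totalMass (path ξ ω) κ γ 0 t ^ p ∂P
      = ∫⁻ ω, Φ (restrictPath t (path ξ ω)) ^ p ∂P := by
    refine lintegral_congr_ae ?_
    filter_upwards [hΦe] with ω hω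
    rw [hω]
  rw [e1]
  refine le_trans (le_of_eq (lintegral_congr_ae ?_)) h4
  filter_upwards [hΦe, h1] with ω h5 h6
  rw [h5, h6]

lemma IsField.ae_forall_ae_le (h : IsField P ξ) {M : ℝ}
    (hM : ∀ (t : ℝ≥0) (x : Site d), ∀ᵐ ω ∂P, ξ t ω x ≤ M) :
    ∀ᵐ ω ∂P, ∀ x, ∀ᵐ r : ℝ, path ξ ω r.toNNReal x ≤ M := by
  refine ae_all_iff.2 fun x => ?_
  have hm : MeasurableSet {q : Ω × ℝ | ξ q.2.toNNReal q.1 x ≤ M} :=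
    measurableSet_le ((measurable_pi_iff.1 h.measurable x).comp
      (f := fun q : Ω × ℝ => (q.2.toNNReal, q.1)) (by fun_prop)) measurable_const
  exact (Measure.ae_ae_comm hm).2 (.of_forall fun r => hM r.toNNReal x)

lemma LocInt.integral_shift_le {v : ℝ≥0 → Config d} (hv : LocInt v) {M : ℝ} {x : Site d}
    (hM : ∀ᵐ r : ℝ, v r.toNNReal x ≤ M) (t T : ℝ≥0) :
    ∫ s in (0 : ℝ)..T, PAM.shift t 0 v s.toNNReal x ≤ M * T := by
  have e : ∫ s in (0 : ℝ)..T, PAM.shift t 0 v s.toNNReal x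
      = ∫ s in (0 : ℝ)..T, v (s + t).toNNReal x := by
    refine intervalIntegral.integral_congr fun s hs => ?_
    rw [uIcc_of_le T.coe_nonneg] at hs
    simp only [PAM.shift, zero_add]
    rw [Real.toNNReal_add hs.1 t.coe_nonneg, Real.toNNReal_coe, add_comm]
  rw [e, intervalIntegral.integral_comp_add_right (fun s => v s.toNNReal x)]
  refine (intervalIntegral.integral_mono_ae (g := fun _ => M) (by simp)
    (hv.intervalIntegrable x (by simp) (by positivity)) intervalIntegrable_const hM).trans ?_
  simp [mul_comm]

lemma totalMass_shift_zero (v : ℝ≥0 → Config d) (κ γ : ℝ) (y : Site d) (t : ℝ) :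
    totalMass (shift 0 y v) κ γ 0 t = totalMass v κ γ y t := by
  simp [totalMass, weight, action, shift]

lemma totalMass_zero (v : ℝ≥0 → Config d) (κ γ : ℝ) (x : Site d) : totalMass v κ γ x 0 = 1 := by
  simp [totalMass, weight, action]

/-- The moments of the total mass grow at most geometrically. -/
lemma IsMarkovProcess.lintegral_totalMass_add_le (hM : IsMarkovProcess P ξ S Pstart)
    (h : IsField P ξ) {κ γ p ρ M b : ℝ} (hκ : 0 ≤ κ) (hγ : 0 ≤ γ) (hp : 0 < p) (hp1 : p ≤ 1)
    (hbd : ∀ (t : ℝ≥0) (x : Site d), ∀ᵐ ω ∂P, ξ t ω x ≤ M) {T : ℝ≥0}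
    (hmp : (2 * d * κ * T) ^ p ≤ 1 / 2) (hb0 : 0 ≤ b)
    (hb : ∀ η, ∫⁻ ω, ENNReal.ofReal (Real.exp (p * γ * min (cumulative ξ ρ 0 T ω) ((M - ρ) * T)))
      ∂(Pstart η) ≤ ENNReal.ofReal b) (t : ℝ≥0) :
    ∫⁻ ω, totalMass (path ξ ω) κ γ 0 (T + t) ^ p ∂P
      ≤ ENNReal.ofReal (Real.exp (p * γ * (ρ * T)) * (b + 2 * 4 ^ d
        * (Real.exp (γ * ((M - ρ) * T)) * (2 * d * κ * T)) ^ p))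
        * ∫⁻ ω, totalMass (path ξ ω) κ γ 0 t ^ p ∂P := by
  set a := ∫⁻ ω, totalMass (path ξ ω) κ γ 0 t ^ p ∂P with ha
  set W : Site d → ℝ≥0∞ :=
    fun y => walkLaw d {w | 1 ≤ jumpCount w (2 * d * κ * T) ∧ walkAt κ w T = y} with hW
  set E : ℝ≥0∞ := ENNReal.ofReal (Real.exp (p * γ * (ρ * T))) with hE
  -- The field is bounded above under `P`, but perhaps not under `Pstart η`; the cap `(M - ρ) T` is
  -- therefore built into `g`. Under `P` it is inactive.
  set g : ℝ → ℝ≥0∞ := fun z => ENNReal.ofReal (Real.exp (p * γ * min z ((M - ρ) * T))) with hg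
  have hgm : Measurable g := by fun_prop
  have hpow : ∀ z : ℝ, ENNReal.ofReal (Real.exp z) ^ p = ENNReal.ofReal (Real.exp (z * p)) :=
    fun z => by rw [ENNReal.ofReal_rpow_of_pos (Real.exp_pos _), ← Real.exp_mul]
  have hpt : ∀ᵐ ω ∂P, totalMass (path ξ ω) κ γ 0 (T + t) ^ p
      ≤ E * (totalMass (path ξ ω) κ γ 0 t ^ p
          * g ((∫ s in (0 : ℝ)..T, shift t 0 (path ξ ω) s.toNNReal 0) - ρ * T))
        + ENNReal.ofReal (Real.exp (γ * (M * T) * p))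
          * ∑' y, W y ^ p * totalMass (path ξ ω) κ γ y t ^ p := by
    filter_upwards [h.ae_locInt, h.ae_forall_ae_le hbd] with ω hv hle
    have h1 := hv.totalMass_add_le hκ hγ 0 (s := t) (t := T) t.coe_nonneg T.coe_nonneg
      fun y => (hle y).mono fun r hr _ => hr
    have hJ : (∫ s in (0 : ℝ)..T, shift t 0 (path ξ ω) s.toNNReal 0) ≤ M * T :=
      hv.integral_shift_le (hle 0) t T
    refine (ENNReal.rpow_le_rpow h1 hp.le).trans ((ENNReal.rpow_add_le_add_rpow _ _ hp.le
      hp1).trans ?_)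
    rw [ENNReal.mul_rpow_of_nonneg _ _ hp.le, ENNReal.mul_rpow_of_nonneg _ _ hp.le, hpow, hpow,
      Real.toNNReal_coe]
    refine add_le_add (le_of_eq ?_) ?_
    · rw [hg, hE]
      simp only
      rw [min_eq_left (by linarith), mul_left_comm, ← ENNReal.ofReal_mul (by positivity),
        ← Real.exp_add, mul_comm]
      congr 3
      ring
    · gcongr
      -- Since `p ≤ 1`, the power passes inside the sum over landing sites, which by stationarity
      -- all have the same moment.
      refine (rpow_tsum_le_tsum_rpow _ hp hp1).trans (le_of_eq (tsum_congr fun y => ?_))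
      rw [ENNReal.mul_rpow_of_nonneg _ _ hp.le, zero_add]
  have hmeas : ∀ y, AEMeasurable (fun ω => totalMass (path ξ ω) κ γ y t ^ p) P := fun y =>
    ((h.isPathFunctional_totalMass hκ γ y t.coe_nonneg).aemeasurable h.measurable).pow_const p
  have hy : ∀ y, ∫⁻ ω, totalMass (path ξ ω) κ γ y t ^ p ∂P = a := by
    intro y
    have := ((h.isPathFunctional_totalMass hκ γ 0 t.coe_nonneg).identDistrib h 0 y).comp
      (u := fun z : ℝ≥0∞ => z ^ p) (by fun_prop)
    have := this.lintegral_eq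
    simpa [Function.comp_def, totalMass_shift_zero] using this
  have hJm : AEMeasurable (fun ω => ∫ s in (0 : ℝ)..T, shift t 0 (path ξ ω) s.toNNReal 0) P :=
    ((h.isPathFunctional_integral 0 T.coe_nonneg).comp_shift t 0).aemeasurable h.measurable
  have hgJ : AEMeasurable (fun ω =>
      g ((∫ s in (0 : ℝ)..T, shift t 0 (path ξ ω) s.toNNReal 0) - ρ * T)) P :=
    hgm.comp_aemeasurable (hJm.sub_const _)
  have hprod : AEMeasurable (fun ω => totalMass (path ξ ω) κ γ 0 t ^ p
      * g ((∫ s in (0 : ℝ)..T, shift t 0 (path ξ ω) s.toNNReal 0) - ρ * T)) P :=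
    (hmeas 0).mul hgJ
  refine (lintegral_mono_ae hpt).trans ?_
  rw [lintegral_add_left' (hprod.const_mul _), lintegral_const_mul'' _ hprod,
    lintegral_const_mul' _ _ (by simp), lintegral_tsum
    fun y => (hmeas y).const_mul _]
  have h2 : ∀ y, ∫⁻ ω, W y ^ p * totalMass (path ξ ω) κ γ y t ^ p ∂P = W y ^ p * a := by
    intro y
    rw [lintegral_const_mul'' _ (hmeas y), hy]
  have hm0 : 0 ≤ 2 * d * κ * T := by positivity
  have h3 : ∑' y, W y ^ p ≤ ENNReal.ofReal ((2 * d * κ * T) ^ p) * (2 * 4 ^ d) :=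
    tsum_walkLaw_rpow_le rfl hm0 hp hmp
  have h4 := hM.lintegral_mul_le h hκ γ p ρ t T hgm hb
  simp only [h2]
  rw [ENNReal.tsum_mul_right]
  calc _ ≤ E * (ENNReal.ofReal b * a) + ENNReal.ofReal (Real.exp (γ * (M * T) * p))
        * (ENNReal.ofReal ((2 * d * κ * T) ^ p) * (2 * 4 ^ d) * a) := by gcongr
    _ = _ := by
      have e1 : (2 * 4 ^ d : ℝ≥0∞) = ENNReal.ofReal (2 * 4 ^ d) := by
        rw [ENNReal.ofReal_mul (by norm_num), ENNReal.ofReal_pow (by norm_num)]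
        norm_num
      rw [e1, ← mul_assoc, ← mul_assoc, ← ENNReal.ofReal_mul (by positivity),
        ← ENNReal.ofReal_mul (by positivity), ← ENNReal.ofReal_mul (by positivity), ← add_mul,
        ← ENNReal.ofReal_add (by positivity) (by positivity)]
      congr 2
      rw [mul_add, Real.mul_rpow (Real.exp_nonneg _) hm0, ← Real.exp_mul]
      have e2 : γ * (M * T) * p = p * γ * (ρ * T) + γ * ((M - ρ) * T) * p := by ring
      rw [e2, Real.exp_add]
      ring

/-- Mean superadditivity bounds the Lyapunov exponent along multiples of a fixed time. -/
lemma IsEnvironment.lyapunov_le_of_forall (h : IsEnvironment P ξ) {κ γ l T : ℝ} (hκ : 0 ≤ κ)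
    (hγ : 0 ≤ γ) (hT : 0 < T)
    (hl : ∀ n : ℕ, ∫ ω, logSol (path ξ ω) κ γ (n * T) ∂P ≤ l * (n * T)) :
    lyapunov P ξ γ κ ≤ l := by
  set G : ℝ → ℝ := fun t => ∫ ω, logSol (path ξ ω) κ γ t ∂P with hG
  have hfin := h.ae_pamSol_lt_top hκ hγ 0 0
  simp only [shift_zero] at hfin
  have hadd : ∀ s t : ℝ, 0 ≤ s → 0 ≤ t → G s + G t ≤ G (s + t) := by
    intro s t hs ht
    have hid := (h.isField.isPathFunctional_logSol hκ γ ht).identDistrib h.isField s.toNNReal 0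
    have hi := hid.symm.integrable_snd (h.integrable_logSol hκ hγ ht)
    rw [hG]
    simp only
    rw [← hid.integral_eq, ← integral_add (h.integrable_logSol hκ hγ hs) hi]
    refine integral_mono_ae ((h.integrable_logSol hκ hγ hs).add hi)
      (h.integrable_logSol hκ hγ (add_nonneg hs ht)) ?_
    filter_upwards [hfin, h.isField.ae_locInt] with ω h1 hv
    exact hv.logSol_add_le hκ hs ht (h1 _ (add_nonneg hs ht))
  set D : ℝ := 2 * d * κ + |γ * density P ξ| with hD
  have hD0 : 0 ≤ D := by positivity
  have hlow : ∀ t : ℝ, 0 ≤ t → -(D * t) ≤ G t := by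
    intro t ht
    have hi := h.isField.integral_integral 0 ht
    have h1 : ∫ ω, (-(2 * d * κ * t) + γ * ∫ s in (0 : ℝ)..t, ξ s.toNNReal ω 0) ∂P ≤ G t := by
      refine integral_mono_ae ((integrable_const _).add (hi.1.const_mul _))
        (h.integrable_logSol hκ hγ ht) ?_
      filter_upwards [hfin] with ω h1
      exact logSol_ge hκ ht (h1 t ht)
    rw [integral_add (integrable_const _) (hi.1.const_mul _), integral_const_mul, hi.2] at h1
    simp only [integral_const, probReal_univ, smul_eq_mul, one_mul] at h1
    have h2 := mul_le_mul_of_nonneg_right (neg_abs_le (γ * density P ξ)) ht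
    rw [hD]
    linarith
  have hmul : ∀ (k : ℕ) (s : ℝ), 0 ≤ s → k * G s ≤ G (k * s) := by
    intro k s hs
    induction k with
    | zero =>
      have := hlow 0 le_rfl
      simpa using this
    | succ k ih =>
      have := hadd (k * s) s (by positivity) hs
      push_cast
      rw [add_mul, add_mul, one_mul, one_mul]
      linarith
  refine csSup_le (nonempty_Ioi.image _) ?_
  rintro _ ⟨s, hs, rfl⟩
  have hs0 : (0 : ℝ) < s := hs
  simp only
  rw [div_le_iff₀ hs0]
  have key : ∀ k : ℕ, (G s - l * s) * k ≤ (|l| + D) * T := by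
    intro k
    set n := ⌈k * s / T⌉₊
    have h1 := Nat.le_ceil (k * s / T)
    have h2 := (Nat.ceil_lt_add_one (show 0 ≤ k * s / T by positivity)).le
    rw [div_le_iff₀ hT] at h1
    have h3 : n * T ≤ k * s + T := by
      have := mul_le_mul_of_nonneg_right h2 hT.le
      rwa [add_mul, div_mul_cancel₀ _ hT.ne', one_mul] at this
    have h4 := hadd (k * s) (n * T - k * s) (by positivity) (by linarith)
    rw [add_sub_cancel] at h4
    have h5 := hlow (n * T - k * s) (by linarith)
    have h6 : D * (n * T - k * s) ≤ D * T := by gcongr; linarith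
    have h7 := hl n
    have h8 : l * (n * T - k * s) ≤ |l| * T := by
      calc _ ≤ |l| * (n * T - k * s) :=
            mul_le_mul_of_nonneg_right (le_abs_self l) (by linarith)
        _ ≤ _ := by gcongr; linarith
    have h9 := hmul k s hs0.le
    change G (n * T) ≤ _ at h7
    linarith
  by_contra! hc
  obtain ⟨k, hk⟩ := exists_nat_gt ((|l| + D) * T / (G s - l * s))
  rw [div_lt_iff₀ (by linarith)] at hk
  have := key k
  linarith

/-- An upper bound for the Lyapunov exponent through fractional moments. -/
lemma IsMarkovProcess.lyapunov_le (hM : IsMarkovProcess P ξ S Pstart)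
    (h : IsEnvironment P ξ) {κ γ p ρ M b T : ℝ} (hκ : 0 ≤ κ) (hγ : 0 ≤ γ) (hp : 0 < p) (hp1 : p ≤ 1)
    (hbd : ∀ (t : ℝ≥0) (x : Site d), ∀ᵐ ω ∂P, ξ t ω x ≤ M) (hT : 0 < T)
    (hmp : (2 * d * κ * T) ^ p ≤ 1 / 2) (hb0 : 1 ≤ b)
    (hb : ∀ η, ∫⁻ ω, ENNReal.ofReal (Real.exp (p * γ * min (cumulative ξ ρ 0 T ω) ((M - ρ) * T)))
      ∂(Pstart η) ≤ ENNReal.ofReal b) :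
    lyapunov P ξ γ κ - ρ * γ ≤ (Real.log b + 2 * 4 ^ d
        * (Real.exp (γ * ((M - ρ) * T)) * (2 * d * κ * T)) ^ p) / (p * T) := by
  set r := 2 * 4 ^ d * (Real.exp (γ * ((M - ρ) * T)) * (2 * d * κ * T)) ^ p with hr
  have hr0 : 0 ≤ r := by positivity
  set β := Real.exp (p * γ * (ρ * T)) * (b + r) with hβ
  have hβ0 : 0 < β := by positivity
  have hpT : 0 < p * T := by positivity
  have hlogβ : Real.log β ≤ p * γ * (ρ * T) + (Real.log b + r) := by
    rw [hβ, Real.log_mul (Real.exp_pos _).ne' (by positivity), Real.log_exp]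
    gcongr
    have h1 : b + r ≤ b * Real.exp r := by
      have := Real.add_one_le_exp r
      nlinarith
    calc _ ≤ Real.log (b * Real.exp r) := Real.log_le_log (by positivity) h1
      _ = _ := by rw [Real.log_mul (by positivity) (Real.exp_pos _).ne', Real.log_exp]
  suffices hmain : lyapunov P ξ γ κ ≤ Real.log β / (p * T) by
    rw [sub_le_iff_le_add]
    refine hmain.trans ?_
    rw [div_add' _ _ _ hpT.ne']
    gcongr
    linarith
  refine h.lyapunov_le_of_forall hκ hγ hT fun n => ?_
  lift T to ℝ≥0 using hT.le
  have hmom : ∀ n : ℕ, ∫⁻ ω, totalMass (path ξ ω) κ γ 0 (n * T) ^ p ∂P ≤ ENNReal.ofReal (β ^ n) := by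
    intro n
    induction n with
    | zero => simp [totalMass_zero]
    | succ n ih =>
      have h1 := hM.lintegral_totalMass_add_le h.isField hκ hγ hp hp1 hbd hmp (by linarith) hb
        (n * T)
      have e1 : ((n + 1 : ℕ) : ℝ) * T = T + ((n * T : ℝ≥0) : ℝ) := by push_cast; ring
      rw [e1]
      refine h1.trans ?_
      rw [pow_succ', ENNReal.ofReal_mul hβ0.le]
      gcongr
      simpa using ih
  have hnT : (0 : ℝ) ≤ n * T := by positivity
  have hβn : 0 < β ^ n := by positivity
  have hfin := h.ae_pamSol_lt_top hκ hγ 0 0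
  simp only [shift_zero] at hfin
  set Y : Ω → ℝ≥0∞ := fun ω => totalMass (path ξ ω) κ γ 0 (n * T) ^ p with hY
  have hYm : AEMeasurable Y P :=
    ((h.isField.isPathFunctional_totalMass hκ γ 0 hnT).aemeasurable h.measurable).pow_const p
  have hYlt : ∫⁻ ω, Y ω ∂P ≠ ⊤ := ((hmom n).trans_lt ENNReal.ofReal_lt_top).ne
  have hYint : Integrable (fun ω => (Y ω).toReal) P := integrable_toReal_of_lintegral_ne_top hYm hYlt
  have hYval : ∫ ω, (Y ω).toReal ∂P ≤ β ^ n := by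
    rw [integral_toReal hYm (ae_lt_top' hYm hYlt)]
    exact ENNReal.toReal_le_of_le_ofReal hβn.le (hmom n)
  have hpt : ∀ᵐ ω ∂P, p * logSol (path ξ ω) κ γ (n * T)
      ≤ (Y ω).toReal / β ^ n + (n * Real.log β - 1) := by
    filter_upwards [hfin, ae_lt_top' hYm hYlt] with ω h1 h2
    have h3 := pamSol_zero_pos (v := path ξ ω) (γ := γ) hκ hnT
    have h4 := (h1 _ hnT).ne
    have h5 := pamSol_le_totalMass (path ξ ω) κ γ 0 (n * T)
    have h6 : 0 < (pamSol (path ξ ω) κ γ 0 (n * T)).toReal := ENNReal.toReal_pos h3.ne' h4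
    have h7 : (pamSol (path ξ ω) κ γ 0 (n * T)).toReal ^ p ≤ (Y ω).toReal := by
      rw [ENNReal.toReal_rpow]
      exact ENNReal.toReal_mono h2.ne (ENNReal.rpow_le_rpow h5 hp.le)
    have h8 : 0 < (Y ω).toReal := (Real.rpow_pos_of_pos h6 p).trans_le h7
    have h9 : p * logSol (path ξ ω) κ γ (n * T) ≤ Real.log (Y ω).toReal := by
      rw [logSol, ← Real.log_rpow h6]
      exact Real.log_le_log (Real.rpow_pos_of_pos h6 p) h7
    -- `log x ≤ x - 1` at `x = Y / β ^ n` takes the place of Jensen's inequality.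
    have h10 := Real.log_le_sub_one_of_pos (div_pos h8 hβn)
    rw [Real.log_div h8.ne' hβn.ne', Real.log_pow] at h10
    linarith
  have hfinal := integral_mono_ae ((h.integrable_logSol hκ hγ hnT).const_mul p)
    ((hYint.div_const _).add (integrable_const _)) hpt
  rw [integral_const_mul] at hfinal
  have hval : ∫ ω, ((Y ω).toReal / β ^ n + (n * Real.log β - 1)) ∂P
      = (∫ ω, (Y ω).toReal ∂P) / β ^ n + (n * Real.log β - 1) := by
    rw [integral_add (hYint.div_const _) (integrable_const _), integral_div]
    simp
  have h11 : (∫ ω, (Y ω).toReal ∂P) / β ^ n ≤ 1 := (div_le_one hβn).2 hYval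
  have h12 : p * ∫ ω, logSol (path ξ ω) κ γ (n * T) ∂P ≤ n * Real.log β := by
    have := hfinal.trans_eq hval
    linarith
  have h13 : Real.log β / (p * T) * (n * T) = n * Real.log β / p := by
    have : (T : ℝ) ≠ 0 := hT.ne'
    field_simp
  rw [h13, le_div_iff₀ hp]
  linarith

end MomentRecursion

/-! ### The upper bounds for small diffusivity. -/

section UpperBounds

variable {d : ℕ} [NeZero d] {Ω : Type*} [MeasurableSpace Ω]
  {P : Measure Ω} [IsProbabilityMeasure P] {ξ : ℝ≥0 → Ω → Config d}
  {S : Set (Config d)} {Pstart : Kernel S Ω}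

lemma eventually_mul_le_exp (a : ℝ) : ∀ᶠ x : ℝ in atTop, a * x ≤ Real.exp (x / 4) := by
  filter_upwards [eventually_ge_atTop (32 * a), eventually_ge_atTop 0] with x h1 h2
  have := Real.quadratic_le_exp_of_nonneg (show 0 ≤ x / 4 by linarith)
  nlinarith

/-- The fractional moment bound with a time horizon proportional to `log (1 / κ)`. -/
lemma IsMarkovProcess.eventually_lyapunov_le (hM : IsMarkovProcess P ξ S Pstart)
    (h : IsEnvironment P ξ) {γ ρ M : ℝ} (hγ : 0 ≤ γ) (hρ : ρ ≤ M)
    (hbd : ∀ (t : ℝ≥0) (x : Site d), ∀ᵐ ω ∂P, ξ t ω x ≤ M) :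
    ∃ c > 0, ∀ᶠ κ : ℝ in 𝓝[>] 0, ∀ p b T : ℝ, 0 < p → p ≤ 1 → 4 ≤ p * Real.log (1 / κ) → 1 ≤ b →
      T = c * Real.log (1 / κ) →
      (∀ η, ∫⁻ ω, ENNReal.ofReal (Real.exp (p * γ * min (cumulative ξ ρ 0 T ω) ((M - ρ) * T)))
        ∂(Pstart η) ≤ ENNReal.ofReal b) →
      lyapunov P ξ γ κ - ρ * γ ≤ (Real.log b + 2 * 4 ^ d * Real.exp (-(p * Real.log (1 / κ) / 4)))
        / (p * T) := by
  have hΓ : 0 ≤ γ * (M - ρ) := mul_nonneg hγ (sub_nonneg.2 hρ)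
  -- For this `c`, `exp (γ (M - ρ) T) ≤ κ^{-1/2}`, while `2dκT ≤ κ^{3/4}` for small `κ`: a block
  -- with a jump is worth at most `κ^{1/4}` before the power `p` is taken.
  set c : ℝ := 1 / (2 * (γ * (M - ρ)) + 2) with hc
  have hc0 : 0 < c := by positivity
  have hcΓ : γ * (M - ρ) * c ≤ 1 / 2 := by
    rw [hc, mul_one_div, div_le_div_iff₀ (by positivity) (by norm_num)]
    linarith
  refine ⟨c, hc0, ?_⟩
  have hpos : ∀ᶠ κ : ℝ in 𝓝[>] 0, 0 < κ := self_mem_nhdsWithin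
  filter_upwards [hpos, tendsto_log_one_div.eventually (eventually_mul_le_exp (2 * d * c)),
    tendsto_log_one_div.eventually_gt_atTop 0] with κ hκ h1 hL p b T hp hp1 hpL hb1 hT hb
  have hκL : κ = Real.exp (-Real.log (1 / κ)) := by
    rw [one_div, Real.log_inv, neg_neg, Real.exp_log hκ]
  set L := Real.log (1 / κ)
  have hT0 : 0 < T := by rw [hT]; positivity
  have hm : 2 * d * κ * T ≤ Real.exp (-(3 / 4 * L)) := by
    have e : Real.exp (-(3 / 4 * L)) = Real.exp (L / 4) * κ := by
      rw [hκL, ← Real.exp_add]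
      congr 1
      ring
    rw [e, hT]
    calc 2 * d * κ * (c * L) = 2 * d * c * L * κ := by ring
      _ ≤ _ := by gcongr
  have hm0 : 0 ≤ 2 * d * κ * T := by positivity
  have hsmall : Real.exp (-(p * L / 4)) ≤ 1 / 2 := by
    have h2 := Real.add_one_le_exp (p * L / 4)
    rw [Real.exp_neg, one_div]
    gcongr
    linarith
  have hr1 : (2 * d * κ * T) ^ p ≤ 1 / 2 := by
    calc _ ≤ Real.exp (-(3 / 4 * L)) ^ p := by gcongr
      _ = Real.exp (-(3 / 4 * (p * L))) := by rw [← Real.exp_mul]; congr 1; ring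
      _ ≤ Real.exp (-(p * L / 4)) := Real.exp_le_exp.2 (by linarith)
      _ ≤ _ := hsmall
  have hr2 : (Real.exp (γ * ((M - ρ) * T)) * (2 * d * κ * T)) ^ p ≤ Real.exp (-(p * L / 4)) := by
    have h3 : γ * ((M - ρ) * T) ≤ 1 / 2 * L := by
      rw [hT]
      calc _ = γ * (M - ρ) * c * L := by ring
        _ ≤ _ := by gcongr
    calc _ ≤ (Real.exp (1 / 2 * L) * Real.exp (-(3 / 4 * L))) ^ p := by gcongr
      _ = _ := by
        rw [← Real.exp_add, ← Real.exp_mul]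
        congr 1
        ring
  refine (hM.lyapunov_le h hκ.le hγ hp hp1 hbd hT0 hr1 hb1 hb).trans ?_
  gcongr

lemma limsup_coe_lt_top {F : Filter ℝ} {f : ℝ → ℝ} {C : ℝ} (h : ∀ᶠ x in F, f x ≤ C) :
    limsup (fun x => (f x : EReal)) F < ⊤ :=
  (limsup_le_of_le (by isBoundedDefault) (h.mono fun _ hx => EReal.coe_le_coe_iff.2 hx)).trans_lt
    (EReal.coe_lt_top C)

lemma IsBoundedAbove.exists_ge (h : IsBoundedAbove P ξ) (ρ : ℝ) :
    ∃ M, ρ ≤ M ∧ ∀ (t : ℝ≥0) (x : Site d), ∀ᵐ ω ∂P, ξ t ω x ≤ M := by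
  obtain ⟨M, hM⟩ := h
  exact ⟨max ρ M, le_max_left _ _, fun t x => (hM t x).mono fun _ hω => hω.trans (le_max_right _ _)⟩

/-- The upper bound for the Lyapunov exponent under exponential moment bounds. -/
theorem IsMarkovProcess.limsup_lt_top_of_exp (hM : IsMarkovProcess P ξ S Pstart)
    (h : IsEnvironment P ξ) {γ : ℝ} (hγ : 0 < γ) (hbd : IsBoundedAbove P ξ)
    (hdev : ExpDeviationCondition ξ (density P ξ) Pstart) :
    limsup (fun κ : ℝ => ((Real.log (1 / κ) / Real.log (Real.log (1 / κ))
      * (lyapunov P ξ γ κ - density P ξ * γ) : ℝ) : EReal)) (𝓝[>] 0) < ⊤ := by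
  set ρ := density P ξ
  obtain ⟨M, hρM, hMbd⟩ := hbd.exists_ge ρ
  obtain ⟨c₀, hc₀, hev⟩ := hM.eventually_lyapunov_le h hγ.le hρM hMbd
  obtain ⟨c, hc⟩ := hdev
  refine limsup_coe_lt_top (C := 4 * |c| * γ ^ 2 + 2 * 4 ^ d / (4 * c₀)) ?_
  have hLL := Real.tendsto_log_atTop.comp tendsto_log_one_div
  have hlo := (Real.isLittleO_log_id_atTop.bound (show (0 : ℝ) < 1 / 4 by norm_num))
  filter_upwards [hev, tendsto_log_one_div.eventually_gt_atTop 0, hLL.eventually_ge_atTop 1,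
    hLL.eventually_ge_atTop (1 / (4 * γ * c₀)), tendsto_log_one_div.eventually hlo]
    with κ h1 hL hl hl2 hl3
  simp only [Function.comp_apply] at hl hl2
  set L := Real.log (1 / κ)
  set l := Real.log L with hlL
  have hl0 : 0 < l := by linarith
  simp only [id, Real.norm_eq_abs] at hl3
  rw [abs_of_pos hl0, abs_of_pos hL] at hl3
  have hμT : 1 ≤ 4 * l / L * γ * (c₀ * L) := by
    have e : 4 * l / L * γ * (c₀ * L) = l * (4 * γ * c₀) := by field_simp
    rw [e, ← div_le_iff₀ (by positivity)]
    exact hl2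
  have hpL : 4 * l / L * L = 4 * l := by field_simp
  -- With `p = 4 log log(1/κ) / log(1/κ)` the jump term `κ^{p/4}` equals `1 / log(1/κ)`, and `log b
  -- / (p T) = |c| γ² p`.
  have h2 := h1 (4 * l / L) (Real.exp (|c| * (4 * l / L * γ) ^ 2 * (c₀ * L))) (c₀ * L)
    (by positivity) (by rw [div_le_one hL]; linarith) (by rw [hpL]; linarith)
    (Real.one_le_exp (by positivity)) rfl (fun η => by
      refine le_trans (lintegral_mono fun ω => ?_) ((le_iSup (fun η : S => ∫⁻ ω, ENNReal.ofReal
        (Real.exp (4 * l / L * γ * cumulative ξ ρ 0 (c₀ * L) ω)) ∂(Pstart η)) η).trans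
        ((hc (4 * l / L * γ) (c₀ * L) (by positivity) (by positivity) hμT).trans ?_))
      · refine ENNReal.ofReal_le_ofReal (Real.exp_le_exp.2 ?_)
        gcongr
        exact min_le_left _ _
      · refine ENNReal.ofReal_le_ofReal (Real.exp_le_exp.2 ?_)
        gcongr
        exact le_abs_self c)
  have e1 : Real.exp (-(4 * l / L * L / 4)) = 1 / L := by
    rw [hpL, mul_div_cancel_left₀ _ (by norm_num), Real.exp_neg, hlL, Real.exp_log hL, one_div]
  rw [e1, Real.log_exp] at h2
  calc L / l * (lyapunov P ξ γ κ - ρ * γ)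
      ≤ L / l * ((|c| * (4 * l / L * γ) ^ 2 * (c₀ * L) + 2 * 4 ^ d * (1 / L))
        / (4 * l / L * (c₀ * L))) := by gcongr
    _ = 4 * |c| * γ ^ 2 + 2 * 4 ^ d / (4 * c₀) / l ^ 2 := by field_simp
    _ ≤ _ := add_le_add_right (div_le_self (by positivity) (one_le_pow₀ hl)) _

/-- Any real number strictly between the negative limsup and `0` serves as `-δ`. -/
lemma WeakDeviationCondition.exists_le {ρ : ℝ} (h : WeakDeviationCondition ξ ρ Pstart) :
    ∃ δ > 0, ∀ᶠ t : ℝ in atTop, ∀ η, Pstart η {ω | t ^ (5 / 6 : ℝ) < cumulative ξ ρ 0 t ω}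
      ≤ ENNReal.ofReal (Real.exp (-(δ * t ^ (2 / 3 : ℝ)))) := by
  obtain ⟨a, ha, ha0⟩ := EReal.lt_iff_exists_real_btwn.1 h
  refine ⟨-a, by simpa using (EReal.coe_lt_coe_iff.1 ha0), ?_⟩
  filter_upwards [eventually_lt_of_limsup_lt ha, eventually_gt_atTop 0] with t h1 ht η
  have hx : (0 : EReal) < ((t ^ (2 / 3 : ℝ) : ℝ) : EReal) := by
    exact_mod_cast Real.rpow_pos_of_pos ht _
  have h2 := (EReal.div_le_iff_le_mul hx (EReal.coe_ne_top _)).1 h1.le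
  have h3 := EReal.exp_monotone h2
  rw [ENNReal.exp_log, ← EReal.coe_mul, EReal.exp_coe] at h3
  refine (le_iSup (fun η : S => Pstart η {ω | t ^ (5 / 6 : ℝ) < cumulative ξ ρ 0 t ω}) η).trans
    (h3.trans_eq ?_)
  congr 2
  ring

/-- The upper bound for the Lyapunov exponent under a weak deviation bound. -/
theorem IsMarkovProcess.limsup_lt_top_of_weak (hM : IsMarkovProcess P ξ S Pstart)
    (h : IsEnvironment P ξ) {γ : ℝ} (hγ : 0 < γ) (hbd : IsBoundedAbove P ξ)
    (hdev : WeakDeviationCondition ξ (density P ξ) Pstart) :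
    limsup (fun κ : ℝ => ((Real.log (1 / κ) ^ (1 / 6 : ℝ)
      * (lyapunov P ξ γ κ - density P ξ * γ) : ℝ) : EReal)) (𝓝[>] 0) < ⊤ := by
  have := hM.isMarkovKernel
  set ρ := density P ξ
  obtain ⟨M, hρM, hMbd⟩ := hbd.exists_ge ρ
  obtain ⟨c₀, hc₀, hev⟩ := hM.eventually_lyapunov_le h hγ.le hρM hMbd
  obtain ⟨δ, hδ, hdev⟩ := hdev.exists_le
  have hD : 0 ≤ γ * (M - ρ) := mul_nonneg hγ.le (sub_nonneg.2 hρM)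
  -- Ensures `α γ (M - ρ) ≤ δ`, so that the largest weight on the deviation event is offset by its
  -- probability; the `1` keeps the denominator positive.
  set α : ℝ := δ / (γ * (M - ρ) + 1) with hα
  have hα0 : 0 < α := by positivity
  have hαD : α * (γ * (M - ρ)) ≤ δ := by
    rw [hα, div_mul_eq_mul_div, div_le_iff₀ (by positivity)]
    nlinarith
  set C : ℝ := Real.log 2 + 2 * 4 ^ d with hC
  have hC0 : 0 < C := by have := Real.log_pos one_lt_two; positivity
  set k : ℝ := (1 / c₀) ^ (1 / 6 : ℝ) with hk
  have hk0 : 0 < k := by positivity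
  refine limsup_coe_lt_top (C := k * (γ + C / α)) ?_
  have hT := tendsto_log_one_div.const_mul_atTop hc₀
  have hy := (tendsto_rpow_atTop (show (0 : ℝ) < 1 / 6 by norm_num)).comp hT
  filter_upwards [hev, hT.eventually hdev, hT.eventually_gt_atTop 0, hy.eventually_ge_atTop 1,
    hy.eventually_ge_atTop α, hy.eventually_ge_atTop (4 * c₀ / α)] with κ h1 h2 hT0 hy1 hy2 hy3
  simp only [Function.comp_apply] at hy1 hy2 hy3
  set L := Real.log (1 / κ)
  set T := c₀ * L with hTL
  set y := T ^ (1 / 6 : ℝ) with hyT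
  have hy0 : 0 < y := by linarith
  have hpow : ∀ n : ℕ, T ^ ((n : ℝ) / 6) = y ^ n := fun n => by
    rw [hyT, ← Real.rpow_natCast, ← Real.rpow_mul hT0.le]
    congr 1
    ring
  have hT6 : T = y ^ 6 := by
    rw [← hpow]; norm_num
  have hT5 : T ^ (5 / 6 : ℝ) = y ^ 5 := by
    rw [← hpow]; norm_num
  have hT4 : T ^ (2 / 3 : ℝ) = y ^ 4 := by
    rw [← hpow]; norm_num
  have hLT : L = 1 / c₀ * T := by rw [hTL]; field_simp
  have hL6 : L ^ (1 / 6 : ℝ) = k * y := by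
    rw [hLT, Real.mul_rpow (by positivity) hT0.le]
  rw [hT5, hT4] at h2
  have hy4 : y ≤ y ^ 2 := by nlinarith
  have hy5 : y ≤ y ^ 4 := by nlinarith [pow_pos hy0 2, pow_pos hy0 3]
  -- With `y = T^{1/6}` and `p = α T^{-1/3}`, the exponent is at most `p γ T^{5/6} = α γ y³` off the
  -- deviation event. On it the cap gives at most `δ T^{2/3}`, offset by the probability `exp (-δ
  -- T^{2/3})`. So `log b / (p T)` is of order `1 / y`.
  have h3 := h1 (α / y ^ 2) (2 * Real.exp (α * γ * y ^ 3)) T (by positivity)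
    (by rw [div_le_one (by positivity)]; linarith) (by
      have e : α / y ^ 2 * L = α / c₀ * y ^ 4 := by rw [hLT, hT6]; field_simp
      rw [e, div_mul_eq_mul_div, le_div_iff₀ hc₀]
      rw [div_le_iff₀ hα0] at hy3
      nlinarith) (by
      have := Real.one_le_exp (show 0 ≤ α * γ * y ^ 3 by positivity)
      linarith) rfl (fun η => by
      set A : Set Ω := {ω | y ^ 5 < cumulative ξ ρ 0 T ω} with hA
      have hpt : ∀ ω, ENNReal.ofReal (Real.exp (α / y ^ 2 * γ
          * min (cumulative ξ ρ 0 T ω) ((M - ρ) * T)))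
          ≤ ENNReal.ofReal (Real.exp (α * γ * y ^ 3))
            + A.indicator (fun _ => ENNReal.ofReal (Real.exp (δ * y ^ 4))) ω := by
        intro ω
        by_cases hω : ω ∈ A
        · rw [indicator_of_mem hω]
          refine le_trans (ENNReal.ofReal_le_ofReal (Real.exp_le_exp.2 ?_)) le_add_self
          calc _ ≤ α / y ^ 2 * γ * ((M - ρ) * T) := by gcongr; exact min_le_right _ _
            _ = α * (γ * (M - ρ)) * y ^ 4 := by rw [hT6]; field_simp
            _ ≤ _ := by gcongr
        · rw [indicator_of_notMem hω, add_zero]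
          refine ENNReal.ofReal_le_ofReal (Real.exp_le_exp.2 ?_)
          have hω' : cumulative ξ ρ 0 T ω ≤ y ^ 5 := not_lt.1 hω
          calc _ ≤ α / y ^ 2 * γ * y ^ 5 := by gcongr; exact (min_le_left _ _).trans hω'
            _ = _ := by field_simp
      refine (lintegral_mono hpt).trans ?_
      rw [lintegral_add_left measurable_const, lintegral_const, measure_univ, mul_one]
      refine (add_le_add le_rfl ((lintegral_indicator_const_le _ _).trans
        (mul_le_mul_right (h2 η) _))).trans ?_
      rw [← ENNReal.ofReal_mul (Real.exp_nonneg _), ← Real.exp_add,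
        ← ENNReal.ofReal_add (Real.exp_nonneg _) (Real.exp_nonneg _)]
      refine ENNReal.ofReal_le_ofReal ?_
      rw [add_neg_cancel, Real.exp_zero]
      have := Real.one_le_exp (show 0 ≤ α * γ * y ^ 3 by positivity)
      linarith)
  have hexp : Real.exp (-(α / y ^ 2 * L / 4)) ≤ 1 := by
    rw [Real.exp_le_one_iff]
    have : 0 ≤ α / y ^ 2 * L := by rw [hLT]; positivity
    linarith
  rw [Real.log_mul two_ne_zero (Real.exp_pos _).ne', Real.log_exp] at h3
  have h4 : lyapunov P ξ γ κ - ρ * γ ≤ (α * γ * y ^ 3 + C) / (α * y ^ 4) := by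
    refine h3.trans ?_
    have e : α / y ^ 2 * T = α * y ^ 4 := by rw [hT6]; field_simp
    rw [e]
    refine div_le_div_of_nonneg_right ?_ (by positivity)
    have : (2 * 4 ^ d : ℝ) * Real.exp (-(α / y ^ 2 * L / 4)) ≤ 2 * 4 ^ d :=
      mul_le_of_le_one_right (by positivity) hexp
    rw [hC]
    linarith
  rw [hL6]
  calc k * y * (lyapunov P ξ γ κ - ρ * γ) ≤ k * y * ((α * γ * y ^ 3 + C) / (α * y ^ 4)) := by gcongr
    _ = k * (γ + C / α / y ^ 3) := by field_simp
    _ ≤ _ := mul_le_mul_of_nonneg_left (add_le_add_right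
      (div_le_self (by positivity) (one_le_pow₀ hy1)) _) hk0.le

end UpperBounds

end PAM

end

theorem theorem3 {d : ℕ} [NeZero d] {Ω : Type*} [MeasurableSpace Ω]
    (P : Measure Ω) [IsProbabilityMeasure P] (ξ : ℝ≥0 → Ω → PAM.Config d)
    (hξ : PAM.IsEnvironment P ξ) (γ : ℝ) (hγ : 0 < γ) :
    ∃ lam : ℝ → ℝ,
      (∀ κ : ℝ, 0 < κ → PAM.IsQuenchedLyapunov P ξ γ κ (lam κ)) ∧
      (∀ e : PAM.Site d, PAM.IsNeighborOfZero e → PAM.MomentCondition P ξ e →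
        PAM.IsBoundedBelow P ξ →
        0 < liminf (fun κ : ℝ =>
          ((Real.log (1 / κ) * (lam κ - PAM.density P ξ * γ) : ℝ) : EReal)) (𝓝[>] 0)) ∧
      (∀ (S : Set (PAM.Config d)) (Pstart : Kernel S Ω),
        PAM.IsMarkovProcess P ξ S Pstart → PAM.IsBoundedAbove P ξ →
        PAM.WeakDeviationCondition ξ (PAM.density P ξ) Pstart →
        limsup (fun κ : ℝ =>
          ((Real.log (1 / κ) ^ (1 / 6 : ℝ) * (lam κ - PAM.density P ξ * γ) : ℝ) : EReal))
          (𝓝[>] 0) < ⊤) ∧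
      (∀ (S : Set (PAM.Config d)) (Pstart : Kernel S Ω),
        PAM.IsMarkovProcess P ξ S Pstart → PAM.IsBoundedAbove P ξ →
        PAM.ExpDeviationCondition ξ (PAM.density P ξ) Pstart →
        limsup (fun κ : ℝ =>
          ((Real.log (1 / κ) / Real.log (Real.log (1 / κ))
            * (lam κ - PAM.density P ξ * γ) : ℝ) : EReal)) (𝓝[>] 0) < ⊤) :=
  ⟨PAM.lyapunov P ξ γ, fun _ hκ => hξ.isQuenchedLyapunov hκ hγ.le,
    fun _ he hmom _ => hξ.liminf_lyapunov_pos hγ he hmom,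
    fun _ _ hM hbd hdev => hM.limsup_lt_top_of_weak hξ hγ hbd hdev,
    fun _ _ hM hbd hdev => hM.limsup_lt_top_of_exp hξ hγ hbd hdev⟩
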